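/- Let $X$ be a Brownian motion with zero drift, variance $\sigma^2$ per unit time ($\sigma>0$) and arbitrary starting value, observed on $[0,1]$. Put $c=X_1-X_0$, $h=\max_{[0,1]}X-X_0$, $l=\min_{[0,1]}X-X_0$, $S_1=(c,h,l)$, and let $S_2=(C,H,L)$ with $C=|c|$, $(H,L)=(h,l)$ if $c>0$ and $(H,L)=(-l,-h)$ otherwise. Consider $$\hat\sigma_1^2=2[(H-C)^2+L^2],\quad \hat\sigma_2^2=C^2,\quad \hat\sigma_3^2=2(H-C-L)C,\quad \hat\sigma_4^2=-\frac{(H-C)L}{2\log 2-5/4}.$$ These four estimators are square integrable and unbiased for $\sigma^2$, and their covariance matrix $\Sigma$ is positive definite. The weight vector $$\alpha=\frac{\Sigma^{-1}\mathbf 1}{\mathbf 1^T\Sigma^{-1}\mathbf 1}$$ does not depend on $\sigma$, agrees with $(0.273520,\,0.160358,\,0.365212,\,0.200910)$ to within $5\cdot10^{-7}$ in each coordinate, and is the unique minimizer of the variance among the unbiased estimators $\sum_i w_i\hat\sigma_i^2$. The estimator $\hat\sigma^2=\sum_i\alpha_i\hat\sigma_i^2$ has variance $1/(\mathbf 1^T\Sigma^{-1}\mathbf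 1)$, which is minimal among all unbiased homogeneous quadratic functions of $S_2$. Moreover, let $\hat\sigma_{GK}^2=g_0(h-l)^2-g_1\bigl(c(h+l)-2hl\bigr)-g_2c^2$ be the Garman–Klass estimator. There are coefficients $g_0,g_1,g_2$, independent of $\sigma$ and within $5\cdot10^{-4}$ of $0.511,\,0.019,\,0.383$ respectively, for which $\hat\sigma_{GK}^2$ is unbiased and of minimal variance among all unbiased homogeneous quadratic functions of $S_1$. Finally, take $\hat\sigma^2$ either with the exact weights $\alpha$ or with the six-decimal weights displayed above. In both cases: - $\hat\sigma^2$ is square integrable and exactly unbiased; - $|\mathrm{Var}(\hat\sigma^2)-0.258658\,\sigma^4|\le 5\cdot10^{-7}\sigma^4$; - its efficiency $\mathrm{Var}(c^2)/\mathrm{Var}(\hat\sigma^2)$ is within $5\cdot10^{-5}$ of $7.7322$; - $\mathrm{Var}(\hat\sigma^2)<\mathrm{Var}(\hat\sigma_{GK}^2)$, where $\hat\sigma_{GK}^2$ (square integrable) is taken either with the exact coefficients $g_k$ or with the rounded ones $0.511,\,0.019,\,0.383$, and in both cases $|\mathrm{Var}(\hat\sigma_{GK}^2)-0.27\,\sigma^4|\le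 0.005\,\sigma^4$. In particular the Garman–Klass estimator is not of minimal variance among unbiased estimators of $\sigma^2$. -/

import Mathlib

open MeasureTheory ProbabilityTheory
open scoped NNReal Matrix

noncomputable section

namespace GarmanKlass

/-- `X` is a Brownian motion with zero drift, variance `σ ^ 2` per unit time (`σ > 0`), and an
arbitrary, possibly random, starting value `X 0`. -/
structure IsZeroDriftBM {Ω : Type*} [MeasurableSpace Ω] (X : ℝ≥0 → Ω → ℝ) (σ : ℝ)
    (P : Measure Ω) : Prop where
  sigma_pos : 0 < σ
  isBrownian : IsBrownianReal (fun t ω => (X t ω - X 0 ω) / σ) P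

/-! Statistics of a path `x` on the time window `[0, 1]`. -/

/-- `c = CLOSE - OPEN`. -/
def closeSpread (x : ℝ≥0 → ℝ) : ℝ := x 1 - x 0

/-- `h = MAX - OPEN`. -/
def highSpread (x : ℝ≥0 → ℝ) : ℝ := sSup (x '' Set.Icc 0 1) - x 0

/-- `l = MIN - OPEN`. -/
def lowSpread (x : ℝ≥0 → ℝ) : ℝ := sInf (x '' Set.Icc 0 1) - x 0

/-- `C = |c|`. -/
def flipClose (x : ℝ≥0 → ℝ) : ℝ := |closeSpread x|

/-- `H = h` if `c > 0`, and `H = -l` otherwise. -/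
def flipHigh (x : ℝ≥0 → ℝ) : ℝ := if 0 < closeSpread x then highSpread x else -lowSpread x

/-- `L = l` if `c > 0`, and `L = -h` otherwise. -/
def flipLow (x : ℝ≥0 → ℝ) : ℝ := if 0 < closeSpread x then lowSpread x else -highSpread x

/-- The statistic `S₁ = (c, h, l)`. -/
def S₁ (x : ℝ≥0 → ℝ) : Fin 3 → ℝ := ![closeSpread x, highSpread x, lowSpread x]

/-- The statistic `S₂ = (C, H, L)`. -/
def S₂ (x : ℝ≥0 → ℝ) : Fin 3 → ℝ := ![flipClose x, flipHigh x, flipLow x]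

/-- The homogeneous quadratic function `v ↦ ∑ i j, A i j * v i * v j`. -/
def quadForm (A : Matrix (Fin 3) (Fin 3) ℝ) (v : Fin 3 → ℝ) : ℝ := v ⬝ᵥ (A *ᵥ v)

/-- The four basic estimators
`2((H-C)² + L²)`, `C²`, `2(H-C-L)C`, `-(H-C)L / (2 log 2 - 5/4)`. -/
def basicEst (i : Fin 4) (x : ℝ≥0 → ℝ) : ℝ :=
  ![2 * ((flipHigh x - flipClose x) ^ 2 + flipLow x ^ 2),
    flipClose x ^ 2,
    2 * (flipHigh x - flipClose x - flipLow x) * flipClose x,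
    -((flipHigh x - flipClose x) * flipLow x) / (2 * Real.log 2 - 5 / 4)] i

/-- The estimator `∑ i, w i * (i-th basic estimator)`. -/
def weightedEst (w : Fin 4 → ℝ) (x : ℝ≥0 → ℝ) : ℝ := ∑ i, w i * basicEst i x

/-- Estimators of Garman-Klass form,
`g₀ (h - l)² - g₁ (c (h + l) - 2 h l) - g₂ c²`. -/
def garmanKlassEst (g : Fin 3 → ℝ) (x : ℝ≥0 → ℝ) : ℝ :=
  g 0 * (highSpread x - lowSpread x) ^ 2
    - g 1 * (closeSpread x * (highSpread x + lowSpread x) - 2 * highSpread x * lowSpread x)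
    - g 2 * closeSpread x ^ 2

/-- The weights of the proposed estimator, as tabulated to six decimals. -/
def roundedWeights : Fin 4 → ℝ := ![0.273520, 0.160358, 0.365212, 0.200910]

/-- The Garman-Klass coefficients, as tabulated to three decimals. -/
def roundedGK : Fin 3 → ℝ := ![0.511, 0.019, 0.383]

/-- The random variable obtained by evaluating the path statistic `T` on the paths of `X`. -/
def onPaths {Ω : Type*} (T : (ℝ≥0 → ℝ) → ℝ) (X : ℝ≥0 → Ω → ℝ) (ω : Ω) : ℝ := T (fun t => X t ω)

/-- `Y` is an integrable random variable with mean `θ`. -/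
def IsUnbiased {Ω : Type*} [MeasurableSpace Ω] (Y : Ω → ℝ) (θ : ℝ) (P : Measure Ω) : Prop :=
  Integrable Y P ∧ ∫ ω, Y ω ∂P = θ

/-- The covariance matrix of the four basic estimators. -/
def covMatrix {Ω : Type*} [MeasurableSpace Ω] (X : ℝ≥0 → Ω → ℝ) (P : Measure Ω) :
    Matrix (Fin 4) (Fin 4) ℝ :=
  Matrix.of fun i j => cov[onPaths (basicEst i) X, onPaths (basicEst j) X; P]

end GarmanKlass

end

/-! Scaling by `σ` and the symmetry `X ↦ -X` reduce every expectation to standard Brownian motion on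
`{c > 0}`. With `a = H - C` and `b = -L`, all estimators are quadratic in `(C, a, b)`, so
unbiasedness involves moments of degree two and covariances involve moments of degree four.

The joint law of `(c, h, l)` comes from a reflection principle without stopping times
(`integral_exit_eq_zero`). If `F` is odd about the boundary points of `S`, the Gaussian semigroup
applied to `F` vanishes at those points. Applying the Markov property at the first grid time outside
`S` shows that paths leaving `S` contribute to the expectation of `F (B 1)` at most a modulus of
continuity, which tends to `0`. For an interval, a periodised set of endpoints turns this into the
method of images: in `measure_both_inter` the event `h ≥ u, l ≤ -v` is described by two series of
Gaussian densities, evaluated at linear forms in `x`, `p = u - x`, `v` with positive coefficients.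

A monomial integrated over the octant against a function of such a form gives inverse powers of the
coefficients times a one-dimensional moment (`lintegral_linear_three`). Hence `lintegral_moment`:
every required moment is rational or a rational multiple of a rapidly convergent series `mixedSum`.
In degree two the series sums to an expression in `log 2`; in degree four there remain four
constants, which are enclosed by partial sums.

The rest is finite-dimensional. The moments are invariant under `a ↔ b` and under the sign of `c`.
The four basic estimators span the quadratics symmetric in `a ↔ b`, and the Garman–Klass form spans
what is left of a quadratic in `(c, h, l)` after averaging over both symmetries. An unbiased
estimator with the same second moment against all unbiased competitors has least variance
(`variance_le_of_momentForm_eq`), and by symmetry this needs checking only inside the reduced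
families (`momentForm_symmWeights`, `momentForm_gkReduction`). There the minimiser is `G⁻¹ m` up to
normalisation. Its decimals follow from `optimum_approx`: a lower bound on the spectrum and the
residual of an explicit approximation control the error. -/

open Filter Topology Set
open scoped ENNReal

noncomputable section
namespace GarmanKlass

/-! ### The reflection principle, by discretising the exit from an open set -/

section

variable {Ω : Type*} [MeasurableSpace Ω] {P : Measure Ω} {B : ℝ≥0 → Ω → ℝ}

/-- The Gaussian semigroup acting on `F`. -/
def heat (F : ℝ → ℝ) (s : ℝ≥0) (x : ℝ) : ℝ := ∫ w, F (x + w) ∂gaussianReal 0 s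

lemma integrable_comp_of_bounded {α : Type*} [MeasurableSpace α] {μ : Measure α}
    [IsFiniteMeasure μ] {F : ℝ → ℝ} (hF : Measurable F) {M : ℝ} (hM : ∀ x, |F x| ≤ M)
    {Y : α → ℝ} (hY : AEMeasurable Y μ) : Integrable (fun a => F (Y a)) μ :=
  Integrable.of_bound (hF.comp_aemeasurable hY).aestronglyMeasurable M
    (ae_of_all _ fun a => by simpa using hM (Y a))

lemma abs_heat_sub_le {F : ℝ → ℝ} {K : ℝ≥0} (hF : LipschitzWith K F) {M : ℝ}
    (hM : ∀ x, |F x| ≤ M) (s : ℝ≥0) (x y : ℝ) : |heat F s x - heat F s y| ≤ K * |x - y| := by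
  have hm : Measurable F := hF.continuous.measurable
  unfold heat
  rw [← integral_sub (integrable_comp_of_bounded hm hM (by fun_prop))
    (integrable_comp_of_bounded hm hM (by fun_prop))]
  have := norm_integral_le_of_norm_le_const (μ := gaussianReal 0 s)
    (f := fun w => F (x + w) - F (y + w)) (C := K * |x - y|) (ae_of_all _ fun w => by
      have h := hF.dist_le_mul (x + w) (y + w)
      rw [Real.dist_eq, Real.dist_eq] at h
      simpa using h)
  simpa using this

lemma abs_heat_le {F : ℝ → ℝ} {M : ℝ} (hM : ∀ x, |F x| ≤ M) (s : ℝ≥0) (x : ℝ) :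
    |heat F s x| ≤ M := by
  have := norm_integral_le_of_norm_le_const (μ := gaussianReal 0 s)
    (f := fun w => F (x + w)) (C := M) (ae_of_all _ fun w => by simpa using hM (x + w))
  simpa [heat] using this

/-- The centred Gaussian is symmetric, so the integral equals its own negative. This cancellation is
the whole source of the reflection principle. -/
lemma heat_eq_zero_of_odd {F : ℝ → ℝ} {z : ℝ} (hz : ∀ y, F (z + y) = -F (z - y)) (s : ℝ≥0) :
    heat F s z = 0 := by
  have h : heat F s z = -heat F s z := by
    have h1 : (gaussianReal 0 s).map (MeasurableEquiv.neg ℝ) = gaussianReal 0 s := by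
      simpa using gaussianReal_map_neg (μ := 0) (v := s)
    conv_lhs => rw [heat, ← h1, (MeasurableEquiv.neg ℝ).measurableEmbedding.integral_map]
    rw [heat, ← integral_neg]
    refine integral_congr_ae (ae_of_all _ fun w => ?_)
    have := hz w
    simp only [MeasurableEquiv.neg_apply]
    rw [this, neg_neg, sub_eq_add_neg]
  linarith

/-- The Markov property at time `t` for events depending on finitely many earlier times. -/
lemma integral_indicator_markov (hB : IsPreBrownianReal B P) {F : ℝ → ℝ} (hF : Measurable F)
    {M : ℝ} (hM : ∀ x, |F x| ≤ M) {t : ℝ≥0} (ht : t ≤ 1) {m : ℕ} {τ : Fin m → ℝ≥0}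
    (hτ : ∀ i, τ i ≤ t) {f : (Fin m → ℝ) → ℝ} (hf : Measurable f) {N : ℝ} (hN : ∀ y, |f y| ≤ N) :
    ∫ ω, f (fun i => B (τ i) ω) * F (B 1 ω) ∂P =
      ∫ ω, f (fun i => B (τ i) ω) * heat F (1 - t) (B t ω) ∂P := by
  have : IsProbabilityMeasure P := hB.isGaussianProcess.isProbabilityMeasure
  set W : Ω → ℝ := fun ω => B 1 ω - B t ω with hW
  set Y : Ω → (Fin m → ℝ) × ℝ := fun ω => (fun i => B (τ i) ω, B t ω) with hY
  have hmB := hB.aemeasurable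
  have hWm : AEMeasurable W P := (hmB 1).sub (hmB t)
  have hYm : AEMeasurable Y P := (aemeasurable_pi_lambda _ fun i => hmB (τ i)).prodMk (hmB t)
  have hind : IndepFun Y W P := by
    have h := (hB.indepFun_shift t).symm
    have hψ : Measurable fun y : ℝ≥0 → ℝ => y (1 - t) := measurable_pi_apply _
    have hφ : Measurable fun y : Set.Iic t → ℝ =>
        (((fun i => y ⟨τ i, hτ i⟩), y ⟨t, Set.mem_Iic.2 le_rfl⟩) : (Fin m → ℝ) × ℝ) :=
      Measurable.prodMk (measurable_pi_lambda _ fun i => measurable_pi_apply _)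
        (measurable_pi_apply _)
    have h2 := h.comp (φ := fun y : Set.Iic t → ℝ =>
        (((fun i => y ⟨τ i, hτ i⟩), y ⟨t, Set.mem_Iic.2 le_rfl⟩) : (Fin m → ℝ) × ℝ))
      (ψ := fun y : ℝ≥0 → ℝ => y (1 - t))
      hφ
      hψ
    have hWe : W = fun ω => B (t + (1 - t)) ω - B t ω := by
      simp [hW, add_tsub_cancel_of_le ht]
    rw [hWe]
    exact h2
  have hlaw : P.map W = gaussianReal 0 (1 - t) := by
    have h := ((hB.shift t).hasLaw_eval (1 - t)).map_eq
    rw [← h]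
    simp [hW, add_tsub_cancel_of_le ht]
  have hjoint := (indepFun_iff_map_prod_eq_prod_map_map hYm hWm).1 hind
  set Ψ : ((Fin m → ℝ) × ℝ) × ℝ → ℝ := fun q => f q.1.1 * F (q.1.2 + q.2) with hΨ
  have hΨm : Measurable Ψ := by fun_prop
  have hΨb : ∀ q, ‖Ψ q‖ ≤ N * M := fun q => by
    rw [hΨ, norm_mul]
    exact mul_le_mul (hN _) (hM _) (norm_nonneg _) ((abs_nonneg _).trans (hN q.1.1))
  have h1 : ∫ ω, f (fun i => B (τ i) ω) * F (B 1 ω) ∂P = ∫ ω, Ψ (Y ω, W ω) ∂P := by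
    congr 1; ext ω; simp [hΨ, hY, hW]
  have : IsProbabilityMeasure (P.map Y) := Measure.isProbabilityMeasure_map hYm
  rw [h1, ← integral_map (f := Ψ) (hYm.prodMk hWm) hΨm.aestronglyMeasurable, hjoint, hlaw,
    integral_prod _ (Integrable.of_bound hΨm.aestronglyMeasurable _ (ae_of_all _ hΨb))]
  have h3 : ∀ y : (Fin m → ℝ) × ℝ, ∫ w, Ψ (y, w) ∂gaussianReal 0 (1 - t) =
      f y.1 * heat F (1 - t) y.2 := fun y => by
    simp only [hΨ, heat]; rw [integral_const_mul]
  have h4 : Measurable fun y : (Fin m → ℝ) × ℝ => f y.1 * heat F (1 - t) y.2 := by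
    have := (hΨm.stronglyMeasurable.integral_prod_right' (ν := gaussianReal 0 (1 - t))).measurable
    simpa only [h3] using this
  simp_rw [h3]
  rw [integral_map hYm h4.aestronglyMeasurable]

/-- The path stays in `S` at the times `0, 1 / n, …, j / n`. -/
def gridStay (S : Set ℝ) (n j : ℕ) (x : ℝ≥0 → ℝ) : Prop := ∀ i ≤ j, x (i / n) ∈ S

open Classical in
/-- Indicator of `gridStay`. -/
def gridInd (S : Set ℝ) (n j : ℕ) (x : ℝ≥0 → ℝ) : ℝ := if gridStay S n j x then 1 else 0

lemma gridInd_of_stay {S : Set ℝ} {n j : ℕ} {x : ℝ≥0 → ℝ} (h : ∀ i ≤ j, x (i / n) ∈ S) :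
    gridInd S n j x = 1 := if_pos h

lemma gridInd_of_not {S : Set ℝ} {n j : ℕ} {x : ℝ≥0 → ℝ} (h : ¬ ∀ i ≤ j, x (i / n) ∈ S) :
    gridInd S n j x = 0 := if_neg h

lemma gridStay_succ {S : Set ℝ} {n j : ℕ} {x : ℝ≥0 → ℝ} (h : gridStay S n (j + 1) x) :
    gridStay S n j x := fun i hi => h i (by omega)

lemma gridInd_sub_nonneg (S : Set ℝ) (n j : ℕ) (x : ℝ≥0 → ℝ) :
    0 ≤ gridInd S n j x - gridInd S n (j + 1) x := by
  unfold gridInd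
  by_cases h : gridStay S n (j + 1) x
  · simp [h, gridStay_succ h]
  · rw [if_neg h]; split_ifs <;> simp

lemma gridInd_mem (S : Set ℝ) (n j : ℕ) (x : ℝ≥0 → ℝ) : |gridInd S n j x| ≤ 1 := by
  unfold gridInd; split_ifs <;> simp

lemma aemeasurable_gridInd (hB : IsPreBrownianReal B P) {S : Set ℝ} (hS : MeasurableSet S)
    (n j : ℕ) : AEMeasurable (fun ω => gridInd S n j (fun t => B t ω)) P := by
  classical
  have : (fun ω => gridInd S n j (fun t => B t ω)) =
      fun ω => ∏ i ∈ Finset.range (j + 1), S.indicator (fun _ => (1 : ℝ)) (B (i / n) ω) := by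
    ext ω
    unfold gridInd gridStay
    split_ifs with h
    · symm
      apply Finset.prod_eq_one
      intro i hi
      exact Set.indicator_of_mem (h i (by simpa [Nat.lt_succ_iff] using hi)) _
    · push Not at h
      obtain ⟨i, hi, hx⟩ := h
      symm
      exact Finset.prod_eq_zero (i := i) (by simp; omega) (Set.indicator_of_notMem hx _)
  rw [this]
  refine Finset.aemeasurable_fun_prod _ fun i _ => ?_
  exact (measurable_const.indicator hS).comp_aemeasurable (hB.aemeasurable _)

/-- A path leaving `S` on the grid, and its contribution to the expectation. -/
lemma abs_integral_gridExit_le (hB : IsPreBrownianReal B P) {S : Set ℝ} (hS : MeasurableSet S)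
    {F : ℝ → ℝ} {K : ℝ≥0} (hF : LipschitzWith K F) {M : ℝ} (hM : ∀ x, |F x| ≤ M)
    (hodd : ∀ x ∈ S, ∀ y ∉ S, ∃ z, |y - z| ≤ |y - x| ∧ ∀ w, F (z + w) = -F (z - w))
    {n j : ℕ} (hj : j < n) :
    |∫ ω, (gridInd S n j (fun t => B t ω) - gridInd S n (j + 1) (fun t => B t ω)) *
        F (B 1 ω) ∂P| ≤
      ∫ ω, (gridInd S n j (fun t => B t ω) - gridInd S n (j + 1) (fun t => B t ω)) *
        min M (K * |B ((j + 1 : ℕ) / n) ω - B (j / n) ω|) ∂P := by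
  classical
  have : IsProbabilityMeasure P := hB.isGaussianProcess.isProbabilityMeasure
  have hM0 : 0 ≤ M := (abs_nonneg _).trans (hM 0)
  have hn : (n : ℝ≥0) ≠ 0 := by have : n ≠ 0 := by omega
                                exact_mod_cast this
  set t : ℝ≥0 := (j + 1 : ℕ) / n with ht
  have ht1 : t ≤ 1 := by
    rw [ht, div_le_one (by positivity)]; exact_mod_cast hj
  -- The indicator of first leaving `S` at grid index `j + 1` depends only on the times `i / n` with
  -- `i ≤ j + 1`, all at most `t`; this is what the Markov property at `t` requires.
  let f : (Fin (j + 2) → ℝ) → ℝ := fun y =>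
    (∏ i : Fin (j + 1), S.indicator (fun _ => (1 : ℝ)) (y i.castSucc)) -
      ∏ i : Fin (j + 2), S.indicator (fun _ => (1 : ℝ)) (y i)
  have hind : ∀ (k : ℕ) (x : ℝ≥0 → ℝ), gridInd S n k x =
      ∏ i : Fin (k + 1), S.indicator (fun _ => (1 : ℝ)) (x ((i : ℕ) / n)) := by
    intro k x
    unfold gridInd gridStay
    split_ifs with h
    · refine (Finset.prod_eq_one fun i _ => ?_).symm
      exact Set.indicator_of_mem (h i (Nat.lt_succ_iff.1 i.is_lt)) _
    · push Not at h
      obtain ⟨i, hi, hx⟩ := h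
      exact (Finset.prod_eq_zero (i := (⟨i, by omega⟩ : Fin (k + 1))) (Finset.mem_univ _)
        (Set.indicator_of_notMem hx _)).symm
  have hfe : ∀ ω, gridInd S n j (fun t => B t ω) - gridInd S n (j + 1) (fun t => B t ω) =
      f (fun i => B ((i : ℕ) / n) ω) := by
    intro ω
    rw [hind, hind]; rfl
  have hfm : Measurable f := by
    have h1 : Measurable (S.indicator (fun _ => (1 : ℝ))) := measurable_const.indicator hS
    refine Measurable.sub ?_ ?_
    · exact Finset.measurable_fun_prod _ fun i _ => h1.comp (measurable_pi_apply _)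
    · exact Finset.measurable_fun_prod _ fun i _ => h1.comp (measurable_pi_apply _)
  have hprod : ∀ (k : ℕ) (y : Fin k → ℝ),
      |∏ i, S.indicator (fun _ => (1 : ℝ)) (y i)| ≤ 1 := by
    intro k y
    rw [Finset.abs_prod]
    refine Finset.prod_le_one (fun _ _ => abs_nonneg _) fun i _ => ?_
    unfold Set.indicator; split_ifs <;> simp
  have hfb : ∀ y, |f y| ≤ 2 := fun y => by
    have h1 := hprod (j + 1) (fun i => y i.castSucc)
    have h2 := hprod (j + 2) y
    have h3 := abs_sub (∏ i : Fin (j + 1), S.indicator (fun _ => (1 : ℝ)) (y i.castSucc))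
      (∏ i : Fin (j + 2), S.indicator (fun _ => (1 : ℝ)) (y i))
    show |_ - _| ≤ _
    linarith
  have hmark : ∫ ω, (gridInd S n j (fun t => B t ω) - gridInd S n (j + 1) (fun t => B t ω)) *
        F (B 1 ω) ∂P =
      ∫ ω, (gridInd S n j (fun t => B t ω) - gridInd S n (j + 1) (fun t => B t ω)) *
        heat F (1 - t) (B t ω) ∂P := by
    simp_rw [hfe]
    refine integral_indicator_markov hB hF.continuous.measurable hM ht1
      (τ := fun i : Fin (j + 2) => (i : ℕ) / n) (fun i => ?_) hfm hfb
    rw [ht]; gcongr; omega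
  rw [hmark]
  refine (abs_integral_le_integral_abs).trans ?_
  refine integral_mono_of_nonneg (ae_of_all _ fun ω => abs_nonneg _) ?_ (ae_of_all _ fun ω => ?_)
  · refine Integrable.of_bound (C := 2 * M) ?_ (ae_of_all _ fun ω => ?_)
    · exact (((aemeasurable_gridInd hB hS n j).sub
        (aemeasurable_gridInd hB hS n (j + 1))).mul (aemeasurable_const.min
          (((hB.aemeasurable _).sub (hB.aemeasurable _)).norm.const_mul _))).aestronglyMeasurable
    · rw [norm_mul]
      refine mul_le_mul (by rw [hfe, Real.norm_eq_abs]; exact hfb fun i => B ((i : ℕ) / n) ω) ?_ (norm_nonneg _) (by norm_num)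
      rw [Real.norm_eq_abs, abs_of_nonneg (le_min hM0 (by positivity))]
      exact min_le_left _ _
  · have h0 := gridInd_sub_nonneg S n j (fun t => B t ω)
    show |_ * _| ≤ _ * _
    rw [abs_mul, abs_of_nonneg h0]
    -- On the exit event the path jumps from `x ∈ S` to `y ∉ S` within one grid step. The centre `z`
    -- supplied by `hodd` is no farther from `y` than `x` is, and the semigroup vanishes at `z`, so
    -- the Lipschitz bound leaves only `K` times the increment.
    by_cases hex : gridStay S n j (fun t => B t ω) ∧ ¬ gridStay S n (j + 1) (fun t => B t ω)
    · refine mul_le_mul_of_nonneg_left (le_min (abs_heat_le hM _ _) ?_) h0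
      have hx : B (j / n) ω ∈ S := hex.1 j le_rfl
      have hy : B t ω ∉ S := by
        intro hy
        refine hex.2 fun i hi => ?_
        rcases Nat.lt_or_ge i (j + 1) with h | h
        · exact hex.1 i (by omega)
        · obtain rfl : i = j + 1 := by omega
          exact hy
      obtain ⟨z, hz, hz2⟩ := hodd _ hx _ hy
      have h1 := abs_heat_sub_le hF hM (1 - t) (B t ω) z
      rw [heat_eq_zero_of_odd hz2, sub_zero] at h1
      exact h1.trans (mul_le_mul_of_nonneg_left hz K.2)
    · have : gridInd S n j (fun t => B t ω) - gridInd S n (j + 1) (fun t => B t ω) = 0 := by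
        unfold gridInd
        by_cases h : gridStay S n (j + 1) (fun t => B t ω)
        · simp [h, gridStay_succ h]
        · have : ¬ gridStay S n j (fun t => B t ω) := fun h' => hex ⟨h', h⟩
          simp [h, this]
      rw [this]; simp

/-- A grid cannot see a path that merely touches the boundary, which `hcl` excludes almost surely.
Otherwise the path is outside `closure S` on a whole neighbourhood of times, and fine grids meet
that neighbourhood. -/
lemma tendsto_gridInd (hB : IsBrownianReal B P) {S : Set ℝ}
    (hcl : ∀ᵐ ω ∂P, (∃ t ≤ 1, B t ω ∉ S) → ∃ t ≤ 1, B t ω ∉ closure S) :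
    ∀ᵐ ω ∂P, Tendsto (fun n => gridInd S n n (fun t => B t ω)) atTop
      (𝓝 ({ω | ∃ t ≤ 1, B t ω ∉ S}ᶜ.indicator (fun _ => 1) ω)) := by
  filter_upwards [hB.cont, hcl] with ω hω hc
  by_cases hω2 : ω ∈ {ω | ∃ t ≤ 1, B t ω ∉ S}
  · rw [Set.indicator_of_notMem (by simpa using hω2)]
    obtain ⟨t, ht, htS⟩ := hc hω2
    refine tendsto_const_nhds.congr' ?_
    have hnb : ∀ᶠ s in 𝓝 t, B s ω ∉ closure S :=
      hω.continuousAt.eventually (isClosed_closure.isOpen_compl.mem_nhds htS)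
    rw [Metric.eventually_nhds_iff] at hnb
    obtain ⟨δ, hδ, hd⟩ := hnb
    obtain ⟨N, hN⟩ := exists_nat_gt (1 / δ)
    filter_upwards [eventually_ge_atTop (N + 1)] with n hn
    have hn0 : (0 : ℝ) < n := by exact_mod_cast (by omega : 0 < n)
    have hgn : gridInd S n n (fun t => B t ω) = 0 := by
      refine gridInd_of_not fun hall => ?_
      have hfl : ⌊t * n⌋₊ ≤ n := by
        have : t * n ≤ n := by
          calc t * n ≤ 1 * n := by gcongr
            _ = n := one_mul _
        exact Nat.floor_le_of_le this
      refine hd (y := ((⌊t * n⌋₊ : ℕ) : ℝ≥0) / n) ?_ (subset_closure (hall _ hfl))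
      rw [NNReal.dist_eq]
      push_cast
      have e1 : ((⌊t * n⌋₊ : ℕ) : ℝ) ≤ t * n := by
        exact_mod_cast Nat.floor_le (zero_le (a := t * n))
      have e2 : (t : ℝ) * n < ((⌊t * n⌋₊ : ℕ) : ℝ) + 1 := by
        exact_mod_cast Nat.lt_floor_add_one (t * n)
      rw [div_lt_iff₀ hδ] at hN
      have e3 : (N : ℝ) ≤ n := by exact_mod_cast (by omega : N ≤ n)
      have e4 : ((⌊t * n⌋₊ : ℕ) : ℝ) / n - t = (((⌊t * n⌋₊ : ℕ) : ℝ) - t * n) / n := by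
        field_simp
      rw [e4, abs_div, abs_of_pos hn0, div_lt_iff₀ hn0, abs_lt]
      constructor <;> nlinarith
    exact hgn.symm
  · rw [Set.indicator_of_mem (by simpa using hω2)]
    refine tendsto_const_nhds.congr' ?_
    filter_upwards [eventually_ge_atTop 1] with n hn
    have hn0 : (0 : ℝ≥0) < n := by exact_mod_cast (by omega : 0 < n)
    have hgn : gridInd S n n (fun t => B t ω) = 1 := by
      refine gridInd_of_stay fun i hi => ?_
      by_contra hx
      exact hω2 ⟨i / n, by rw [div_le_one hn0]; exact_mod_cast hi, hx⟩
    exact hgn.symm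

/-- The exit event is an uncountable union over times; its measurability is read off from the almost
sure limit of the grid indicators. -/
lemma nullMeasurableSet_exit (hB : IsBrownianReal B P) {S : Set ℝ} (hS : IsOpen S)
    (hcl : ∀ᵐ ω ∂P, (∃ t ≤ 1, B t ω ∉ S) → ∃ t ≤ 1, B t ω ∉ closure S) :
    NullMeasurableSet {ω | ∃ t ≤ 1, B t ω ∉ S} P := by
  have h := aemeasurable_of_tendsto_metrizable_ae' (fun n =>
    aemeasurable_gridInd hB.toIsPreBrownianReal hS.measurableSet n n) (tendsto_gridInd hB hcl)
  exact ((aemeasurable_indicator_const_iff (1 : ℝ)).1 h).of_compl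

/-- **Reflection principle** (functional form): if `F` is odd about every boundary point of `S`,
then paths leaving `S` before time `1` contribute nothing to the expectation of `F (B 1)`. -/
theorem integral_exit_eq_zero (hB : IsBrownianReal B P) {S : Set ℝ} (hS : IsOpen S)
    (h0S : (0 : ℝ) ∈ S) {F : ℝ → ℝ} {K : ℝ≥0} (hF : LipschitzWith K F) {M : ℝ}
    (hM : ∀ x, |F x| ≤ M)
    (hodd : ∀ x ∈ S, ∀ y ∉ S, ∃ z, |y - z| ≤ |y - x| ∧ ∀ w, F (z + w) = -F (z - w))
    (hcl : ∀ᵐ ω ∂P, (∃ t ≤ 1, B t ω ∉ S) → ∃ t ≤ 1, B t ω ∉ closure S) :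
    ∫ ω, {ω | ∃ t ≤ 1, B t ω ∉ S}.indicator (fun ω => F (B 1 ω)) ω ∂P = 0 := by
  classical
  have hP : IsProbabilityMeasure P := hB.isGaussianProcess.isProbabilityMeasure
  have hM0 : 0 ≤ M := (abs_nonneg _).trans (hM 0)
  have hB' := hB.toIsPreBrownianReal
  set g : ℕ → ℕ → Ω → ℝ := fun n j ω => gridInd S n j (fun t => B t ω) with hg
  have hgm : ∀ n j, AEMeasurable (g n j) P := fun n j => aemeasurable_gridInd hB' hS.measurableSet n j
  have hF1 : AEMeasurable (fun ω => F (B 1 ω)) P :=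
    hF.continuous.measurable.comp_aemeasurable (hB.aemeasurable 1)
  -- The exit indicators are nonnegative with telescoping sum at most `1`. Thus `R n ω` is bounded
  -- by any common bound on the truncated increments, not by their sum.
  set R : ℕ → Ω → ℝ := fun n ω => ∑ j ∈ Finset.range n, (g n j ω - g n (j + 1) ω) *
        min M (K * |B ((j + 1 : ℕ) / n) ω - B (j / n) ω|) with hR
  have hRm : ∀ n, AEMeasurable (R n) P := fun n =>
    Finset.aemeasurable_fun_sum _ fun j _ => ((hgm n j).sub (hgm n (j + 1))).mul
      (aemeasurable_const.min
          (((hB.aemeasurable _).sub (hB.aemeasurable _)).norm.const_mul _))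
  have hterm : ∀ n ω (c : ℝ), 0 ≤ c → (∀ j < n,
      min M (K * |B ((j + 1 : ℕ) / n) ω - B (j / n) ω|) ≤ c) → R n ω ≤ c := by
    intro n ω c hc h
    calc R n ω ≤ ∑ j ∈ Finset.range n, (g n j ω - g n (j + 1) ω) * c := by
          refine Finset.sum_le_sum fun j hj => ?_
          exact mul_le_mul_of_nonneg_left (h j (by simpa using hj)) (gridInd_sub_nonneg _ _ _ _)
      _ = (g n 0 ω - g n n ω) * c := by
          rw [← Finset.sum_mul, Finset.sum_range_sub']
      _ ≤ 1 * c := by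
          refine mul_le_mul_of_nonneg_right ?_ hc
          simp only [hg, gridInd]; split_ifs <;> norm_num
      _ = c := one_mul c
  have hR0 : ∀ n ω, 0 ≤ R n ω := fun n ω => Finset.sum_nonneg fun j _ =>
    mul_nonneg (gridInd_sub_nonneg _ _ _ _) (le_min hM0 (by positivity))
  have hRint : ∀ n, |∫ ω, (g n 0 ω - g n n ω) * F (B 1 ω) ∂P| ≤ ∫ ω, R n ω ∂P := by
    intro n
    have hi : ∀ j, Integrable (fun ω => (g n j ω - g n (j + 1) ω) * F (B 1 ω)) P := fun j => by
      refine Integrable.of_bound (C := 2 * M)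
        (((hgm n j).sub (hgm n (j + 1))).mul hF1).aestronglyMeasurable (ae_of_all _ fun ω => ?_)
      rw [norm_mul]
      refine mul_le_mul ?_ (hM _) (norm_nonneg _) (by norm_num)
      have h1 := gridInd_mem S n j (fun t => B t ω)
      have h2 := gridInd_mem S n (j + 1) (fun t => B t ω)
      exact (abs_sub _ _).trans (by simp only [hg]; linarith)
    have hi2 : ∀ j, Integrable (fun ω => (g n j ω - g n (j + 1) ω) *
        min M (K * |B ((j + 1 : ℕ) / n) ω - B (j / n) ω|)) P := fun j => by
      refine Integrable.of_bound (C := 2 * M)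
        (((hgm n j).sub (hgm n (j + 1))).mul (aemeasurable_const.min
          (((hB.aemeasurable _).sub (hB.aemeasurable _)).norm.const_mul _))).aestronglyMeasurable
        (ae_of_all _ fun ω => ?_)
      rw [norm_mul]
      refine mul_le_mul ?_ ?_ (norm_nonneg _) (by norm_num)
      · have h1 := gridInd_mem S n j (fun t => B t ω)
        have h2 := gridInd_mem S n (j + 1) (fun t => B t ω)
        exact (abs_sub _ _).trans (by simp only [hg]; linarith)
      · rw [Real.norm_eq_abs, abs_of_nonneg (le_min hM0 (by positivity))]
        exact min_le_left _ _
    have hsum : ∀ ω, (g n 0 ω - g n n ω) * F (B 1 ω) =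
        ∑ j ∈ Finset.range n, (g n j ω - g n (j + 1) ω) * F (B 1 ω) := fun ω => by
      rw [← Finset.sum_mul, Finset.sum_range_sub']
    simp_rw [hsum]
    rw [integral_finsetSum _ fun j _ => hi j, hR, integral_finsetSum _ fun j _ => hi2 j]
    refine (Finset.abs_sum_le_sum_abs _ _).trans (Finset.sum_le_sum fun j hj => ?_)
    exact abs_integral_gridExit_le hB' hS.measurableSet hF hM hodd (by simpa using hj)
  have hRlim : Tendsto (fun n => ∫ ω, R n ω ∂P) atTop (𝓝 0) := by
    have := tendsto_integral_of_dominated_convergence (μ := P) (F := R) (f := fun _ => 0)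
      (fun _ => M) (fun n => (hRm n).aestronglyMeasurable) (integrable_const M)
      (fun n => ae_of_all _ fun ω => by
        rw [Real.norm_eq_abs, abs_of_nonneg (hR0 n ω)]
        exact hterm n ω M hM0 fun j _ => min_le_left _ _) ?_
    · simpa using this
    filter_upwards [hB.cont] with ω hω
    rw [Metric.tendsto_atTop]
    intro ε hε
    have huc : UniformContinuousOn (fun t => B t ω) (Set.Icc 0 1) :=
      isCompact_Icc.uniformContinuousOn_of_continuous hω.continuousOn
    rw [Metric.uniformContinuousOn_iff] at huc
    -- The denominator has `K + 1` in place of `K` so that `K = 0` is allowed.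
    obtain ⟨δ, hδ, hd⟩ := huc (ε / (2 * (K + 1))) (by positivity)
    obtain ⟨N, hN⟩ := exists_nat_gt (1 / δ)
    refine ⟨N, fun n hn => ?_⟩
    rw [Real.dist_eq, sub_zero, abs_of_nonneg (hR0 n ω)]
    refine lt_of_le_of_lt (hterm n ω (ε / 2) (by positivity) fun j hj => ?_) (by linarith)
    have hn0 : (0 : ℝ) < n := by exact_mod_cast (by omega : 0 < n)
    have hn0' : (0 : ℝ≥0) < n := by exact_mod_cast hn0
    have h1 := hd ((j + 1 : ℕ) / n) ⟨by positivity, by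
        rw [div_le_one hn0']; exact_mod_cast hj⟩ (j / n) ⟨by positivity, by
        rw [div_le_one hn0']; exact_mod_cast hj.le⟩ (by
          rw [NNReal.dist_eq]
          push_cast
          rw [← sub_div, add_sub_cancel_left, abs_of_pos (by positivity),
            div_lt_iff₀ hn0]
          rw [div_lt_iff₀ hδ] at hN
          have : (N : ℝ) ≤ n := by exact_mod_cast hn
          nlinarith)
    rw [Real.dist_eq] at h1
    refine (min_le_right _ _).trans ?_
    calc (K : ℝ) * |B ((j + 1 : ℕ) / n) ω - B (j / n) ω| ≤ (K + 1) * (ε / (2 * (K + 1))) := by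
          refine mul_le_mul (by simp) h1.le (abs_nonneg _) (by positivity)
      _ = ε / 2 := by field_simp
  have hzero : Tendsto (fun n => ∫ ω, (g n 0 ω - g n n ω) * F (B 1 ω) ∂P) atTop (𝓝 0) :=
    squeeze_zero_norm (fun n => by simpa using hRint n) hRlim
  set D : Set Ω := {ω | ∃ t ≤ 1, B t ω ∉ S} with hD
  -- Since `B 0 = 0 ∈ S` almost surely, `g n 0 = 1`, and the difference tends to the indicator of
  -- the exit event.
  have hpt : ∀ᵐ ω ∂P, Tendsto (fun n => (g n 0 ω - g n n ω) * F (B 1 ω)) atTop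
      (𝓝 (D.indicator (fun ω => F (B 1 ω)) ω)) := by
    filter_upwards [tendsto_gridInd hB hcl, hB.eval_zero_ae_eq_zero] with ω hω h0
    have hg0 : ∀ n, g n 0 ω = 1 := fun n => by
      refine gridInd_of_stay fun i hi => ?_
      obtain rfl : i = 0 := by omega
      simpa [h0] using h0S
    simp only [hg0]
    have h1 := (tendsto_const_nhds (x := (1 : ℝ))).sub hω |>.mul_const (F (B 1 ω))
    by_cases hω2 : ω ∈ D
    · rw [Set.indicator_of_mem hω2]
      rwa [Set.indicator_of_notMem (show ω ∉ Dᶜ from fun h => h hω2), sub_zero, one_mul] at h1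
    · rw [Set.indicator_of_notMem hω2]
      rwa [Set.indicator_of_mem (show ω ∈ Dᶜ from hω2), sub_self, zero_mul] at h1
  have hlim := tendsto_integral_of_dominated_convergence (μ := P) (fun _ => 2 * M)
      (fun n => (((hgm n 0).sub (hgm n n)).mul hF1).aestronglyMeasurable)
      (integrable_const (2 * M)) (fun n => ae_of_all _ fun ω => by
        show ‖(g n 0 ω - g n n ω) * F (B 1 ω)‖ ≤ _
        rw [norm_mul]
        refine mul_le_mul ?_ (hM _) (norm_nonneg _) (by norm_num)
        have h1 := gridInd_mem S n 0 (fun t => B t ω)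
        have h2 := gridInd_mem S n n (fun t => B t ω)
        exact (abs_sub _ _).trans (by simp only [hg]; linarith)) hpt
  exact tendsto_nhds_unique hlim hzero

lemma lipschitzWith_min_infDist (m : ℝ≥0) (T : Set ℝ) :
    LipschitzWith m fun x => min 1 (m * Metric.infDist x T) := by
  have h1 : LipschitzWith m fun x => (m : ℝ) * Metric.infDist x T := by
    refine LipschitzWith.of_dist_le_mul fun x y => ?_
    have := (Metric.lipschitz_infDist_pt T).dist_le_mul x y
    rw [Real.dist_eq] at this ⊢
    rw [← mul_sub, abs_mul, NNReal.abs_eq]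
    simpa using mul_le_mul_of_nonneg_left this m.2
  simpa using (LipschitzWith.const' (K := m) (1 : ℝ)).min h1

/-- Lipschitz functions increasing to the indicator of an open set carry the functional reflection
principle over to events. The complement must be nonempty because `infDist` to the empty set is `0`.
-/
lemma tendsto_min_infDist {O : Set ℝ} (hO : IsOpen O) (hne : Oᶜ.Nonempty) (x : ℝ) :
    Tendsto (fun m : ℕ => min 1 (((m : ℝ≥0) : ℝ) * Metric.infDist x Oᶜ)) atTop
      (𝓝 (O.indicator (fun _ => 1) x)) := by
  by_cases hx : x ∈ O
  · have hd : 0 < Metric.infDist x Oᶜ := by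
      rw [← hO.isClosed_compl.notMem_iff_infDist_pos hne]; simpa using hx
    rw [Set.indicator_of_mem hx]
    refine tendsto_const_nhds.congr' ?_
    obtain ⟨N, hN⟩ := exists_nat_gt (1 / Metric.infDist x Oᶜ)
    filter_upwards [eventually_ge_atTop N] with n hn
    rw [div_lt_iff₀ hd] at hN
    have : (N : ℝ) ≤ n := by exact_mod_cast hn
    rw [min_eq_left]
    push_cast
    nlinarith
  · rw [Set.indicator_of_notMem hx, Metric.infDist_zero_of_mem (by simpa using hx)]
    simp

lemma infDist_compl_reflect {O O' : Set ℝ} {z : ℝ} (h : ∀ w, z + w ∈ O ↔ z - w ∈ O') (w : ℝ) :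
    Metric.infDist (z + w) Oᶜ = Metric.infDist (z - w) O'ᶜ := by
  have hΦ : Isometry fun x : ℝ => 2 * z - x := Isometry.of_dist_eq fun x y => by
    rw [Real.dist_eq, Real.dist_eq, ← abs_neg]; congr 1; ring
  have himg : (fun x : ℝ => 2 * z - x) '' Oᶜ = O'ᶜ := by
    ext y
    simp only [Set.mem_image, Set.mem_compl_iff]
    constructor
    · rintro ⟨x, hx, rfl⟩
      have := h (x - z)
      rw [add_sub_cancel, show z - (x - z) = 2 * z - x by ring] at this
      rwa [← this]
    · intro hy
      refine ⟨2 * z - y, fun hx => hy ?_, by ring⟩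
      have := h (z - y)
      rw [show z + (z - y) = 2 * z - y by ring, sub_sub_cancel] at this
      exact this.1 hx
  have := Metric.infDist_image hΦ (x := z + w) (t := Oᶜ)
  rw [himg] at this
  rw [← this]; congr 1; ring

/-- **Reflection principle** for events: `O` and `O'` are exchanged by the reflections at the
boundary points of `S`. -/
theorem measure_exit_inter_eq (hB : IsBrownianReal B P) {S : Set ℝ} (hS : IsOpen S)
    (h0S : (0 : ℝ) ∈ S) {O O' : Set ℝ} (hO : IsOpen O) (hO' : IsOpen O') (hne : Oᶜ.Nonempty)
    (hne' : O'ᶜ.Nonempty)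
    (hodd : ∀ x ∈ S, ∀ y ∉ S, ∃ z, |y - z| ≤ |y - x| ∧ ∀ w, z + w ∈ O ↔ z - w ∈ O')
    (hcl : ∀ᵐ ω ∂P, (∃ t ≤ 1, B t ω ∉ S) → ∃ t ≤ 1, B t ω ∉ closure S) :
    P ({ω | ∃ t ≤ 1, B t ω ∉ S} ∩ B 1 ⁻¹' O) = P ({ω | ∃ t ≤ 1, B t ω ∉ S} ∩ B 1 ⁻¹' O') := by
  have hP : IsProbabilityMeasure P := hB.isGaussianProcess.isProbabilityMeasure
  set D : Set Ω := {ω | ∃ t ≤ 1, B t ω ∉ S} with hD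
  have hDm : NullMeasurableSet D P := nullMeasurableSet_exit hB hS hcl
  -- The approximations of `O` and `O'` are exchanged by each reflection, so their difference is odd
  -- about every centre.
  let F : ℕ → ℝ → ℝ := fun m x => min 1 (((m : ℝ≥0) : ℝ) * Metric.infDist x Oᶜ) -
    min 1 (((m : ℝ≥0) : ℝ) * Metric.infDist x O'ᶜ)
  have hFL : ∀ m : ℕ, LipschitzWith ((m : ℝ≥0) + (m : ℝ≥0)) (F m) := fun m =>
    (lipschitzWith_min_infDist _ _).sub (lipschitzWith_min_infDist _ _)
  have hFb : ∀ m x, |F m x| ≤ 1 := fun m x => by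
    have h1 : 0 ≤ min 1 (((m : ℝ≥0) : ℝ) * Metric.infDist x Oᶜ) :=
      le_min zero_le_one (mul_nonneg (by positivity) Metric.infDist_nonneg)
    have h2 : 0 ≤ min 1 (((m : ℝ≥0) : ℝ) * Metric.infDist x O'ᶜ) :=
      le_min zero_le_one (mul_nonneg (by positivity) Metric.infDist_nonneg)
    have h3 := min_le_left 1 (((m : ℝ≥0) : ℝ) * Metric.infDist x Oᶜ)
    have h4 := min_le_left 1 (((m : ℝ≥0) : ℝ) * Metric.infDist x O'ᶜ)
    rw [abs_le]; constructor <;> simp only [F] <;> linarith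
  have hzero : ∀ m, ∫ ω, D.indicator (fun ω => F m (B 1 ω)) ω ∂P = 0 := by
    intro m
    refine integral_exit_eq_zero hB hS h0S (hFL m) (hFb m) (fun x hx y hy => ?_) hcl
    obtain ⟨z, hz, hz2⟩ := hodd x hx y hy
    refine ⟨z, hz, fun w => ?_⟩
    have e1 := infDist_compl_reflect hz2 w
    have e2 := infDist_compl_reflect hz2 (-w)
    rw [← sub_eq_add_neg, sub_neg_eq_add] at e2
    simp only [F]
    rw [e1, e2]; ring
  have hB1 := hB.aemeasurable 1
  have hlim := tendsto_integral_of_dominated_convergence (μ := P)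
    (F := fun m => D.indicator (fun ω => F m (B 1 ω)))
    (f := D.indicator (fun ω => O.indicator (fun _ => (1 : ℝ)) (B 1 ω) -
      O'.indicator (fun _ => (1 : ℝ)) (B 1 ω)))
    (fun _ => 1) (fun m => (((hFL m).continuous.measurable.comp_aemeasurable hB1).indicator₀
        hDm).aestronglyMeasurable)
    (integrable_const 1) (fun m => ae_of_all _ fun ω => by
      refine (norm_indicator_le_norm_self _ _).trans (hFb m _)) (ae_of_all _ fun ω => by
      by_cases hω : ω ∈ D
      · simp only [Set.indicator_of_mem hω]
        exact (tendsto_min_infDist hO hne _).sub (tendsto_min_infDist hO' hne' _)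
      · simp only [Set.indicator_of_notMem hω]
        exact tendsto_const_nhds)
  simp_rw [hzero] at hlim
  have h0 := tendsto_nhds_unique hlim tendsto_const_nhds
  have hmO : ∀ {T : Set ℝ}, IsOpen T → NullMeasurableSet (D ∩ B 1 ⁻¹' T) P := fun hT =>
    hDm.inter (hB1.nullMeasurableSet_preimage hT.measurableSet)
  have hsplit : (D.indicator (fun ω => O.indicator (fun _ => (1 : ℝ)) (B 1 ω) -
      O'.indicator (fun _ => (1 : ℝ)) (B 1 ω))) = fun ω =>
      (D ∩ B 1 ⁻¹' O).indicator (fun _ => (1 : ℝ)) ω -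
      (D ∩ B 1 ⁻¹' O').indicator (fun _ => (1 : ℝ)) ω := by
    ext ω
    by_cases hω : ω ∈ D
    · have hi : ∀ T : Set ℝ, (D ∩ B 1 ⁻¹' T).indicator (fun _ => (1 : ℝ)) ω =
          T.indicator (fun _ => 1) (B 1 ω) := fun T => by
        by_cases hT : B 1 ω ∈ T
        · rw [Set.indicator_of_mem hT, Set.indicator_of_mem (show ω ∈ D ∩ B 1 ⁻¹' T from ⟨hω, hT⟩)]
        · rw [Set.indicator_of_notMem hT, Set.indicator_of_notMem fun h => hT h.2]
      rw [Set.indicator_of_mem hω, hi, hi]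
    · rw [Set.indicator_of_notMem hω, Set.indicator_of_notMem fun h => hω h.1,
        Set.indicator_of_notMem fun h => hω h.1, sub_zero]
  have hint : ∀ {T : Set ℝ}, IsOpen T →
      Integrable ((D ∩ B 1 ⁻¹' T).indicator (fun _ => (1 : ℝ))) P := fun hT =>
    (integrable_const (1 : ℝ)).indicator₀ (hmO hT)
  have hval : ∀ {T : Set ℝ}, IsOpen T →
      ∫ ω, (D ∩ B 1 ⁻¹' T).indicator (fun _ => (1 : ℝ)) ω ∂P = P.real (D ∩ B 1 ⁻¹' T) :=
    fun hT => by
      rw [integral_indicator₀ (hmO hT)]; simp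
  rw [hsplit, integral_sub (hint hO) (hint hO'), hval hO, hval hO', sub_eq_zero] at h0
  exact (measureReal_eq_measureReal_iff).1 h0

end

/-! ### Extremes of a path, and the images method for one and two barriers -/

section

section Paths

variable {x : ℝ≥0 → ℝ}

lemma bddAbove_image_Icc (hx : Continuous x) : BddAbove (x '' Icc 0 1) :=
  (isCompact_Icc.image hx).bddAbove

lemma bddBelow_image_Icc (hx : Continuous x) : BddBelow (x '' Icc 0 1) :=
  (isCompact_Icc.image hx).bddBelow

lemma le_highSpread (hx : Continuous x) {t : ℝ≥0} (ht : t ≤ 1) : x t - x 0 ≤ highSpread x :=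
  sub_le_sub_right (le_csSup (bddAbove_image_Icc hx) ⟨t, ⟨zero_le, ht⟩, rfl⟩) _

lemma lowSpread_le (hx : Continuous x) {t : ℝ≥0} (ht : t ≤ 1) : lowSpread x ≤ x t - x 0 :=
  sub_le_sub_right (csInf_le (bddBelow_image_Icc hx) ⟨t, ⟨zero_le, ht⟩, rfl⟩) _

lemma exists_eq_highSpread (hx : Continuous x) : ∃ t ≤ 1, x t - x 0 = highSpread x := by
  obtain ⟨t, ht, h⟩ := (isCompact_Icc (a := (0 : ℝ≥0)) (b := 1)).exists_sSup_image_eq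
    ⟨0, by simp⟩ hx.continuousOn
  exact ⟨t, ht.2, by rw [highSpread, h]⟩

lemma highSpread_neg (x : ℝ≥0 → ℝ) : highSpread (-x) = -lowSpread x := by
  have : (-x) '' Icc 0 1 = -(x '' Icc 0 1) := by
    rw [← Set.image_neg_eq_neg, ← Set.image_comp]; rfl
  rw [highSpread, lowSpread, this, Real.sInf_def]
  simp only [Pi.neg_apply]; ring

lemma lowSpread_neg (x : ℝ≥0 → ℝ) : lowSpread (-x) = -highSpread x := by
  have := highSpread_neg (-x)
  rw [neg_neg] at this
  linarith

lemma closeSpread_neg (x : ℝ≥0 → ℝ) : closeSpread (-x) = -closeSpread x := by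
  simp only [closeSpread, Pi.neg_apply]; ring

lemma closeSpread_le_highSpread (hx : Continuous x) : closeSpread x ≤ highSpread x :=
  le_highSpread hx le_rfl

lemma lowSpread_nonpos (hx : Continuous x) : lowSpread x ≤ 0 := by
  simpa using lowSpread_le hx zero_le_one

/-- A countable supremum makes the maximum measurable; `min 1` folds a dense sequence of all times
into the window. -/
lemma highSpread_eq_iSup (hx : Continuous x) :
    highSpread x = (⨆ n, x (min 1 (TopologicalSpace.denseSeq ℝ≥0 n))) - x 0 := by
  unfold highSpread
  congr 1
  set d := TopologicalSpace.denseSeq ℝ≥0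
  have hb : BddAbove (range fun n => x (min 1 (d n))) :=
    (bddAbove_image_Icc hx).mono (by
      rintro _ ⟨n, rfl⟩; exact ⟨_, ⟨zero_le, min_le_left _ _⟩, rfl⟩)
  refine le_antisymm (csSup_le (by simp) ?_) (ciSup_le fun n => ?_)
  · rintro _ ⟨t, ht, rfl⟩
    have key : ∀ s : ℝ≥0, x (min 1 s) ≤ ⨆ n, x (min 1 (d n)) :=
      isClosed_property (TopologicalSpace.denseRange_denseSeq ℝ≥0)
        (isClosed_le (hx.comp (continuous_const.min continuous_id)) continuous_const)
        fun n => le_ciSup hb n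
    simpa [min_eq_right ht.2] using key t
  · exact le_csSup (bddAbove_image_Icc hx) ⟨_, ⟨zero_le, min_le_left _ _⟩, rfl⟩

end Paths

variable {Ω : Type*} [MeasurableSpace Ω] {P : Measure Ω} {B : ℝ≥0 → Ω → ℝ}

lemma aemeasurable_highSpread (hB : IsBrownianReal B P) :
    AEMeasurable (fun ω => highSpread fun t => B t ω) P := by
  have h : AEMeasurable (fun ω =>
      (⨆ n, B (min 1 (TopologicalSpace.denseSeq ℝ≥0 n)) ω) - B 0 ω) P :=
    (AEMeasurable.iSup fun n => hB.aemeasurable _).sub (hB.aemeasurable 0)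
  refine h.congr ?_
  filter_upwards [hB.cont] with ω hω using (highSpread_eq_iSup hω).symm

lemma aemeasurable_lowSpread (hB : IsBrownianReal B P) :
    AEMeasurable (fun ω => lowSpread fun t => B t ω) P := by
  have h := (aemeasurable_highSpread hB.neg).neg
  refine h.congr (ae_of_all _ fun ω => ?_)
  have := highSpread_neg fun t => B t ω
  show -highSpread (-fun t => B t ω) = _
  rw [this, neg_neg]

/-- Reflection at one upper barrier. -/
theorem measure_high_inter (hB : IsBrownianReal B P) {u : ℝ} (hu : 0 < u)
    (hnull : ∀ᵐ ω ∂P, (highSpread fun t => B t ω) ≠ u) {T : Set ℝ} (hT : IsOpen T)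
    (hTu : T ⊆ Iio u) :
    P {ω | u ≤ (highSpread fun t => B t ω) ∧ B 1 ω ∈ T} = P {ω | 2 * u - B 1 ω ∈ T} := by
  -- A path reaching `u` with maximum different from `u` must exceed `u`, hence leave the closed
  -- half-line.
  have hcl : ∀ᵐ ω ∂P, (∃ t ≤ 1, B t ω ∉ Iio u) → ∃ t ≤ 1, B t ω ∉ closure (Iio u) := by
    filter_upwards [hnull, hB.cont, hB.eval_zero_ae_eq_zero] with ω h1 hω h0
    rintro ⟨t, ht, htu⟩
    obtain ⟨s, hs, hs2⟩ := exists_eq_highSpread hω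
    refine ⟨s, hs, ?_⟩
    have h3 := le_highSpread hω ht
    rw [closure_Iio, mem_Iic, not_le]
    rw [mem_Iio, not_lt] at htu
    rw [h0, sub_zero] at *
    rw [hs2]
    exact lt_of_le_of_ne (htu.trans h3) (Ne.symm h1)
  have key := measure_exit_inter_eq hB (S := Iio u) isOpen_Iio hu (O := T)
    (O' := {y | 2 * u - y ∈ T}) hT (hT.preimage (by fun_prop)) ⟨u, fun h => lt_irrefl u (hTu h)⟩
    ⟨u, fun h => by
      have := hTu h
      rw [mem_Iio] at this; linarith⟩ (fun x hx y hy => ⟨u, by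
        rw [mem_Iio] at hx
        rw [mem_Iio, not_lt] at hy
        rw [abs_of_nonneg (by linarith), abs_of_nonneg (by linarith)]; linarith, fun w => by
        rw [mem_ofPred_eq, show 2 * u - (u - w) = u + w by ring]⟩) hcl
  refine Eq.trans (measure_congr ?_) (key.trans (measure_congr ?_))
  · filter_upwards [hB.cont, hB.eval_zero_ae_eq_zero] with ω hω h0
    refine propext ⟨fun h => ⟨?_, h.2⟩, fun h => ⟨?_, h.2⟩⟩
    · obtain ⟨s, hs, hs2⟩ := exists_eq_highSpread hω
      refine ⟨s, hs, ?_⟩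
      rw [h0, sub_zero] at hs2
      rw [mem_Iio, not_lt, hs2]; exact h.1
    · obtain ⟨t, ht, htu⟩ := h.1
      have h3 := le_highSpread hω ht
      rw [mem_Iio, not_lt] at htu
      rw [h0, sub_zero] at h3
      exact htu.trans h3
  -- The reflected endpoint already lies beyond the barrier, so the crossing condition is redundant.
  · refine ae_of_all _ fun ω => propext ⟨fun h => h.2, fun h => ⟨⟨1, le_rfl, ?_⟩, h⟩⟩
    have := hTu h
    rw [mem_Iio] at this ⊢
    linarith

/-- Reflection at one lower barrier. -/
theorem measure_low_inter (hB : IsBrownianReal B P) {v : ℝ} (hv : 0 < v)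
    (hnull : ∀ᵐ ω ∂P, (lowSpread fun t => B t ω) ≠ -v) {T : Set ℝ} (hT : IsOpen T)
    (hTv : T ⊆ Ioi (-v)) :
    P {ω | (lowSpread fun t => B t ω) ≤ -v ∧ B 1 ω ∈ T} = P {ω | -2 * v - B 1 ω ∈ T} := by
  have hh : ∀ ω, (highSpread fun t => (-B) t ω) = -lowSpread fun t => B t ω := fun ω =>
    highSpread_neg fun t => B t ω
  have := measure_high_inter hB.neg hv (by
      filter_upwards [hnull] with ω hω h
      rw [hh] at h
      exact hω (by linarith)) (T := -T) hT.neg (fun y hy => by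
        have := hTv hy
        rw [mem_Ioi] at this; rw [mem_Iio]; linarith)
  simp only [Pi.neg_apply] at hh this
  simp only [hh, Set.mem_neg, neg_neg] at this
  convert this using 4
  · rw [le_neg]
  · ring_nf

/-- Reflection at two barriers. -/
theorem measure_exit_Ioo (hB : IsBrownianReal B P) {u v : ℝ} (hu : 0 < u) (hv : 0 < v)
    (hnu : ∀ᵐ ω ∂P, (highSpread fun t => B t ω) ≠ u)
    (hnv : ∀ᵐ ω ∂P, (lowSpread fun t => B t ω) ≠ -v) {T : Set ℝ} (hT : IsOpen T)
    (hTu : T ⊆ Ioo 0 u) :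
    P {ω | (u ≤ (highSpread fun t => B t ω) ∨ (lowSpread fun t => B t ω) ≤ -v) ∧
        ∃ k : ℤ, B 1 ω + 2 * k * (u + v) ∈ T} =
      P {ω | ∃ k : ℤ, 2 * u - B 1 ω + 2 * k * (u + v) ∈ T} := by
  -- The reflections at `u` and `-v` compose to a translation by `2 (u + v)`. Periodising `T` with
  -- this period makes both of them send `O` to the same set `O'`.
  set O : Set ℝ := {y | ∃ k : ℤ, y + 2 * k * (u + v) ∈ T} with hOdef
  have hO : IsOpen O := by
    have : O = ⋃ k : ℤ, (fun y : ℝ => y + 2 * k * (u + v)) ⁻¹' T := by ext y; simp [hOdef]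
    rw [this]
    exact isOpen_iUnion fun k => hT.preimage (by fun_prop)
  have hper : ∀ y, y + 2 * (u + v) ∈ O ↔ y ∈ O := fun y => by
    constructor
    · rintro ⟨k, hk⟩
      refine ⟨k + 1, ?_⟩
      push_cast
      convert hk using 1; ring
    · rintro ⟨k, hk⟩
      refine ⟨k - 1, ?_⟩
      push_cast
      convert hk using 1; ring
  -- No translate of `u` by a multiple of the period falls in `(0, u)`. Being fixed by the
  -- reflection at `u`, the point `u` then witnesses that both complements are nonempty.
  have huO : u ∉ O := by
    rintro ⟨k, hk⟩
    have h := hTu hk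
    rcases le_or_gt 0 k with h0 | h0
    · have : (0 : ℝ) ≤ k := by exact_mod_cast h0
      have := h.2
      nlinarith [mul_nonneg ‹(0 : ℝ) ≤ k› (add_pos hu hv).le]
    · have : (k : ℝ) ≤ -1 := by exact_mod_cast (by omega : k ≤ -1)
      have := h.1
      nlinarith
  have hexit : ∀ᵐ ω ∂P, ((∃ t ≤ 1, B t ω ∉ Ioo (-v) u) ↔
      (u ≤ (highSpread fun t => B t ω) ∨ (lowSpread fun t => B t ω) ≤ -v)) := by
    filter_upwards [hB.cont, hB.eval_zero_ae_eq_zero] with ω hω h0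
    obtain ⟨s, hs, hs2⟩ := exists_eq_highSpread hω
    obtain ⟨r, hr, hr2⟩ := exists_eq_highSpread (x := -fun t => B t ω) hω.neg
    rw [highSpread_neg] at hr2
    simp only [Pi.neg_apply, h0, neg_zero, sub_zero] at hr2 hs2
    constructor
    · rintro ⟨t, ht, htu⟩
      have h3 := le_highSpread hω ht
      have h4 := lowSpread_le hω ht
      rw [h0, sub_zero] at h3 h4
      rw [mem_Ioo, not_and_or, not_lt, not_lt] at htu
      rcases htu with h | h
      · exact Or.inr (h4.trans h)
      · exact Or.inl (h.trans h3)
    · rintro (h | h)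
      · exact ⟨s, hs, fun hm => by have := hm.2; linarith⟩
      · exact ⟨r, hr, fun hm => by have := hm.1; linarith⟩
  have hcl : ∀ᵐ ω ∂P, (∃ t ≤ 1, B t ω ∉ Ioo (-v) u) →
      ∃ t ≤ 1, B t ω ∉ closure (Ioo (-v) u) := by
    filter_upwards [hnu, hnv, hexit, hB.cont, hB.eval_zero_ae_eq_zero] with ω h1 h2 he hω h0 hex
    obtain ⟨s, hs, hs2⟩ := exists_eq_highSpread hω
    obtain ⟨r, hr, hr2⟩ := exists_eq_highSpread (x := -fun t => B t ω) hω.neg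
    rw [highSpread_neg] at hr2
    simp only [Pi.neg_apply, h0, neg_zero, sub_zero] at hr2 hs2
    rw [closure_Ioo (by linarith : -v ≠ u)]
    rcases he.1 hex with h | h
    · exact ⟨s, hs, fun hm => h1 (le_antisymm (by have := hm.2; linarith) h)⟩
    · exact ⟨r, hr, fun hm => h2 (le_antisymm h (by have := hm.1; linarith))⟩
  have key := measure_exit_inter_eq hB (S := Ioo (-v) u) isOpen_Ioo ⟨by linarith, hu⟩ (O := O)
    (O' := {y | 2 * u - y ∈ O}) hO (hO.preimage (by fun_prop)) ⟨u, huO⟩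
    ⟨u, fun h => huO (by rwa [mem_ofPred_eq, show 2 * u - u = u by ring] at h)⟩
    (fun x hx y hy => by
      rw [mem_Ioo, not_and_or, not_lt, not_lt] at hy
      rcases hy with h | h
      · refine ⟨-v, ?_, fun w => ?_⟩
        · rw [abs_sub_comm, abs_sub_comm y, abs_of_nonneg (by linarith),
            abs_of_nonneg (by linarith [hx.1])]
          linarith [hx.1]
        · show -v + w ∈ O ↔ 2 * u - (-v - w) ∈ O
          rw [← hper (-v + w), show -v + w + 2 * (u + v) = 2 * u - (-v - w) by ring]
      · refine ⟨u, ?_, fun w => ?_⟩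
        · rw [abs_of_nonneg (by linarith), abs_of_nonneg (by linarith [hx.2])]
          linarith [hx.2]
        · show u + w ∈ O ↔ 2 * u - (u - w) ∈ O
          rw [show 2 * u - (u - w) = u + w by ring]) hcl
  refine Eq.trans (measure_congr ?_) (key.trans (measure_congr ?_))
  · filter_upwards [hexit] with ω he
    exact propext ⟨fun h => ⟨he.2 h.1, h.2⟩, fun h => ⟨he.1 h.1, h.2⟩⟩
  -- Every image point of `T` lies outside `(-v, u)`, so the exit condition may be dropped after
  -- reflection.
  · refine ae_of_all _ fun ω => propext ⟨fun h => h.2, fun h => ⟨⟨1, le_rfl, ?_⟩, h⟩⟩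
    obtain ⟨k, hk⟩ := h
    have hk := hTu hk
    rintro ⟨h1, h2⟩
    rcases le_or_gt 0 k with h0 | h0
    · have : (0 : ℝ) ≤ k := by exact_mod_cast h0
      have := hk.2
      nlinarith [mul_nonneg ‹(0 : ℝ) ≤ k› (add_pos hu hv).le]
    · have : (k : ℝ) ≤ -1 := by exact_mod_cast (by omega : k ≤ -1)
      have := hk.1
      nlinarith

lemma map_eval_one (hB : IsPreBrownianReal B P) :
    P.map (B 1) = volume.withDensity (gaussianPDF 0 1) := by
  rw [(hB.hasLaw_eval 1).map_eq, gaussianReal_of_var_ne_zero _ one_ne_zero]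

lemma gaussianPDF_neg (x : ℝ) : gaussianPDF 0 1 (-x) = gaussianPDF 0 1 x := by
  simp [gaussianPDF, gaussianPDFReal]

lemma measure_add_mem (hB : IsPreBrownianReal B P) {T : Set ℝ} (hT : MeasurableSet T) (r : ℝ) :
    P {ω | B 1 ω + r ∈ T} = ∫⁻ x in T, gaussianPDF 0 1 (x - r) := by
  have hm : MeasurableSet ((fun y => y + r) ⁻¹' T) := measurableSet_preimage (by fun_prop) hT
  have h1 : P {ω | B 1 ω + r ∈ T} = P.map (B 1) ((fun y => y + r) ⁻¹' T) :=
    (Measure.map_apply_of_aemeasurable (hB.aemeasurable 1) hm).symm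
  rw [h1, map_eval_one hB, withDensity_apply _ hm, ← lintegral_indicator hm,
    ← lintegral_indicator hT,
    ← lintegral_add_right_eq_self (T.indicator fun x => gaussianPDF 0 1 (x - r)) r]
  refine lintegral_congr fun x => ?_
  simp only [Set.indicator, mem_preimage, add_sub_cancel_right]
  rfl

lemma measure_sub_mem (hB : IsPreBrownianReal B P) {T : Set ℝ} (hT : MeasurableSet T) (r : ℝ) :
    P {ω | r - B 1 ω ∈ T} = ∫⁻ x in T, gaussianPDF 0 1 (r - x) := by
  have := measure_add_mem hB.neg hT r
  simp only [Pi.neg_apply] at this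
  simp_rw [sub_eq_neg_add r (B 1 _), this]
  refine lintegral_congr fun x => ?_
  rw [← gaussianPDF_neg, neg_sub]

/-- Positive terms in the density of `(close, high, low)` at two barriers. -/
def posKernel (x p v : ℝ) : ℝ≥0∞ :=
  ∑' n : ℕ, (gaussianPDF 0 1 ((2 * n + 3) * x + (2 * n + 2) * p + (2 * n + 2) * v) +
    gaussianPDF 0 1 ((2 * n + 1) * x + (2 * n + 2) * p + (2 * n + 2) * v))

/-- Negative terms in the density of `(close, high, low)` at two barriers. -/
def negKernel (x p v : ℝ) : ℝ≥0∞ :=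
  ∑' n : ℕ, (gaussianPDF 0 1 ((2 * n + 3) * x + (2 * n + 4) * p + (2 * n + 2) * v) +
    gaussianPDF 0 1 ((2 * n + 3) * x + (2 * n + 2) * p + (2 * n + 4) * v))

lemma pairwise_disjoint_translates {u v : ℝ} (hv : 0 < v) {T : Set ℝ} (hTu : T ⊆ Ioo 0 u)
    {j k : ℤ} (hjk : j ≠ k) {y : ℝ} (hj : y + 2 * j * (u + v) ∈ T)
    (hk : y + 2 * k * (u + v) ∈ T) : False := by
  have h1 := hTu hj
  have h2 := hTu hk
  rcases lt_or_gt_of_ne hjk with h | h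
  · have : (j : ℝ) + 1 ≤ k := by exact_mod_cast h
    nlinarith [h1.1, h1.2, h2.1, h2.2]
  · have : (k : ℝ) + 1 ≤ j := by exact_mod_cast h
    nlinarith [h1.1, h1.2, h2.1, h2.2]

/-- With `p = u - x` the two linear forms become `±x + 2 (n + 1) (u + v)`. As the density is even,
the kernel collects exactly the translates with `k ≠ 0`. In the variables `x, p, v` all coefficients
are positive. -/
lemma lintegral_posKernel (hB : IsPreBrownianReal B P) {T : Set ℝ} (hTm : MeasurableSet T)
    {u v : ℝ} : ∫⁻ x in T, posKernel x (u - x) v =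
      (∑' n : ℕ, P {ω | B 1 ω + 2 * ((-((n : ℤ) + 1) : ℤ) : ℝ) * (u + v) ∈ T}) +
        ∑' n : ℕ, P {ω | B 1 ω + 2 * (((n : ℤ) + 1 : ℤ) : ℝ) * (u + v) ∈ T} := by
  have hg : Measurable (gaussianPDF 0 1) := measurable_gaussianPDF 0 1
  unfold posKernel
  rw [← ENNReal.tsum_add, lintegral_tsum fun n => by fun_prop]
  refine tsum_congr fun n => ?_
  rw [lintegral_add_left (by fun_prop)]
  rw [measure_add_mem hB hTm, measure_add_mem hB hTm]
  congr 1
  · refine lintegral_congr fun x => ?_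
    congr 1; push_cast; ring
  · refine lintegral_congr fun x => ?_
    rw [← gaussianPDF_neg]
    congr 1; push_cast; ring

/-- The translates of `(0, u)` are disjoint, so each of the two sums of probabilities is at most
`1`. -/
lemma lintegral_posKernel_lt_top (hB : IsPreBrownianReal B P) {u v : ℝ} (hv : 0 < v) :
    ∫⁻ x in Ioo 0 u, posKernel x (u - x) v < ⊤ := by
  have hP : IsProbabilityMeasure P := hB.isGaussianProcess.isProbabilityMeasure
  rw [lintegral_posKernel hB measurableSet_Ioo]
  let q : ℤ → ℝ≥0∞ := fun k => P {ω | B 1 ω + 2 * k * (u + v) ∈ Ioo 0 u}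
  have h1 : ∑' k : ℤ, q k ≤ 1 := by
    rw [← measure_iUnion₀]
    · exact prob_le_one
    · intro j k hjk
      refine Disjoint.aedisjoint (Set.disjoint_left.2 fun ω h1 h2 => ?_)
      exact pairwise_disjoint_translates hv subset_rfl hjk h1 h2
    · exact fun k => ((hB.aemeasurable 1).add_const _).nullMeasurable measurableSet_Ioo
  refine lt_of_le_of_lt ?_ (ENNReal.add_lt_top.2 ⟨h1.trans_lt ENNReal.one_lt_top,
    h1.trans_lt ENNReal.one_lt_top⟩)
  refine add_le_add ?_ ?_
  · exact ENNReal.tsum_comp_le_tsum_of_injective (f := fun n : ℕ => -((n : ℤ) + 1))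
      (fun a b h => by simpa using h) q
  · exact ENNReal.tsum_comp_le_tsum_of_injective (f := fun n : ℕ => (n : ℤ) + 1)
      (fun a b h => by simpa using h) q

theorem measure_both_inter (hB : IsBrownianReal B P) {u v : ℝ} (hu : 0 < u) (hv : 0 < v)
    (hnu : ∀ᵐ ω ∂P, (highSpread fun t => B t ω) ≠ u)
    (hnv : ∀ᵐ ω ∂P, (lowSpread fun t => B t ω) ≠ -v) {T : Set ℝ} (hT : IsOpen T)
    (hTu : T ⊆ Ioo 0 u) :
    P {ω | (u ≤ (highSpread fun t => B t ω) ∧ (lowSpread fun t => B t ω) ≤ -v) ∧ B 1 ω ∈ T} +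
        ∫⁻ x in T, negKernel x (u - x) v = ∫⁻ x in T, posKernel x (u - x) v := by
  have hP : IsProbabilityMeasure P := hB.isGaussianProcess.isProbabilityMeasure
  have hB' := hB.toIsPreBrownianReal
  have hTm := hT.measurableSet
  set w := u + v with hw
  let q : ℤ → ℝ≥0∞ := fun k => P {ω | B 1 ω + 2 * k * w ∈ T}
  let r : ℤ → ℝ≥0∞ := fun k => P {ω | 2 * u - B 1 ω + 2 * k * w ∈ T}
  have hnull1 : NullMeasurableSet {ω | u ≤ (highSpread fun t => B t ω)} P :=
    (aemeasurable_highSpread hB).nullMeasurable measurableSet_Ici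
  have hnull2 : NullMeasurableSet {ω | (lowSpread fun t => B t ω) ≤ -v} P :=
    (aemeasurable_lowSpread hB).nullMeasurable measurableSet_Iic
  have hnc : ∀ r : ℝ, NullMeasurableSet {ω | B 1 ω + r ∈ T} P := fun r =>
    ((hB.aemeasurable 1).add_const r).nullMeasurable hTm
  have hnc' : ∀ r s : ℝ, NullMeasurableSet {ω | r - B 1 ω + s ∈ T} P := fun r s =>
    (((hB.aemeasurable 1).const_sub r).add_const s).nullMeasurable hTm
  have hnT : NullMeasurableSet {ω | B 1 ω ∈ T} P := (hB.aemeasurable 1).nullMeasurable hTm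
  have hD := hnull1.union hnull2
  set D : Set Ω := {ω | u ≤ (highSpread fun t => B t ω)} ∪
    {ω | (lowSpread fun t => B t ω) ≤ -v} with hDdef
  have hL : P {ω | ω ∈ D ∧ ∃ k : ℤ, B 1 ω + 2 * k * w ∈ T} =
      ∑' k : ℤ, P {ω | ω ∈ D ∧ B 1 ω + 2 * k * w ∈ T} := by
    rw [← measure_iUnion₀]
    · congr 1; ext ω; simp
    · intro j k hjk
      refine Disjoint.aedisjoint (Set.disjoint_left.2 fun ω h1 h2 => ?_)
      exact pairwise_disjoint_translates hv hTu hjk h1.2 h2.2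
    · exact fun k => hD.inter (hnc _)
  have hR : P {ω | ∃ k : ℤ, 2 * u - B 1 ω + 2 * k * w ∈ T} = ∑' k : ℤ, r k := by
    rw [← measure_iUnion₀]
    · congr 1; ext ω; simp
    · intro j k hjk
      refine Disjoint.aedisjoint (Set.disjoint_left.2 fun ω h1 h2 => ?_)
      exact pairwise_disjoint_translates hv hTu hjk h1 h2
    · exact fun k => hnc' _ _
  have key : P {ω | ω ∈ D ∧ ∃ k : ℤ, B 1 ω + 2 * k * w ∈ T} = _ :=
    measure_exit_Ioo hB hu hv hnu hnv hT hTu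
  rw [hL, hR, tsum_of_nat_of_neg_add_one ENNReal.summable ENNReal.summable,
    tsum_of_nat_of_neg_add_one ENNReal.summable ENNReal.summable,
    tsum_eq_zero_add' ENNReal.summable, tsum_eq_zero_add' (f := fun n : ℕ => r n) ENNReal.summable,
    tsum_eq_zero_add' (f := fun n : ℕ => r (-(n + 1))) ENNReal.summable] at key
  -- For `k ≠ 0` the endpoint itself lies outside `(-v, u)`, and a barrier has been hit
  -- automatically.
  have hq : ∀ k : ℤ, k ≠ 0 → P {ω | ω ∈ D ∧ B 1 ω + 2 * k * w ∈ T} = q k := by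
    intro k hk
    refine measure_congr ?_
    filter_upwards [hB.cont, hB.eval_zero_ae_eq_zero] with ω hω h0
    refine propext ⟨fun h => h.2, fun h => ⟨?_, h⟩⟩
    have h1 := le_highSpread hω le_rfl
    have h2 := lowSpread_le hω le_rfl
    rw [h0, sub_zero] at h1 h2
    have h3 := hTu h
    rcases lt_or_gt_of_ne hk with h | h
    · have : (k : ℝ) ≤ -1 := by exact_mod_cast (by omega : k ≤ -1)
      exact Or.inl (by
        show u ≤ _
        nlinarith [h3.1, h3.2])
    · have : (1 : ℝ) ≤ k := by exact_mod_cast (by omega : 1 ≤ k)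
      exact Or.inr (by
        show _ ≤ -v
        nlinarith [h3.1, h3.2])
  have hhigh : P {ω | u ≤ (highSpread fun t => B t ω) ∧ B 1 ω ∈ T} = r 0 := by
    rw [measure_high_inter hB hu hnu hT (hTu.trans Ioo_subset_Iio_self)]
    simp [r]
  have hlow : P {ω | (lowSpread fun t => B t ω) ≤ -v ∧ B 1 ω ∈ T} = r (-1) := by
    rw [measure_low_inter hB hv hnv hT (hTu.trans (Ioo_subset_Ioi_self.trans
      (Ioi_subset_Ioi (by linarith))))]
    simp only [r]
    congr 1; ext ω
    show _ ∈ T ↔ _ ∈ T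
    rw [show 2 * u - B 1 ω + 2 * ((-1 : ℤ) : ℝ) * w = -2 * v - B 1 ω by rw [hw]; push_cast; ring]
  -- Inclusion–exclusion for the term `k = 0`. The two single-barrier probabilities are precisely
  -- the reflected terms `r 0` and `r (-1)`.
  have hie : P {ω | ω ∈ D ∧ B 1 ω ∈ T} +
      P {ω | (u ≤ (highSpread fun t => B t ω) ∧ (lowSpread fun t => B t ω) ≤ -v) ∧ B 1 ω ∈ T} =
      r 0 + r (-1) := by
    rw [← hhigh, ← hlow]
    have h1 := measure_union_add_inter₀ {ω | u ≤ (highSpread fun t => B t ω) ∧ B 1 ω ∈ T}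
      (hnull2.inter hnT)
    refine Eq.trans ?_ h1
    congr 2
    · ext ω; exact or_and_right
    · ext ω; exact and_and_right
  have hsum : ∀ (f : ℕ → ℝ → ℝ≥0∞), (∀ n, Measurable (f n)) →
      ∑' n, ∫⁻ x in T, f n x = ∫⁻ x in T, ∑' n, f n x := fun f hf =>
    (lintegral_tsum fun n => (hf n).aemeasurable).symm
  have hg : Measurable (gaussianPDF 0 1) := measurable_gaussianPDF 0 1
  have hpos : ∫⁻ x in T, posKernel x (u - x) v =
      (∑' n : ℕ, q (-(n + 1))) + ∑' n : ℕ, q (n + 1) := lintegral_posKernel hB' hTm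
  have hneg : ∫⁻ x in T, negKernel x (u - x) v =
      (∑' n : ℕ, r (n + 1)) + ∑' n : ℕ, r (-((n + 1 : ℕ) + 1)) := by
    unfold negKernel
    rw [← ENNReal.tsum_add, ← hsum _ (fun n => by fun_prop)]
    refine tsum_congr fun n => ?_
    rw [lintegral_add_left (by fun_prop)]
    simp only [r, sub_add_eq_add_sub]
    rw [measure_sub_mem hB' hTm, measure_sub_mem hB' hTm]
    congr 1
    · refine lintegral_congr fun x => ?_
      congr 1; rw [hw]; push_cast; ring
    · refine lintegral_congr fun x => ?_
      rw [← gaussianPDF_neg]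
      congr 1; rw [hw]; push_cast; ring
  rw [hpos, hneg]
  have hq1 : ∀ n : ℕ, P {ω | ω ∈ D ∧ B 1 ω + 2 * (((n + 1 : ℕ) : ℤ) : ℝ) * w ∈ T} = q (n + 1) :=
    fun n => by rw [hq _ (by omega)]; push_cast; rfl
  have hq2 : ∀ n : ℕ, P {ω | ω ∈ D ∧ B 1 ω + 2 * ((-((n : ℤ) + 1) : ℤ) : ℝ) * w ∈ T} =
      q (-(n + 1)) := fun n => hq _ (by omega)
  simp only [hq1, hq2] at key
  have hr0 : r ((0 : ℕ) : ℤ) = r 0 := rfl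
  have hr1 : r (-(((0 : ℕ) : ℤ) + 1)) = r (-1) := rfl
  have hD0 : P {ω | ω ∈ D ∧ B 1 ω + 2 * (((0 : ℕ) : ℤ) : ℝ) * w ∈ T} = P {ω | ω ∈ D ∧ B 1 ω ∈ T} := by
    simp
  have hr2 : ∑' n : ℕ, r ((n + 1 : ℕ) : ℤ) = ∑' n : ℕ, r (n + 1) := by push_cast; rfl
  rw [hr0, hr1, hD0, hr2] at key
  -- Adding the finite quantity `r 0 + r (-1)` to both sides replaces subtraction in `ℝ≥0∞`; the
  -- reflected terms other than these two make up `negKernel`.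
  have hfin : r 0 + r (-1) ≠ ⊤ := ENNReal.add_ne_top.2 ⟨measure_ne_top _ _, measure_ne_top _ _⟩
  rw [← ENNReal.add_right_inj hfin]
  calc _ = P {ω | (u ≤ (highSpread fun t => B t ω) ∧ (lowSpread fun t => B t ω) ≤ -v) ∧
        B 1 ω ∈ T} + (r 0 + ∑' n : ℕ, r (n + 1) +
          (r (-1) + ∑' n : ℕ, r (-((n + 1 : ℕ) + 1)))) := by abel
    _ = _ := by rw [← key, ← hie]; abel

/-- Rational intervals cut with `U` are open subsets of `U`, and rational intervals determine the
measure. -/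
lemma measure_restrict_ext {ν μ : Measure ℝ} {U : Set ℝ} (hU : IsOpen U)
    (hfin : μ U < ⊤) (h : ∀ T, IsOpen T → T ⊆ U → ν T = μ T) : ν.restrict U = μ.restrict U := by
  have : IsFiniteMeasure (μ.restrict U) := ⟨by simpa using hfin⟩
  refine (Real.measure_ext_Ioo_rat fun a b => ?_).symm
  rw [Measure.restrict_apply measurableSet_Ioo, Measure.restrict_apply measurableSet_Ioo]
  exact (h _ (isOpen_Ioo.inter hU) Set.inter_subset_right).symm

/-- Passing from the law of `B 1` on an event to expectations. -/
lemma lintegral_event_eq (hB : IsPreBrownianReal B P) {A : Set Ω} (hA : NullMeasurableSet A P)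
    {U : Set ℝ} (hU : IsOpen U) {k l : ℝ → ℝ≥0∞} (hk : Measurable k) (hl : Measurable l)
    (hfin : ∫⁻ x in U, l x < ⊤)
    (h : ∀ T, IsOpen T → T ⊆ U → P (A ∩ B 1 ⁻¹' T) + ∫⁻ x in T, k x = ∫⁻ x in T, l x)
    {f : ℝ → ℝ≥0∞} (hf : Measurable f) :
    ∫⁻ ω, A.indicator (fun ω => U.indicator f (B 1 ω)) ω ∂P + ∫⁻ x in U, f x * k x =
      ∫⁻ x in U, f x * l x := by
  have hB1 := hB.aemeasurable 1
  have hB1' : AEMeasurable (B 1) (P.restrict A) := hB1.restrict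
  have key : ((P.restrict A).map (B 1) + volume.withDensity k).restrict U =
      (volume.withDensity l).restrict U := by
    refine measure_restrict_ext hU (by rwa [withDensity_apply _ hU.measurableSet]) ?_
    intro T hT hTU
    rw [Measure.add_apply, Measure.map_apply_of_aemeasurable hB1' hT.measurableSet,
      Measure.restrict_apply₀' hA, withDensity_apply _ hT.measurableSet,
      withDensity_apply _ hT.measurableSet, Set.inter_comm]
    exact h T hT hTU
  have h2 := congrArg (fun m => ∫⁻ x, f x ∂m) key
  simp only [Measure.restrict_add, lintegral_add_measure] at h2
  rw [← lintegral_indicator hU.measurableSet,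
    lintegral_map' (hf.indicator hU.measurableSet).aemeasurable hB1',
    restrict_withDensity hU.measurableSet, restrict_withDensity hU.measurableSet,
    lintegral_withDensity_eq_lintegral_mul _ hk hf,
    lintegral_withDensity_eq_lintegral_mul _ hl hf, ← lintegral_indicator₀ hA] at h2
  simpa only [Pi.mul_apply, mul_comm] using h2

lemma measurable_posKernel : Measurable fun q : ℝ × ℝ × ℝ => posKernel q.1 q.2.1 q.2.2 := by
  have hg : Measurable (gaussianPDF 0 1) := measurable_gaussianPDF 0 1
  exact Measurable.tsum fun n => by fun_prop

lemma measurable_negKernel : Measurable fun q : ℝ × ℝ × ℝ => negKernel q.1 q.2.1 q.2.2 := by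
  have hg : Measurable (gaussianPDF 0 1) := measurable_gaussianPDF 0 1
  exact Measurable.tsum fun n => by fun_prop

theorem lintegral_high (hB : IsBrownianReal B P) {u : ℝ} (hu : 0 < u)
    (hnu : ∀ᵐ ω ∂P, (highSpread fun t => B t ω) ≠ u) {f : ℝ → ℝ≥0∞} (hf : Measurable f) :
    ∫⁻ ω, {ω | u ≤ highSpread fun t => B t ω}.indicator
      (fun ω => (Ioo 0 u).indicator f (B 1 ω)) ω ∂P =
      ∫⁻ x in Ioo 0 u, f x * gaussianPDF 0 1 (2 * u - x) := by
  have hP : IsProbabilityMeasure P := hB.isGaussianProcess.isProbabilityMeasure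
  have hg : Measurable (gaussianPDF 0 1) := measurable_gaussianPDF 0 1
  have h := lintegral_event_eq hB.toIsPreBrownianReal (A := {ω | u ≤ highSpread fun t => B t ω})
    ((aemeasurable_highSpread hB).nullMeasurable measurableSet_Ici) (U := Ioo 0 u) isOpen_Ioo
    (k := fun _ => 0) (l := fun x => gaussianPDF 0 1 (2 * u - x)) measurable_const (by fun_prop)
    (by rw [← measure_sub_mem hB.toIsPreBrownianReal measurableSet_Ioo]; exact measure_lt_top _ _)
    (fun T hT hTU => by
      rw [← measure_sub_mem hB.toIsPreBrownianReal hT.measurableSet, lintegral_zero, add_zero]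
      exact measure_high_inter hB hu hnu hT (hTU.trans Ioo_subset_Iio_self)) hf
  simpa using h

theorem lintegral_low (hB : IsBrownianReal B P) {v : ℝ} (hv : 0 < v)
    (hnv : ∀ᵐ ω ∂P, (lowSpread fun t => B t ω) ≠ -v) {f : ℝ → ℝ≥0∞} (hf : Measurable f) :
    ∫⁻ ω, {ω | (lowSpread fun t => B t ω) ≤ -v}.indicator
      (fun ω => (Ioi 0).indicator f (B 1 ω)) ω ∂P =
      ∫⁻ x in Ioi 0, f x * gaussianPDF 0 1 (x + 2 * v) := by
  have hP : IsProbabilityMeasure P := hB.isGaussianProcess.isProbabilityMeasure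
  have hg : Measurable (gaussianPDF 0 1) := measurable_gaussianPDF 0 1
  have he : ∀ x, gaussianPDF 0 1 (x + 2 * v) = gaussianPDF 0 1 (-2 * v - x) := fun x => by
    rw [← gaussianPDF_neg]; congr 1; ring
  simp_rw [he]
  have h := lintegral_event_eq hB.toIsPreBrownianReal
    (A := {ω | (lowSpread fun t => B t ω) ≤ -v})
    ((aemeasurable_lowSpread hB).nullMeasurable measurableSet_Iic) (U := Ioi 0) isOpen_Ioi
    (k := fun _ => 0) (l := fun x => gaussianPDF 0 1 (-2 * v - x)) measurable_const (by fun_prop)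
    (by rw [← measure_sub_mem hB.toIsPreBrownianReal measurableSet_Ioi]; exact measure_lt_top _ _)
    (fun T hT hTU => by
      rw [← measure_sub_mem hB.toIsPreBrownianReal hT.measurableSet, lintegral_zero, add_zero]
      exact measure_low_inter hB hv hnv hT (hTU.trans (Ioi_subset_Ioi (by linarith)))) hf
  simpa using h

theorem lintegral_both (hB : IsBrownianReal B P) {u v : ℝ} (hu : 0 < u) (hv : 0 < v)
    (hnu : ∀ᵐ ω ∂P, (highSpread fun t => B t ω) ≠ u)
    (hnv : ∀ᵐ ω ∂P, (lowSpread fun t => B t ω) ≠ -v) {f : ℝ → ℝ≥0∞} (hf : Measurable f) :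
    ∫⁻ ω, {ω | u ≤ (highSpread fun t => B t ω) ∧ (lowSpread fun t => B t ω) ≤ -v}.indicator
      (fun ω => (Ioo 0 u).indicator f (B 1 ω)) ω ∂P +
      ∫⁻ x in Ioo 0 u, f x * negKernel x (u - x) v =
      ∫⁻ x in Ioo 0 u, f x * posKernel x (u - x) v := by
  refine lintegral_event_eq hB.toIsPreBrownianReal ?_ isOpen_Ioo
    (measurable_negKernel.comp (by fun_prop : Measurable fun x : ℝ => (x, u - x, v)))
    (measurable_posKernel.comp (by fun_prop : Measurable fun x : ℝ => (x, u - x, v)))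
    (lintegral_posKernel_lt_top hB.toIsPreBrownianReal hv) (fun T hT hTU => ?_) hf
  · exact ((aemeasurable_highSpread hB).nullMeasurable measurableSet_Ici).inter
      ((aemeasurable_lowSpread hB).nullMeasurable measurableSet_Iic)
  · exact measure_both_inter hB hu hv hnu hnv hT hTU

end

/-! ### Integrals of normalised monomials, and Gaussian moments on the half-line -/

section

/-- The normalised monomial `x ^ n / n!`, as an extended nonnegative real. -/
def nmono (n : ℕ) (x : ℝ) : ℝ≥0∞ := ENNReal.ofReal (x ^ n / n.factorial)

@[fun_prop]
lemma measurable_nmono (n : ℕ) : Measurable (nmono n) := by unfold nmono; fun_prop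

@[simp] lemma nmono_zero (x : ℝ) : nmono 0 x = 1 := by simp [nmono]

lemma lintegral_Ioi_eq_shift (ψ : ℝ → ℝ≥0∞) (s : ℝ) :
    ∫⁻ r in Ioi 0, ψ (s + r) = ∫⁻ t in Ioi s, ψ t := by
  rw [← lintegral_indicator measurableSet_Ioi, ← lintegral_indicator measurableSet_Ioi,
    ← lintegral_add_left_eq_self ((Ioi s).indicator ψ) s]
  refine lintegral_congr fun x => ?_
  simp [Set.indicator]

lemma lintegral_nmono_Ioc {t : ℝ} (ht : 0 ≤ t) (n : ℕ) :
    ∫⁻ s in Ioc 0 t, nmono n s = nmono (n + 1) t := by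
  unfold nmono
  rw [← ofReal_integral_eq_lintegral_ofReal]
  · congr 1
    rw [← intervalIntegral.integral_of_le ht, intervalIntegral.integral_div, integral_pow,
      Nat.factorial_succ]
    push_cast
    field_simp
    simp
  · exact (by fun_prop : Continuous fun s : ℝ => s ^ n / (n.factorial : ℝ)).integrableOn_Icc.mono_set
      Ioc_subset_Icc_self
  · filter_upwards [ae_restrict_mem measurableSet_Ioc] with s hs
    have := hs.1.le
    simp only [Pi.zero_apply]
    positivity

/-- Tonelli on `s < t`, followed by integration of `s ^ n / n!` up to `t`. Dividing by `n!` makes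
each tail integration a pure shift of the index. -/
lemma lintegral_nmono_mul_tail {ψ : ℝ → ℝ≥0∞} (hψ : Measurable ψ) (n : ℕ) :
    ∫⁻ s in Ioi 0, nmono n s * ∫⁻ r in Ioi 0, ψ (s + r) =
      ∫⁻ t in Ioi 0, nmono (n + 1) t * ψ t := by
  have hS : MeasurableSet {q : ℝ × ℝ | q.1 < q.2} := measurableSet_lt measurable_fst measurable_snd
  have h1 : ∀ s ∈ Ioi (0 : ℝ), nmono n s * ∫⁻ r in Ioi 0, ψ (s + r) =
      ∫⁻ t in Ioi 0, {q : ℝ × ℝ | q.1 < q.2}.indicator (fun q => nmono n q.1 * ψ q.2) (s, t) := by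
    intro s hs
    rw [lintegral_Ioi_eq_shift, ← lintegral_const_mul _ hψ, ← lintegral_indicator measurableSet_Ioi,
      ← lintegral_indicator measurableSet_Ioi]
    refine lintegral_congr fun t => ?_
    by_cases hst : s < t
    · have : 0 < t := lt_trans hs hst
      simp [Set.indicator, hst, this]
    · simp [Set.indicator, hst]
  rw [setLIntegral_congr_fun measurableSet_Ioi h1, lintegral_lintegral_swap]
  · refine setLIntegral_congr_fun measurableSet_Ioi fun t ht => ?_
    have h2 : ∀ s, {q : ℝ × ℝ | q.1 < q.2}.indicator (fun q => nmono n q.1 * ψ q.2) (s, t) =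
        (Iio t).indicator (fun s => nmono n s * ψ t) s := fun s => by simp [Set.indicator]
    simp_rw [h2]
    rw [lintegral_indicator measurableSet_Iio, Measure.restrict_restrict measurableSet_Iio,
      lintegral_mul_const _ (measurable_nmono n), Iio_inter_Ioi, setLIntegral_congr Ioo_ae_eq_Ioc,
      lintegral_nmono_Ioc (le_of_lt ht)]
  · exact (Measurable.indicator (by fun_prop) hS).aemeasurable

lemma measurable_tail {ψ : ℝ → ℝ≥0∞} (hψ : Measurable ψ) :
    Measurable fun x : ℝ => ∫⁻ r in Ioi 0, ψ (x + r) :=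
  Measurable.lintegral_prod_right' (f := fun q : ℝ × ℝ => ψ (q.1 + q.2)) (by fun_prop)

/-- Normalised monomials convolve to a normalised monomial, without a Beta factor. In the induction
one power of `p` is traded for a further tail integral. -/
lemma lintegral_nmono_nmono {ψ : ℝ → ℝ≥0∞} (hψ : Measurable ψ) (a b : ℕ) :
    ∫⁻ x in Ioi 0, nmono a x * ∫⁻ p in Ioi 0, nmono b p * ψ (x + p) =
      ∫⁻ t in Ioi 0, nmono (a + b + 1) t * ψ t := by
  induction b generalizing ψ with
  | zero => simpa using lintegral_nmono_mul_tail hψ a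
  | succ b ih =>
    have h1 : ∀ x : ℝ, ∫⁻ p in Ioi 0, nmono (b + 1) p * ψ (x + p) =
        ∫⁻ s in Ioi 0, nmono b s * ∫⁻ r in Ioi 0, ψ (x + s + r) := fun x => by
      rw [← lintegral_nmono_mul_tail (ψ := fun p => ψ (x + p)) (by fun_prop)]
      simp only [add_assoc]
    simp_rw [h1]
    rw [ih (ψ := fun y => ∫⁻ r in Ioi 0, ψ (y + r)) (measurable_tail hψ),
      lintegral_nmono_mul_tail hψ]
    rfl

lemma lintegral_Ioi_scale {F : ℝ → ℝ≥0∞} (hF : Measurable F) {α : ℝ} (hα : 0 < α) (n : ℕ) :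
    ∫⁻ x in Ioi 0, nmono n x * F (α * x) =
      ENNReal.ofReal ((α ^ (n + 1))⁻¹) * ∫⁻ x in Ioi 0, nmono n x * F x := by
  have h1 : ∀ x : ℝ, (Ioi 0).indicator (fun x => nmono n x * F (α * x)) x =
      ENNReal.ofReal ((α ^ n)⁻¹) * (Ioi 0).indicator (fun x => nmono n x * F x) (α * x) := by
    intro x
    by_cases hx : 0 < x
    · have : 0 < α * x := by positivity
      simp only [Set.indicator, mem_Ioi, hx, this, if_true, nmono]
      rw [← mul_assoc, ← ENNReal.ofReal_mul (by positivity)]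
      congr 2
      rw [mul_pow]
      field_simp
    · have : ¬ 0 < α * x := fun h => hx (by
        by_contra h'
        nlinarith)
      simp [Set.indicator, hx, this]
  have hm : Measurable ((Ioi 0).indicator fun x => nmono n x * F x) :=
    Measurable.indicator (by fun_prop) measurableSet_Ioi
  rw [← lintegral_indicator measurableSet_Ioi]
  simp_rw [h1]
  rw [lintegral_const_mul' _ _ ENNReal.ofReal_ne_top,
    ← lintegral_map hm (measurable_const_mul α), Real.map_volume_mul_left hα.ne',
    lintegral_smul_measure, lintegral_indicator measurableSet_Ioi, smul_eq_mul, ← mul_assoc,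
    ← ENNReal.ofReal_mul (by positivity), abs_of_pos (by positivity)]
  congr 2
  field_simp
  rw [pow_succ]

/-- Gamma-type integrals against a function of a positive linear form in two variables. -/
lemma lintegral_linear_two {ψ : ℝ → ℝ≥0∞} (hψ : Measurable ψ) (i j : ℕ) {α β : ℝ} (hα : 0 < α)
    (hβ : 0 < β) :
    ∫⁻ x in Ioi 0, nmono i x * ∫⁻ p in Ioi 0, nmono j p * ψ (α * x + β * p) =
      ENNReal.ofReal ((α ^ (i + 1))⁻¹ * (β ^ (j + 1))⁻¹) *
        ∫⁻ t in Ioi 0, nmono (i + j + 1) t * ψ t := by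
  have h1 : ∀ x : ℝ, ∫⁻ p in Ioi 0, nmono j p * ψ (α * x + β * p) =
      ENNReal.ofReal ((β ^ (j + 1))⁻¹) * ∫⁻ p in Ioi 0, nmono j p * ψ (α * x + p) := fun x =>
    lintegral_Ioi_scale (F := fun p => ψ (α * x + p)) (by fun_prop) hβ j
  have hm : Measurable fun y : ℝ => ∫⁻ p in Ioi 0, nmono j p * ψ (y + p) :=
    Measurable.lintegral_prod_right' (f := fun q : ℝ × ℝ => nmono j q.2 * ψ (q.1 + q.2))
      (by fun_prop)
  simp_rw [h1, mul_left_comm (nmono i _)]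
  rw [lintegral_const_mul' _ _ ENNReal.ofReal_ne_top,
    lintegral_Ioi_scale (F := fun y => ∫⁻ p in Ioi 0, nmono j p * ψ (y + p)) hm hα,
    lintegral_nmono_nmono hψ, ← mul_assoc, ← ENNReal.ofReal_mul (by positivity), mul_comm (_)⁻¹]

/-- Gamma-type integrals against a function of a positive linear form in three variables. -/
lemma lintegral_linear_three {ψ : ℝ → ℝ≥0∞} (hψ : Measurable ψ) (i j k : ℕ) {α β γ : ℝ}
    (hα : 0 < α) (hβ : 0 < β) (hγ : 0 < γ) :
    ∫⁻ x in Ioi 0, nmono i x * ∫⁻ p in Ioi 0, nmono j p * ∫⁻ v in Ioi 0, nmono k v *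
        ψ (α * x + β * p + γ * v) =
      ENNReal.ofReal ((α ^ (i + 1))⁻¹ * (β ^ (j + 1))⁻¹ * (γ ^ (k + 1))⁻¹) *
        ∫⁻ t in Ioi 0, nmono (i + j + k + 2) t * ψ t := by
  have h1 : ∀ x : ℝ, ∫⁻ p in Ioi 0, nmono j p * ∫⁻ v in Ioi 0, nmono k v *
        ψ (α * x + β * p + γ * v) = ENNReal.ofReal ((β ^ (j + 1))⁻¹ * (γ ^ (k + 1))⁻¹) *
        ∫⁻ t in Ioi 0, nmono (j + k + 1) t * ψ (α * x + t) := fun x => by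
    rw [← lintegral_linear_two (ψ := fun t => ψ (α * x + t)) (by fun_prop) j k hβ hγ]
    simp only [add_assoc]
  have hm : Measurable fun y : ℝ => ∫⁻ t in Ioi 0, nmono (j + k + 1) t * ψ (y + t) :=
    Measurable.lintegral_prod_right' (f := fun q : ℝ × ℝ => nmono (j + k + 1) q.2 * ψ (q.1 + q.2))
      (by fun_prop)
  simp_rw [h1, mul_left_comm (nmono i _)]
  rw [lintegral_const_mul' _ _ ENNReal.ofReal_ne_top,
    lintegral_Ioi_scale (F := fun y => ∫⁻ t in Ioi 0, nmono (j + k + 1) t * ψ (y + t)) hm hα,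
    lintegral_nmono_nmono hψ, ← mul_assoc, ← ENNReal.ofReal_mul (by positivity),
    show i + (j + k + 1) + 1 = i + j + k + 2 by ring]
  congr 2
  ring

/-- Half-line moments of the standard Gaussian density. -/
def halfMoment (n : ℕ) : ℝ≥0∞ := ∫⁻ t in Ioi 0, nmono n t * gaussianPDF 0 1 t

lemma halfMoment_eq (n : ℕ) : halfMoment n = ENNReal.ofReal
    ((n.factorial : ℝ)⁻¹ * (√(2 * Real.pi))⁻¹ *
      ((1 / 2 : ℝ) ^ (-((n : ℝ) + 1) / 2) * (1 / 2) * Real.Gamma (((n : ℝ) + 1) / 2))) := by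
  have hn : (-1 : ℝ) < n := by have := n.cast_nonneg (α := ℝ); linarith
  rw [← integral_rpow_mul_exp_neg_mul_rpow (by norm_num : (0 : ℝ) < 2) hn
    (by norm_num : (0 : ℝ) < 1 / 2), ← integral_const_mul, ofReal_integral_eq_lintegral_ofReal]
  · refine setLIntegral_congr_fun measurableSet_Ioi fun t ht => ?_
    have ht : 0 < t := ht
    simp only [nmono, gaussianPDF, gaussianPDFReal]
    rw [← ENNReal.ofReal_mul (by positivity)]
    congr 1
    simp only [Real.rpow_natCast, NNReal.coe_one, mul_one, sub_zero, Real.rpow_ofNat]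
    rw [show -(1 / 2) * t ^ 2 = -t ^ 2 / 2 by ring]
    ring
  · have := integrableOn_rpow_mul_exp_neg_mul_sq (by norm_num : (0 : ℝ) < 1 / 2) hn
    simpa using (this.const_mul ((n.factorial : ℝ)⁻¹ * (√(2 * Real.pi))⁻¹))
  · filter_upwards [ae_restrict_mem measurableSet_Ioi] with t ht
    have ht : 0 < t := ht
    simp only [Pi.zero_apply]
    positivity

lemma halfMoment_two : halfMoment 2 = ENNReal.ofReal (1 / 4) := by
  rw [halfMoment_eq]
  congr 1
  have h1 : Real.Gamma ((((2 : ℕ) : ℝ) + 1) / 2) = √Real.pi / 2 := by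
    rw [show (((2 : ℕ) : ℝ) + 1) / 2 = 1 / 2 + 1 by norm_num,
      Real.Gamma_add_one (by norm_num), Real.Gamma_one_half_eq]; ring
  have h2 : (1 / 2 : ℝ) ^ (-(((2 : ℕ) : ℝ) + 1) / 2) = 2 * √2 := by
    rw [one_div, Real.inv_rpow (by norm_num), ← Real.rpow_neg (by norm_num), Real.sqrt_eq_rpow,
      show -(-(((2 : ℕ) : ℝ) + 1) / 2) = 1 + 1 / 2 by norm_num, Real.rpow_add (by norm_num),
      Real.rpow_one]
  rw [h1, h2, Real.sqrt_mul (by norm_num)]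
  have := Real.sqrt_pos.2 Real.pi_pos
  norm_num [Nat.factorial]
  field_simp
  norm_num

lemma halfMoment_four : halfMoment 4 = ENNReal.ofReal (1 / 16) := by
  rw [halfMoment_eq]
  congr 1
  have h1 : Real.Gamma ((((4 : ℕ) : ℝ) + 1) / 2) = 3 * √Real.pi / 4 := by
    rw [show (((4 : ℕ) : ℝ) + 1) / 2 = 1 / 2 + 1 + 1 by norm_num,
      Real.Gamma_add_one (by norm_num), Real.Gamma_add_one (by norm_num),
      Real.Gamma_one_half_eq]; ring
  have h2 : (1 / 2 : ℝ) ^ (-(((4 : ℕ) : ℝ) + 1) / 2) = 4 * √2 := by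
    rw [one_div, Real.inv_rpow (by norm_num), ← Real.rpow_neg (by norm_num), Real.sqrt_eq_rpow,
      show -(-(((4 : ℕ) : ℝ) + 1) / 2) = 2 + 1 / 2 by norm_num, Real.rpow_add (by norm_num)]
    norm_num
  rw [h1, h2, Real.sqrt_mul (by norm_num)]
  have := Real.sqrt_pos.2 Real.pi_pos
  norm_num [Nat.factorial]
  field_simp
  norm_num

end

/-! ### Mixed moments of close, high and low on the event of a positive close -/

section

lemma nmono_ne_top (n : ℕ) (x : ℝ) : nmono n x ≠ ⊤ := ENNReal.ofReal_ne_top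

lemma lintegral_nmono_sub_Ioc {c h : ℝ} (hch : c ≤ h) (n : ℕ) :
    ∫⁻ u in Ioc c h, nmono n (u - c) = nmono (n + 1) (h - c) := by
  rw [← lintegral_nmono_Ioc (sub_nonneg.2 hch), ← lintegral_indicator measurableSet_Ioc,
    ← lintegral_indicator measurableSet_Ioc,
    ← lintegral_add_right_eq_self ((Ioc c h).indicator fun u => nmono n (u - c)) c]
  refine lintegral_congr fun x => ?_
  have : x + c ∈ Ioc c h ↔ x ∈ Ioc 0 (h - c) := by
    simp only [mem_Ioc]; constructor <;> rintro ⟨h1, h2⟩ <;> constructor <;> linarith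
  by_cases hx : x ∈ Ioc 0 (h - c)
  · rw [Set.indicator_of_mem hx, Set.indicator_of_mem (this.2 hx), add_sub_cancel_right]
  · rw [Set.indicator_of_notMem hx, Set.indicator_of_notMem fun h => hx (this.1 h)]

variable {Ω : Type*} [MeasurableSpace Ω] {P : Measure Ω} {B : ℝ≥0 → Ω → ℝ}

/-- Shearing the region `0 < x < u` to the quadrant. -/
lemma lintegral_shear {k : ℝ → ℝ → ℝ≥0∞} (hk : Measurable (Function.uncurry k)) :
    ∫⁻ u in Ioi 0, ∫⁻ x in Ioo 0 u, k x (u - x) = ∫⁻ x in Ioi 0, ∫⁻ p in Ioi 0, k x p := by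
  have hS : MeasurableSet {q : ℝ × ℝ | q.2 < q.1} := measurableSet_lt measurable_snd measurable_fst
  have h1 : ∀ u ∈ Ioi (0 : ℝ), ∫⁻ x in Ioo 0 u, k x (u - x) =
      ∫⁻ x in Ioi 0, {q : ℝ × ℝ | q.2 < q.1}.indicator (fun q => k q.2 (q.1 - q.2)) (u, x) := by
    intro u _
    rw [← lintegral_indicator measurableSet_Ioo, ← lintegral_indicator measurableSet_Ioi]
    refine lintegral_congr fun x => ?_
    by_cases hx : 0 < x <;> by_cases hxu : x < u <;> simp [Set.indicator, hx, hxu]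
  rw [setLIntegral_congr_fun measurableSet_Ioi h1, lintegral_lintegral_swap]
  · refine setLIntegral_congr_fun measurableSet_Ioi fun x hx => ?_
    rw [← lintegral_indicator measurableSet_Ioi, ← lintegral_indicator measurableSet_Ioi,
      ← lintegral_add_right_eq_self _ x]
    refine lintegral_congr fun p => ?_
    have hx : 0 < x := hx
    by_cases hp : 0 < p
    · have : 0 < p + x := by positivity
      simp [Set.indicator, hp, this]
    · simp [Set.indicator, hp]
  · refine (Measurable.indicator ?_ hS).aemeasurable
    exact hk.comp (by fun_prop : Measurable fun q : ℝ × ℝ => (q.2, q.1 - q.2))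

/-- Only countably many levels can carry positive mass. Since the barrier level is integrated
afterwards, almost every level suffices and continuity of the law of the maximum is not needed. -/
lemma ae_highSpread_ne (hB : IsBrownianReal B P) :
    ∀ᵐ u : ℝ, ∀ᵐ ω ∂P, (highSpread fun t => B t ω) ≠ u := by
  have hP : IsProbabilityMeasure P := hB.isGaussianProcess.isProbabilityMeasure
  have h := (Measure.countable_meas_level_set_pos₀ (μ := P)
    (aemeasurable_highSpread hB).nullMeasurable).measure_zero (volume : Measure ℝ)
  filter_upwards [measure_eq_zero_iff_ae_notMem.1 h] with u hu
  exact measure_eq_zero_iff_ae_notMem.1 (nonpos_iff_eq_zero.1 (not_lt.1 hu))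

lemma ae_lowSpread_ne (hB : IsBrownianReal B P) :
    ∀ᵐ v : ℝ, ∀ᵐ ω ∂P, (lowSpread fun t => B t ω) ≠ -v := by
  filter_upwards [ae_highSpread_ne hB.neg] with v hv
  filter_upwards [hv] with ω hω h
  refine hω ((highSpread_neg fun t => B t ω).trans ?_)
  rw [h, neg_neg]

/-- Moments of `(c, h - c)` on `c > 0`. -/
theorem lintegral_close_high (hB : IsBrownianReal B P) (i j : ℕ) :
    ∫⁻ ω, (Ioi 0).indicator (nmono i) (B 1 ω) *
      nmono (j + 1) ((highSpread fun t => B t ω) - B 1 ω) ∂P =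
      ENNReal.ofReal ((2 ^ (j + 1))⁻¹) * halfMoment (i + j + 1) := by
  have hP : IsProbabilityMeasure P := hB.isGaussianProcess.isProbabilityMeasure
  have hh := aemeasurable_highSpread hB
  have hg : Measurable (gaussianPDF 0 1) := measurable_gaussianPDF 0 1
  set Y : Ω → ℝ × ℝ := fun ω => (B 1 ω, highSpread fun t => B t ω) with hY
  have hYm : AEMeasurable Y P := (hB.aemeasurable 1).prodMk hh
  have : IsProbabilityMeasure (P.map Y) := Measure.isProbabilityMeasure_map hYm
  have hcu : Measurable (Function.uncurry fun (q : ℝ × ℝ) (u : ℝ) =>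
      {q : ℝ × ℝ | u ≤ q.2}.indicator
        (fun q => (Ioo 0 u).indicator (fun x => nmono i x * nmono j (u - x)) q.1) q) := by
    have : (Function.uncurry fun (q : ℝ × ℝ) (u : ℝ) => {q : ℝ × ℝ | u ≤ q.2}.indicator
        (fun q => (Ioo 0 u).indicator (fun x => nmono i x * nmono j (u - x)) q.1) q) =
        fun s : (ℝ × ℝ) × ℝ => {s : (ℝ × ℝ) × ℝ | s.2 ≤ s.1.2 ∧ 0 < s.1.1 ∧ s.1.1 < s.2}.indicator
          (fun s => nmono i s.1.1 * nmono j (s.2 - s.1.1)) s := by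
      ext ⟨q, u⟩
      by_cases h1 : u ≤ q.2 <;> by_cases h2 : 0 < q.1 <;> by_cases h3 : q.1 < u <;>
        simp [Set.indicator, h1, h2, h3]
    rw [this]
    refine Measurable.indicator (by fun_prop) ?_
    exact (measurableSet_le measurable_snd (measurable_snd.comp measurable_fst)).inter
      ((measurableSet_lt measurable_const (measurable_fst.comp measurable_fst)).inter
        (measurableSet_lt (measurable_fst.comp measurable_fst) measurable_snd))
  calc _ = ∫⁻ q, (Ioi 0).indicator (nmono i) q.1 * nmono (j + 1) (q.2 - q.1) ∂(P.map Y) := by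
        rw [lintegral_map' _ hYm]
        exact (Measurable.mul (((measurable_nmono i).indicator measurableSet_Ioi).comp
          measurable_fst) (by fun_prop)).aemeasurable
    -- Layer-cake step: the power of `h - c` is the integral over levels `u` between `c` and `h` of
    -- the next lower power of `u - c`, which turns the moment into barrier probabilities.
    _ = ∫⁻ q, ∫⁻ u in Ioi 0, {q : ℝ × ℝ | u ≤ q.2}.indicator
        (fun q => (Ioo 0 u).indicator (fun x => nmono i x * nmono j (u - x)) q.1) q
          ∂volume ∂(P.map Y) := by
        refine lintegral_congr_ae ?_
        have : ∀ᵐ q ∂(P.map Y), q.1 ≤ q.2 := by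
          rw [ae_map_iff hYm (measurableSet_le measurable_fst measurable_snd)]
          filter_upwards [hB.cont, hB.eval_zero_ae_eq_zero] with ω hω h0
          have := closeSpread_le_highSpread hω
          simpa [closeSpread, h0] using this
        filter_upwards [this] with q hq
        by_cases h0 : 0 < q.1
        · rw [Set.indicator_of_mem (show q.1 ∈ Ioi 0 from h0), ← lintegral_nmono_sub_Ioc hq,
            ← lintegral_const_mul _ (by fun_prop), ← lintegral_indicator measurableSet_Ioc,
            ← lintegral_indicator measurableSet_Ioi]
          refine lintegral_congr fun u => ?_
          by_cases h1 : u ≤ q.2 <;> by_cases h2 : q.1 < u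
          · have : 0 < u := h0.trans h2
            simp [Set.indicator, h1, h2, h0, this]
          all_goals simp [Set.indicator, h1, h2]
        · rw [Set.indicator_of_notMem (show q.1 ∉ Ioi 0 from h0), zero_mul]
          simp [Set.indicator, h0]
    _ = ∫⁻ u in Ioi 0, ∫⁻ q, {q : ℝ × ℝ | u ≤ q.2}.indicator
        (fun q => (Ioo 0 u).indicator (fun x => nmono i x * nmono j (u - x)) q.1) q
          ∂(P.map Y) := lintegral_lintegral_swap hcu.aemeasurable
    _ = ∫⁻ u in Ioi 0, ∫⁻ x in Ioo 0 u, nmono i x * nmono j (u - x) *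
          gaussianPDF 0 1 (2 * u - x) := by
        refine lintegral_congr_ae ?_
        filter_upwards [ae_restrict_of_ae (ae_highSpread_ne hB),
          ae_restrict_mem measurableSet_Ioi] with u hu hu0
        rw [← lintegral_high hB hu0 hu (by fun_prop), lintegral_map' _ hYm]
        · rfl
        · exact (hcu.comp (by fun_prop : Measurable fun q : ℝ × ℝ => (q, u))).aemeasurable
    _ = ∫⁻ x in Ioi 0, nmono i x * ∫⁻ p in Ioi 0, nmono j p * gaussianPDF 0 1 (1 * x + 2 * p) := by
        simp_rw [← lintegral_const_mul' _ _ (nmono_ne_top i _)]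
        rw [← lintegral_shear (k := fun x p => nmono i x * (nmono j p *
          gaussianPDF 0 1 (1 * x + 2 * p)))
          (by simp only [Function.uncurry_def]; fun_prop)]
        refine lintegral_congr fun u => lintegral_congr fun x => ?_
        rw [mul_assoc]; congr 3; ring
    _ = _ := by
        rw [lintegral_linear_two hg i j one_pos two_pos, one_pow, inv_one, one_mul]
        rfl

/-- Moments of `(c, -l)` on `c > 0`. -/
theorem lintegral_close_low (hB : IsBrownianReal B P) (i k : ℕ) :
    ∫⁻ ω, (Ioi 0).indicator (nmono i) (B 1 ω) * nmono (k + 1) (-(lowSpread fun t => B t ω)) ∂P =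
      ENNReal.ofReal ((2 ^ (k + 1))⁻¹) * halfMoment (i + k + 1) := by
  have hP : IsProbabilityMeasure P := hB.isGaussianProcess.isProbabilityMeasure
  have hg : Measurable (gaussianPDF 0 1) := measurable_gaussianPDF 0 1
  set Y : Ω → ℝ × ℝ := fun ω => (B 1 ω, -lowSpread fun t => B t ω) with hY
  have hYm : AEMeasurable Y P := (hB.aemeasurable 1).prodMk (aemeasurable_lowSpread hB).neg
  have : IsProbabilityMeasure (P.map Y) := Measure.isProbabilityMeasure_map hYm
  have hcu : Measurable (Function.uncurry fun (q : ℝ × ℝ) (v : ℝ) =>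
      {q : ℝ × ℝ | v ≤ q.2}.indicator
        (fun q => (Ioi 0).indicator (fun x => nmono i x * nmono k v) q.1) q) := by
    have : (Function.uncurry fun (q : ℝ × ℝ) (v : ℝ) => {q : ℝ × ℝ | v ≤ q.2}.indicator
        (fun q => (Ioi 0).indicator (fun x => nmono i x * nmono k v) q.1) q) =
        fun s : (ℝ × ℝ) × ℝ => {s : (ℝ × ℝ) × ℝ | s.2 ≤ s.1.2 ∧ 0 < s.1.1}.indicator
          (fun s => nmono i s.1.1 * nmono k s.2) s := by
      ext ⟨q, v⟩
      by_cases h1 : v ≤ q.2 <;> by_cases h2 : 0 < q.1 <;> simp [Set.indicator, h1, h2]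
    rw [this]
    refine Measurable.indicator (by fun_prop) ?_
    exact (measurableSet_le measurable_snd (measurable_snd.comp measurable_fst)).inter
      (measurableSet_lt measurable_const (measurable_fst.comp measurable_fst))
  calc _ = ∫⁻ q, (Ioi 0).indicator (nmono i) q.1 * nmono (k + 1) q.2 ∂(P.map Y) := by
        rw [lintegral_map' _ hYm]
        exact (Measurable.mul (((measurable_nmono i).indicator measurableSet_Ioi).comp
          measurable_fst) (by fun_prop)).aemeasurable
    _ = ∫⁻ q, ∫⁻ v in Ioi 0, {q : ℝ × ℝ | v ≤ q.2}.indicator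
        (fun q => (Ioi 0).indicator (fun x => nmono i x * nmono k v) q.1) q
          ∂volume ∂(P.map Y) := by
        refine lintegral_congr_ae ?_
        have : ∀ᵐ q ∂(P.map Y), 0 ≤ q.2 := by
          rw [ae_map_iff hYm (measurableSet_le measurable_const measurable_snd)]
          filter_upwards [hB.cont] with ω hω
          exact neg_nonneg.2 (lowSpread_nonpos hω)
        filter_upwards [this] with q hq
        by_cases h0 : 0 < q.1
        · rw [Set.indicator_of_mem (show q.1 ∈ Ioi 0 from h0), ← lintegral_nmono_Ioc hq,
            ← lintegral_const_mul _ (by fun_prop), ← lintegral_indicator measurableSet_Ioc,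
            ← lintegral_indicator measurableSet_Ioi]
          refine lintegral_congr fun v => ?_
          by_cases h1 : v ≤ q.2 <;> by_cases h2 : 0 < v <;> simp [Set.indicator, h1, h2, h0]
        · rw [Set.indicator_of_notMem (show q.1 ∉ Ioi 0 from h0), zero_mul]
          simp [Set.indicator, h0]
    _ = ∫⁻ v in Ioi 0, ∫⁻ q, {q : ℝ × ℝ | v ≤ q.2}.indicator
        (fun q => (Ioi 0).indicator (fun x => nmono i x * nmono k v) q.1) q
          ∂(P.map Y) := lintegral_lintegral_swap hcu.aemeasurable
    _ = ∫⁻ v in Ioi 0, ∫⁻ x in Ioi 0, nmono i x * nmono k v * gaussianPDF 0 1 (x + 2 * v) := by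
        refine lintegral_congr_ae ?_
        filter_upwards [ae_restrict_of_ae (ae_lowSpread_ne hB),
          ae_restrict_mem measurableSet_Ioi] with v hv hv0
        rw [← lintegral_low hB hv0 hv (by fun_prop), lintegral_map' _ hYm]
        · refine lintegral_congr fun ω => ?_
          simp only [Set.indicator, mem_ofPred_eq, hY, le_neg]
        · exact (hcu.comp (by fun_prop : Measurable fun q : ℝ × ℝ => (q, v))).aemeasurable
    _ = ∫⁻ x in Ioi 0, nmono i x * ∫⁻ v in Ioi 0, nmono k v * gaussianPDF 0 1 (1 * x + 2 * v) := by
        rw [lintegral_lintegral_swap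
          (by simp only [Function.uncurry_def]; exact Measurable.aemeasurable (by fun_prop))]
        simp_rw [← lintegral_const_mul' _ _ (nmono_ne_top i _), one_mul, mul_assoc]
    _ = _ := by
        rw [lintegral_linear_two hg i k one_pos two_pos, one_pow, inv_one, one_mul]
        rfl

lemma measurable_negKernel_comp {α : Type*} [MeasurableSpace α] {x p v : α → ℝ}
    (hx : Measurable x) (hp : Measurable p) (hv : Measurable v) :
    Measurable fun a => negKernel (x a) (p a) (v a) := by
  have hg : Measurable (gaussianPDF 0 1) := measurable_gaussianPDF 0 1
  exact Measurable.tsum fun n => by fun_prop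

/-- Coefficient of the positive terms in the mixed moments of `(c, h - c, -l)`. -/
def posCoeff (i j k n : ℕ) : ℝ :=
  ((2 * n + 3 : ℝ) ^ (i + 1))⁻¹ * ((2 * n + 2 : ℝ) ^ j)⁻¹ * ((2 * n + 2 : ℝ) ^ k)⁻¹ +
    ((2 * n + 1 : ℝ) ^ (i + 1))⁻¹ * ((2 * n + 2 : ℝ) ^ j)⁻¹ * ((2 * n + 2 : ℝ) ^ k)⁻¹

/-- Coefficient of the negative terms in the mixed moments of `(c, h - c, -l)`. -/
def negCoeff (i j k n : ℕ) : ℝ :=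
  ((2 * n + 3 : ℝ) ^ (i + 1))⁻¹ * ((2 * n + 4 : ℝ) ^ j)⁻¹ * ((2 * n + 2 : ℝ) ^ k)⁻¹ +
    ((2 * n + 3 : ℝ) ^ (i + 1))⁻¹ * ((2 * n + 2 : ℝ) ^ j)⁻¹ * ((2 * n + 4 : ℝ) ^ k)⁻¹

lemma lintegral_tsum_add {α : Type*} [MeasurableSpace α] {μ : Measure α} {f g : ℕ → α → ℝ≥0∞}
    (hf : ∀ n, Measurable (f n)) (hg : ∀ n, Measurable (g n)) :
    ∫⁻ a, ∑' n, (f n a + g n a) ∂μ = ∑' n, ((∫⁻ a, f n a ∂μ) + ∫⁻ a, g n a ∂μ) := by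
  rw [lintegral_tsum (f := fun n a => f n a + g n a)
    fun n => (Measurable.add (hf n) (hg n)).aemeasurable]
  exact tsum_congr fun n => lintegral_add_left (hf n) _

/-- All terms are nonnegative, so the series commutes with the three integrals, and each term is a
Gamma-type integral of a positive linear form. -/
lemma lintegral_kernel {K : ℝ → ℝ → ℝ → ℝ≥0∞} {α₁ β₁ γ₁ α₂ β₂ γ₂ : ℕ → ℝ}
    (hK : ∀ x p v, K x p v = ∑' n, (gaussianPDF 0 1 (α₁ n * x + β₁ n * p + γ₁ n * v) +
      gaussianPDF 0 1 (α₂ n * x + β₂ n * p + γ₂ n * v)))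
    (h1 : ∀ n, 0 < α₁ n ∧ 0 < β₁ n ∧ 0 < γ₁ n) (h2 : ∀ n, 0 < α₂ n ∧ 0 < β₂ n ∧ 0 < γ₂ n)
    (i j k : ℕ) :
    ∫⁻ x in Ioi 0, ∫⁻ p in Ioi 0, ∫⁻ v in Ioi 0, nmono i x * nmono j p * nmono k v * K x p v =
      (∑' n, ENNReal.ofReal (((α₁ n) ^ (i + 1))⁻¹ * ((β₁ n) ^ (j + 1))⁻¹ * ((γ₁ n) ^ (k + 1))⁻¹ +
        ((α₂ n) ^ (i + 1))⁻¹ * ((β₂ n) ^ (j + 1))⁻¹ * ((γ₂ n) ^ (k + 1))⁻¹)) *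
        halfMoment (i + j + k + 2) := by
  have hg : Measurable (gaussianPDF 0 1) := measurable_gaussianPDF 0 1
  let g1 : ℕ → ℝ → ℝ → ℝ → ℝ≥0∞ := fun n x p v =>
    nmono i x * (nmono j p * (nmono k v * gaussianPDF 0 1 (α₁ n * x + β₁ n * p + γ₁ n * v)))
  let g2 : ℕ → ℝ → ℝ → ℝ → ℝ≥0∞ := fun n x p v =>
    nmono i x * (nmono j p * (nmono k v * gaussianPDF 0 1 (α₂ n * x + β₂ n * p + γ₂ n * v)))
  have hm1 : ∀ n, Measurable fun q : (ℝ × ℝ) × ℝ => g1 n q.1.1 q.1.2 q.2 := fun n => by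
    simp only [g1]; fun_prop
  have hm2 : ∀ n, Measurable fun q : (ℝ × ℝ) × ℝ => g2 n q.1.1 q.1.2 q.2 := fun n => by
    simp only [g2]; fun_prop
  have hm1v : ∀ n, Measurable fun q : ℝ × ℝ => ∫⁻ v in Ioi 0, g1 n q.1 q.2 v := fun n =>
    Measurable.lintegral_prod_right' (hm1 n)
  have hm2v : ∀ n, Measurable fun q : ℝ × ℝ => ∫⁻ v in Ioi 0, g2 n q.1 q.2 v := fun n =>
    Measurable.lintegral_prod_right' (hm2 n)
  have e1 : ∀ x p v, nmono i x * nmono j p * nmono k v * K x p v = ∑' n, (g1 n x p v + g2 n x p v) := by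
    intro x p v
    rw [hK, ← ENNReal.tsum_mul_left]
    refine tsum_congr fun n => ?_
    simp only [g1, g2]; ring
  have e2 : ∀ x p, ∫⁻ v in Ioi 0, ∑' n, (g1 n x p v + g2 n x p v) =
      ∑' n, ((∫⁻ v in Ioi 0, g1 n x p v) + ∫⁻ v in Ioi 0, g2 n x p v) := fun x p => by
    have hc : Measurable fun v : ℝ => ((x, p), v) := by fun_prop
    exact lintegral_tsum_add (fun n => (hm1 n).comp hc) fun n => (hm2 n).comp hc
  have e3 : ∀ x, ∫⁻ p in Ioi 0, ∑' n, ((∫⁻ v in Ioi 0, g1 n x p v) + ∫⁻ v in Ioi 0, g2 n x p v) =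
      ∑' n, ((∫⁻ p in Ioi 0, ∫⁻ v in Ioi 0, g1 n x p v) +
        ∫⁻ p in Ioi 0, ∫⁻ v in Ioi 0, g2 n x p v) := fun x => by
    have hc : Measurable fun p : ℝ => (x, p) := by fun_prop
    exact lintegral_tsum_add (fun n => (hm1v n).comp hc) fun n => (hm2v n).comp hc
  have hm1p : ∀ n, Measurable fun x : ℝ => ∫⁻ p in Ioi 0, ∫⁻ v in Ioi 0, g1 n x p v := fun n =>
    Measurable.lintegral_prod_right' (hm1v n)
  have hm2p : ∀ n, Measurable fun x : ℝ => ∫⁻ p in Ioi 0, ∫⁻ v in Ioi 0, g2 n x p v := fun n =>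
    Measurable.lintegral_prod_right' (hm2v n)
  simp_rw [e1, e2, e3]
  rw [lintegral_tsum_add hm1p hm2p, ← ENNReal.tsum_mul_right]
  refine tsum_congr fun n => ?_
  obtain ⟨a1, b1, c1⟩ := h1 n
  obtain ⟨a2, b2, c2⟩ := h2 n
  rw [ENNReal.ofReal_add (by positivity) (by positivity), add_mul]
  simp only [g1, g2, lintegral_const_mul' _ _ (nmono_ne_top _ _)]
  rw [lintegral_linear_three hg i j k a1 b1 c1, lintegral_linear_three hg i j k a2 b2 c2]
  rfl

lemma lintegral_posKernel_moment (i j k : ℕ) :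
    ∫⁻ x in Ioi 0, ∫⁻ p in Ioi 0, ∫⁻ v in Ioi 0, nmono i x * nmono j p * nmono k v *
      posKernel x p v =
      (∑' n, ENNReal.ofReal (posCoeff i (j + 1) (k + 1) n)) * halfMoment (i + j + k + 2) :=
  lintegral_kernel (fun _ _ _ => rfl) (fun n => ⟨by positivity, by positivity, by positivity⟩)
    (fun n => ⟨by positivity, by positivity, by positivity⟩) i j k

lemma lintegral_negKernel_moment (i j k : ℕ) :
    ∫⁻ x in Ioi 0, ∫⁻ p in Ioi 0, ∫⁻ v in Ioi 0, nmono i x * nmono j p * nmono k v *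
      negKernel x p v =
      (∑' n, ENNReal.ofReal (negCoeff i (j + 1) (k + 1) n)) * halfMoment (i + j + k + 2) :=
  lintegral_kernel (fun _ _ _ => rfl) (fun n => ⟨by positivity, by positivity, by positivity⟩)
    (fun n => ⟨by positivity, by positivity, by positivity⟩) i j k

/-- Moments of `(c, h - c, -l)` on `c > 0`. -/
theorem lintegral_close_high_low (hB : IsBrownianReal B P) (i j k : ℕ) :
    ∫⁻ ω, (Ioi 0).indicator (nmono i) (B 1 ω) *
      nmono (j + 1) ((highSpread fun t => B t ω) - B 1 ω) *
      nmono (k + 1) (-(lowSpread fun t => B t ω)) ∂P +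
      (∑' n, ENNReal.ofReal (negCoeff i (j + 1) (k + 1) n)) * halfMoment (i + j + k + 2) =
      (∑' n, ENNReal.ofReal (posCoeff i (j + 1) (k + 1) n)) * halfMoment (i + j + k + 2) := by
  have hP : IsProbabilityMeasure P := hB.isGaussianProcess.isProbabilityMeasure
  set Y : Ω → ℝ × ℝ × ℝ := fun ω => (B 1 ω, highSpread fun t => B t ω,
    -lowSpread fun t => B t ω) with hY
  have hYm : AEMeasurable Y P := (hB.aemeasurable 1).prodMk
    ((aemeasurable_highSpread hB).prodMk (aemeasurable_lowSpread hB).neg)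
  have : IsProbabilityMeasure (P.map Y) := Measure.isProbabilityMeasure_map hYm
  let f : ℝ → ℝ → ℝ → ℝ≥0∞ := fun u v x => nmono i x * nmono j (u - x) * nmono k v
  let Φ : (ℝ × ℝ × ℝ) → ℝ → ℝ → ℝ≥0∞ := fun q u v =>
    {q : ℝ × ℝ × ℝ | u ≤ q.2.1 ∧ v ≤ q.2.2}.indicator
        (fun q => (Ioo 0 u).indicator (f u v) q.1) q
  have hΦ : Measurable fun s : ((ℝ × ℝ × ℝ) × ℝ) × ℝ => Φ s.1.1 s.1.2 s.2 := by
    have : (fun s : ((ℝ × ℝ × ℝ) × ℝ) × ℝ => Φ s.1.1 s.1.2 s.2) =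
        fun s => {s : ((ℝ × ℝ × ℝ) × ℝ) × ℝ | (s.1.2 ≤ s.1.1.2.1 ∧ s.2 ≤ s.1.1.2.2) ∧
          0 < s.1.1.1 ∧ s.1.1.1 < s.1.2}.indicator
          (fun s => nmono i s.1.1.1 * nmono j (s.1.2 - s.1.1.1) * nmono k s.2) s := by
      ext ⟨⟨q, u⟩, v⟩
      by_cases h1 : u ≤ q.2.1 <;> by_cases h2 : 0 < q.1 <;> by_cases h3 : q.1 < u <;>
        by_cases h4 : v ≤ q.2.2 <;> simp [Φ, f, Set.indicator, h1, h2, h3, h4]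
    rw [this]
    refine Measurable.indicator (by fun_prop) ?_
    have m1 : Measurable fun s : ((ℝ × ℝ × ℝ) × ℝ) × ℝ => s.1.2 := by fun_prop
    have m2 : Measurable fun s : ((ℝ × ℝ × ℝ) × ℝ) × ℝ => s.1.1.2.1 := by fun_prop
    have m3 : Measurable fun s : ((ℝ × ℝ × ℝ) × ℝ) × ℝ => s.1.1.2.2 := by fun_prop
    have m4 : Measurable fun s : ((ℝ × ℝ × ℝ) × ℝ) × ℝ => s.1.1.1 := by fun_prop
    exact ((measurableSet_le m1 m2).inter (measurableSet_le measurable_snd m3)).inter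
      ((measurableSet_lt measurable_const m4).inter (measurableSet_lt m4 m1))
  -- The layer-cake formula in two levels at once: `u` for the maximum and `v` for the minimum.
  have hmain : ∫⁻ ω, (Ioi 0).indicator (nmono i) (B 1 ω) *
      nmono (j + 1) ((highSpread fun t => B t ω) - B 1 ω) *
      nmono (k + 1) (-(lowSpread fun t => B t ω)) ∂P =
      ∫⁻ u in Ioi 0, ∫⁻ v in Ioi 0, ∫⁻ ω,
        {ω | u ≤ (highSpread fun t => B t ω) ∧ (lowSpread fun t => B t ω) ≤ -v}.indicator
      (fun ω => (Ioo 0 u).indicator (f u v) (B 1 ω)) ω ∂P := by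
    calc _ = ∫⁻ q, (Ioi 0).indicator (nmono i) q.1 * nmono (j + 1) (q.2.1 - q.1) *
          nmono (k + 1) q.2.2 ∂(P.map Y) := by
          rw [lintegral_map' _ hYm]
          exact (Measurable.mul (Measurable.mul (((measurable_nmono i).indicator
            measurableSet_Ioi).comp measurable_fst) (by fun_prop)) (by fun_prop)).aemeasurable
      _ = ∫⁻ q, ∫⁻ u in Ioi 0, ∫⁻ v in Ioi 0, Φ q u v ∂volume ∂volume ∂(P.map Y) := by
          refine lintegral_congr_ae ?_
          have h1 : ∀ᵐ q ∂(P.map Y), q.1 ≤ q.2.1 ∧ 0 ≤ q.2.2 := by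
            have m1 : Measurable fun q : ℝ × ℝ × ℝ => q.2.1 := by fun_prop
            have m2 : Measurable fun q : ℝ × ℝ × ℝ => q.2.2 := by fun_prop
            have m3 : MeasurableSet {q : ℝ × ℝ × ℝ | q.1 ≤ q.2.1 ∧ 0 ≤ q.2.2} :=
              (measurableSet_le measurable_fst m1).inter (measurableSet_le measurable_const m2)
            rw [ae_map_iff hYm m3]
            filter_upwards [hB.cont, hB.eval_zero_ae_eq_zero] with ω hω h0
            have := closeSpread_le_highSpread hω
            exact ⟨by simpa [closeSpread, h0] using this, neg_nonneg.2 (lowSpread_nonpos hω)⟩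
          filter_upwards [h1] with q hq
          have e1 : ∀ u, ∫⁻ v in Ioi 0, Φ q u v =
              (Ioc q.1 q.2.1).indicator (fun u => (Ioi 0).indicator (nmono i) q.1 *
                nmono j (u - q.1)) u * nmono (k + 1) q.2.2 := by
            intro u
            rw [← lintegral_nmono_Ioc hq.2, ← lintegral_const_mul _ (by fun_prop),
              ← lintegral_indicator measurableSet_Ioc, ← lintegral_indicator measurableSet_Ioi]
            refine lintegral_congr fun v => ?_
            by_cases h1 : u ≤ q.2.1 <;> by_cases h2 : 0 < q.1 <;> by_cases h3 : q.1 < u <;>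
              by_cases h4 : v ≤ q.2.2 <;> by_cases h5 : 0 < v <;>
              simp [Φ, f, Set.indicator, h1, h2, h3, h4, h5]
          have e2 : ∀ u, (Ioi 0).indicator (fun u => ∫⁻ v in Ioi 0, Φ q u v) u =
              (Ioc q.1 q.2.1).indicator (fun u => (Ioi 0).indicator (nmono i) q.1 *
                nmono j (u - q.1)) u * nmono (k + 1) q.2.2 := by
            intro u
            by_cases hu : 0 < u
            · rw [Set.indicator_of_mem (show u ∈ Ioi 0 from hu), e1]
            · rw [Set.indicator_of_notMem (show u ∉ Ioi 0 from hu)]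
              by_cases h3 : q.1 < u
              · have : ¬ 0 < q.1 := fun h => hu (h.trans h3)
                simp [Set.indicator, this]
              · simp [Set.indicator, h3]
          rw [← lintegral_indicator measurableSet_Ioi, lintegral_congr e2,
            lintegral_mul_const' _ _ (nmono_ne_top _ _), lintegral_indicator measurableSet_Ioc,
            lintegral_const_mul _ (by fun_prop), lintegral_nmono_sub_Ioc hq.1]
      _ = ∫⁻ u in Ioi 0, ∫⁻ q, ∫⁻ v in Ioi 0, Φ q u v ∂volume ∂(P.map Y) :=
          lintegral_lintegral_swap (Measurable.lintegral_prod_right' hΦ).aemeasurable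
      _ = ∫⁻ u in Ioi 0, ∫⁻ v in Ioi 0, ∫⁻ q, Φ q u v ∂(P.map Y) := by
          refine lintegral_congr fun u => lintegral_lintegral_swap ?_
          exact (hΦ.comp (by fun_prop : Measurable fun s : (ℝ × ℝ × ℝ) × ℝ =>
            ((s.1, u), s.2))).aemeasurable
      _ = _ := by
          refine lintegral_congr fun u => lintegral_congr fun v => ?_
          rw [lintegral_map' _ hYm]
          · refine lintegral_congr fun ω => ?_
            simp only [Φ, Set.indicator, mem_ofPred_eq, hY, le_neg]
            congr
          · exact (hΦ.comp (by fun_prop : Measurable fun q : ℝ × ℝ × ℝ =>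
              ((q, u), v))).aemeasurable
  -- The shear `p = u - x` opens the region `0 < x < u` into the quadrant, where the kernel has
  -- positive coefficients.
  have hker : ∀ K : ℝ → ℝ → ℝ → ℝ≥0∞, Measurable (fun q : ℝ × ℝ × ℝ => K q.1 q.2.1 q.2.2) →
      ∫⁻ u in Ioi 0, ∫⁻ v in Ioi 0, ∫⁻ x in Ioo 0 u, f u v x * K x (u - x) v =
      ∫⁻ x in Ioi 0, ∫⁻ p in Ioi 0, ∫⁻ v in Ioi 0,
        nmono i x * nmono j p * nmono k v * K x p v := by
    intro K hK
    have hK3 : ∀ g : ℝ × ℝ → ℝ × ℝ × ℝ, Measurable g →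
        Measurable fun q => K (g q).1 (g q).2.1 (g q).2.2 := fun g hg => hK.comp hg
    rw [← lintegral_shear (k := fun x p => ∫⁻ v in Ioi 0,
      nmono i x * nmono j p * nmono k v * K x p v)]
    · refine lintegral_congr fun u => ?_
      refine lintegral_lintegral_swap (Measurable.aemeasurable ?_)
      have := hK3 (fun q => (q.2, u - q.2, q.1)) (by fun_prop)
      simp only [Function.uncurry_def, f]
      exact Measurable.mul (by fun_prop) this
    · have h3 : Measurable fun s : (ℝ × ℝ) × ℝ => K s.1.1 s.1.2 s.2 :=
        hK.comp (by fun_prop : Measurable fun s : (ℝ × ℝ) × ℝ => (s.1.1, s.1.2, s.2))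
      exact Measurable.lintegral_prod_right' (f := fun s : (ℝ × ℝ) × ℝ =>
        nmono i s.1.1 * nmono j s.1.2 * nmono k s.2 * K s.1.1 s.1.2 s.2)
        (Measurable.mul (by fun_prop) h3)
  have hnegm : Measurable fun s : (ℝ × ℝ) × ℝ =>
      (Ioo 0 s.1.1).indicator (fun x => f s.1.1 s.1.2 x * negKernel x (s.1.1 - x) s.1.2) s.2 := by
    have h1 : (fun s : (ℝ × ℝ) × ℝ =>
        (Ioo 0 s.1.1).indicator (fun x => f s.1.1 s.1.2 x * negKernel x (s.1.1 - x) s.1.2) s.2) =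
        {s : (ℝ × ℝ) × ℝ | 0 < s.2 ∧ s.2 < s.1.1}.indicator (fun s =>
          f s.1.1 s.1.2 s.2 * negKernel s.2 (s.1.1 - s.2) s.1.2) := by
      ext s
      by_cases hs : s.2 ∈ Ioo 0 s.1.1
      · rw [Set.indicator_of_mem hs, Set.indicator_of_mem (show s ∈ {s : (ℝ × ℝ) × ℝ |
          0 < s.2 ∧ s.2 < s.1.1} from hs)]
      · rw [Set.indicator_of_notMem hs, Set.indicator_of_notMem (show s ∉ {s : (ℝ × ℝ) × ℝ |
          0 < s.2 ∧ s.2 < s.1.1} from hs)]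
    have h2 : Measurable fun s : (ℝ × ℝ) × ℝ => f s.1.1 s.1.2 s.2 := by simp only [f]; fun_prop
    have h3 : Measurable fun s : (ℝ × ℝ) × ℝ => negKernel s.2 (s.1.1 - s.2) s.1.2 :=
      measurable_negKernel_comp (by fun_prop) (by fun_prop) (by fun_prop)
    have m1 : Measurable fun s : (ℝ × ℝ) × ℝ => s.1.1 := by fun_prop
    rw [h1]
    exact (h2.mul h3).indicator ((measurableSet_lt measurable_const measurable_snd).inter
      (measurableSet_lt measurable_snd m1))
  rw [hmain, ← lintegral_posKernel_moment, ← lintegral_negKernel_moment,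
    ← hker posKernel measurable_posKernel, ← hker negKernel measurable_negKernel]
  have hnegm2 : Measurable fun s : ℝ × ℝ =>
      ∫⁻ x in Ioo 0 s.1, f s.1 s.2 x * negKernel x (s.1 - x) s.2 := by
    have := Measurable.lintegral_prod_right' (ν := volume) hnegm
    simpa only [lintegral_indicator measurableSet_Ioo] using this
  rw [← lintegral_add_right _ (Measurable.lintegral_prod_right' hnegm2)]
  refine lintegral_congr_ae ?_
  filter_upwards [ae_restrict_of_ae (ae_highSpread_ne hB),
          ae_restrict_mem measurableSet_Ioi] with u hu hu0
  have hnegm3 : Measurable fun v : ℝ => ∫⁻ x in Ioo 0 u, f u v x * negKernel x (u - x) v :=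
    hnegm2.comp (by fun_prop : Measurable fun v : ℝ => (u, v))
  rw [← lintegral_add_right _ hnegm3]
  refine lintegral_congr_ae ?_
  filter_upwards [ae_restrict_of_ae (ae_lowSpread_ne hB),
          ae_restrict_mem measurableSet_Ioi] with v hv hv0
  exact lintegral_both hB hu0 hv0 hu hv (by simp only [f]; fun_prop)

end

/-! ### The moment series: factorised terms, tail bounds and the value in degree two -/

section

/-- The `n`-th correction in the series for the mixed moments. -/
def mixedTerm (i j k n : ℕ) : ℝ :=
  ((2 * n + 3 : ℝ) ^ (i + 1))⁻¹ * (((2 * n + 2 : ℝ)⁻¹ ^ j - (2 * n + 4 : ℝ)⁻¹ ^ j) *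
    ((2 * n + 2 : ℝ)⁻¹ ^ k - (2 * n + 4 : ℝ)⁻¹ ^ k))

lemma inv_pow_sub_nonneg (n j : ℕ) : 0 ≤ (2 * n + 2 : ℝ)⁻¹ ^ j - (2 * n + 4 : ℝ)⁻¹ ^ j :=
  sub_nonneg.2 (pow_le_pow_left₀ (by positivity) (inv_anti₀ (by positivity) (by linarith)) _)

/-- The reciprocals `u, v` of `2n + 2` and `2n + 4` satisfy `u - v = 2 u v ≤ 2 u ^ 2`; induction on
the exponent propagates this, gaining one order of decay. -/
lemma inv_pow_sub_le (n j : ℕ) :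
    (2 * n + 2 : ℝ)⁻¹ ^ j - (2 * n + 4 : ℝ)⁻¹ ^ j ≤ 2 * j * (2 * n + 2 : ℝ)⁻¹ ^ (j + 1) := by
  set u := (2 * n + 2 : ℝ)⁻¹ with hu
  set v := (2 * n + 4 : ℝ)⁻¹ with hv
  have huv : u - v = 2 * u * v := by rw [hu, hv]; field_simp; ring
  have hv0 : 0 < v := by rw [hv]; positivity
  have hu0 : 0 < u := by rw [hu]; positivity
  have hle : v ≤ u := by rw [hu, hv]; exact inv_anti₀ (by positivity) (by linarith)
  induction j with
  | zero => simp
  | succ j ih =>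
    have h1 : u ^ (j + 1) - v ^ (j + 1) = u * (u ^ j - v ^ j) + v ^ j * (2 * u * v) := by
      rw [← huv]; ring
    have h2 : v ^ j * (2 * u * v) ≤ u ^ j * (2 * u * u) := by gcongr
    have h3 := mul_le_mul_of_nonneg_left ih hu0.le
    rw [h1]
    push_cast
    calc _ ≤ u * (2 * j * u ^ (j + 1)) + u ^ j * (2 * u * u) := add_le_add h3 h2
      _ = _ := by ring

lemma mixedTerm_nonneg (i j k n : ℕ) : 0 ≤ mixedTerm i j k n :=
  mul_nonneg (by positivity) (mul_nonneg (inv_pow_sub_nonneg _ _) (inv_pow_sub_nonneg _ _))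

lemma mixedTerm_le (i j k n : ℕ) :
    mixedTerm i j k n ≤ 4 * j * k * (2 * n + 2 : ℝ)⁻¹ ^ (i + j + k + 3) := by
  have h1 : ((2 * n + 3 : ℝ) ^ (i + 1))⁻¹ ≤ (2 * n + 2 : ℝ)⁻¹ ^ (i + 1) := by
    rw [← inv_pow]
    exact pow_le_pow_left₀ (by positivity) (inv_anti₀ (by positivity) (by linarith)) _
  calc mixedTerm i j k n ≤ (2 * n + 2 : ℝ)⁻¹ ^ (i + 1) *
        ((2 * j * (2 * n + 2 : ℝ)⁻¹ ^ (j + 1)) * (2 * k * (2 * n + 2 : ℝ)⁻¹ ^ (k + 1))) :=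
        mul_le_mul h1 (mul_le_mul (inv_pow_sub_le n j) (inv_pow_sub_le n k)
          (inv_pow_sub_nonneg _ _) (by positivity))
          (mul_nonneg (inv_pow_sub_nonneg _ _) (inv_pow_sub_nonneg _ _)) (by positivity)
    _ = _ := by ring

lemma negCoeff_nonneg (i j k n : ℕ) : 0 ≤ negCoeff i j k n := by unfold negCoeff; positivity

lemma posCoeff_nonneg (i j k n : ℕ) : 0 ≤ posCoeff i j k n := by unfold posCoeff; positivity

lemma summable_inv_sq : Summable fun n : ℕ => ((2 * n + 2 : ℝ) ^ 2)⁻¹ := by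
  have h := (summable_nat_add_iff 1).2 (Real.summable_nat_pow_inv.2 (by norm_num : 1 < 2))
  refine (h.mul_left (1 / 4)).congr fun n => ?_
  push_cast
  rw [show (2 * n + 2 : ℝ) ^ 2 = 4 * (n + 1) ^ 2 by ring, mul_inv]
  norm_num

lemma inv_mul_inv_le {x : ℝ} (hx : 1 ≤ x) (i j k n : ℕ) {y z : ℝ} (hy : 2 * (n : ℝ) + 2 ≤ y)
    (hz : 2 * (n : ℝ) + 2 ≤ z) :
    (x ^ (i + 1))⁻¹ * (y ^ (j + 1))⁻¹ * (z ^ (k + 1))⁻¹ ≤ ((2 * n + 2 : ℝ) ^ 2)⁻¹ := by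
  have hn : (1 : ℝ) ≤ 2 * n + 2 := by have := n.cast_nonneg (α := ℝ); linarith
  have h1 : (x ^ (i + 1))⁻¹ ≤ 1 := inv_le_one_of_one_le₀ (one_le_pow₀ hx)
  have h2 : ∀ {w : ℝ} (m : ℕ), 2 * (n : ℝ) + 2 ≤ w → (w ^ (m + 1))⁻¹ ≤ (2 * n + 2 : ℝ)⁻¹ := by
    intro w m hw
    refine inv_anti₀ (by positivity) (hw.trans ?_)
    exact le_self_pow₀ (hn.trans hw) (by omega)
  calc _ ≤ 1 * (2 * n + 2 : ℝ)⁻¹ * (2 * n + 2 : ℝ)⁻¹ := by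
        refine mul_le_mul (mul_le_mul h1 (h2 j hy) ?_ zero_le_one) (h2 k hz) ?_ (by positivity)
        · have : 0 ≤ y := by linarith
          positivity
        · have : 0 ≤ z := by linarith
          positivity
    _ = _ := by rw [one_mul, ← mul_inv, sq]

lemma summable_posCoeff (i j k : ℕ) : Summable (posCoeff i (j + 1) (k + 1)) := by
  refine Summable.of_nonneg_of_le (posCoeff_nonneg _ _ _) (fun n => ?_) (summable_inv_sq.mul_left 2)
  have hn := n.cast_nonneg (α := ℝ)
  have h1 := inv_mul_inv_le (x := 2 * n + 3) (by linarith) i j k n le_rfl le_rfl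
  have h2 := inv_mul_inv_le (x := 2 * n + 1) (by linarith) i j k n le_rfl le_rfl
  unfold posCoeff; linarith

lemma summable_negCoeff (i j k : ℕ) : Summable (negCoeff i (j + 1) (k + 1)) := by
  refine Summable.of_nonneg_of_le (negCoeff_nonneg _ _ _) (fun n => ?_) (summable_inv_sq.mul_left 2)
  have hn := n.cast_nonneg (α := ℝ)
  have h1 := inv_mul_inv_le (x := 2 * n + 3) (by linarith) i j k n
    (by linarith : 2 * (n : ℝ) + 2 ≤ 2 * n + 4) le_rfl
  have h2 := inv_mul_inv_le (x := 2 * n + 3) (by linarith) i j k n le_rfl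
    (by linarith : 2 * (n : ℝ) + 2 ≤ 2 * n + 4)
  unfold negCoeff; linarith

/-- The series in the mixed moments of `(c, h - c, -l)`. -/
def mixedSum (i j k : ℕ) : ℝ := (2 ^ (j + k))⁻¹ + ∑' n, mixedTerm i j k n

/-- Split off the first summand of the `2n + 1` series and shift the rest, so that all denominators
become `2n + 3`. The four products at index `n` then factor as a difference of `j`-th powers times a
difference of `k`-th powers; the split summand is the leading `2 ^ -(j + k)`. This pairing produces
the fast convergence. -/
lemma hasSum_posCoeff_sub (i j k : ℕ) :
    (∑' n, posCoeff i (j + 1) (k + 1) n) - ∑' n, negCoeff i (j + 1) (k + 1) n =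
      mixedSum i (j + 1) (k + 1) := by
  let C : ℕ → ℝ := fun n => ((2 * n + 3 : ℝ) ^ (i + 1))⁻¹ * ((2 * n + 2 : ℝ) ^ (j + 1))⁻¹ *
    ((2 * n + 2 : ℝ) ^ (k + 1))⁻¹
  let D : ℕ → ℝ := fun n => ((2 * n + 1 : ℝ) ^ (i + 1))⁻¹ * ((2 * n + 2 : ℝ) ^ (j + 1))⁻¹ *
    ((2 * n + 2 : ℝ) ^ (k + 1))⁻¹
  have hC : Summable C := Summable.of_nonneg_of_le (fun n => by positivity)
    (fun n => inv_mul_inv_le (by have := n.cast_nonneg (α := ℝ); linarith) i j k n le_rfl le_rfl)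
    summable_inv_sq
  have hD : Summable D := Summable.of_nonneg_of_le (fun n => by positivity)
    (fun n => inv_mul_inv_le (by have := n.cast_nonneg (α := ℝ); linarith) i j k n le_rfl le_rfl)
    summable_inv_sq
  have hN := summable_negCoeff i j k
  have hD1 : Summable fun n => D (n + 1) := (summable_nat_add_iff 1).2 hD
  have h1 : ∑' n, posCoeff i (j + 1) (k + 1) n = ∑' n, C n + ∑' n, D n := hC.tsum_add hD
  rw [h1, hD.tsum_eq_zero_add, mixedSum, add_left_comm, add_sub_assoc, ← hC.tsum_add hD1,
    ← (hC.add hD1).tsum_sub hN]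
  congr 1
  · simp only [D]; norm_num; rw [← mul_inv, ← pow_add]
  · refine tsum_congr fun n => ?_
    simp only [C, D, negCoeff, mixedTerm, inv_pow]
    push_cast
    rw [show 2 * ((n : ℝ) + 1) + 1 = 2 * n + 3 by ring, show 2 * ((n : ℝ) + 1) + 2 = 2 * n + 4 by ring]
    ring

lemma mixedSum_comm (i j k : ℕ) : mixedSum i j k = mixedSum i k j := by
  unfold mixedSum mixedTerm
  rw [add_comm j k]
  congr 1
  exact tsum_congr fun n => by ring

lemma mixedSum_nonneg (i j k : ℕ) : 0 ≤ mixedSum i j k :=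
  add_nonneg (by positivity) (tsum_nonneg fun n => mixedTerm_nonneg _ _ _ _)

lemma summable_mixedTerm (i j k : ℕ) : Summable (mixedTerm i j k) := by
  refine Summable.of_nonneg_of_le (mixedTerm_nonneg _ _ _) (fun n => (mixedTerm_le i j k n).trans ?_)
    (summable_inv_sq.mul_left (4 * (j : ℝ) * k))
  refine mul_le_mul_of_nonneg_left ?_ (by positivity)
  rw [← inv_pow]
  refine pow_le_pow_of_le_one (by positivity) (inv_le_one_of_one_le₀ ?_) (by omega)
  have := n.cast_nonneg (α := ℝ); linarith

/-- Enclosure of the series by partial sums. -/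
lemma mixedSum_bounds {i j k : ℕ} (hd : i + j + k = 4) {N : ℕ} (hN : 0 < N) :
    (2 ^ (j + k) : ℝ)⁻¹ + ∑ n ∈ Finset.range N, mixedTerm i j k n ≤ mixedSum i j k ∧
    mixedSum i j k ≤ (2 ^ (j + k) : ℝ)⁻¹ + ∑ n ∈ Finset.range N, mixedTerm i j k n +
      j * k / (32 * N ^ 6) := by
  have hs := summable_mixedTerm i j k
  refine ⟨add_le_add_right (hs.sum_le_tsum _ fun n _ => mixedTerm_nonneg _ _ _ _) _, ?_⟩
  rw [mixedSum, ← hs.sum_add_tsum_nat_add N, ← add_assoc]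
  refine add_le_add_right ?_ _
  have hN0 : (0 : ℝ) < N := by exact_mod_cast hN
  -- In total degree four a term at index `m` is at most `j k / (32 (m + 1) ^ 7)`. Five of the seven
  -- factors are bounded below by `N`, and the other two telescope.
  have hterm : ∀ n : ℕ, mixedTerm i j k (n + N) ≤
      j * k / (32 * N ^ 5) * (1 / ((n : ℝ) + N) - 1 / (((n + 1 : ℕ) : ℝ) + N)) := by
    intro n
    refine (mixedTerm_le i j k (n + N)).trans ?_
    rw [hd]
    have hn := n.cast_nonneg (α := ℝ)
    have e1 : (2 * ((n + N : ℕ) : ℝ) + 2)⁻¹ ^ (4 + 3) = 1 / (128 * ((n : ℝ) + N + 1) ^ 7) := by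
      push_cast
      rw [inv_pow, one_div]; congr 1; ring
    have e2 : 1 / ((n : ℝ) + N) - 1 / (((n + 1 : ℕ) : ℝ) + N) =
        1 / (((n : ℝ) + N) * ((n : ℝ) + N + 1)) := by
      push_cast
      field_simp
      ring
    rw [e1, e2]
    have e3 : 1 / ((n : ℝ) + N + 1) ^ 7 ≤ 1 / (N ^ 5 * (((n : ℝ) + N) * ((n : ℝ) + N + 1))) := by
      refine one_div_le_one_div_of_le (by positivity) ?_
      calc (N : ℝ) ^ 5 * (((n : ℝ) + N) * ((n : ℝ) + N + 1))
          ≤ ((n : ℝ) + N + 1) ^ 5 * (((n : ℝ) + N + 1) * ((n : ℝ) + N + 1)) := by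
            refine mul_le_mul (pow_le_pow_left₀ hN0.le (by linarith) _)
              (mul_le_mul_of_nonneg_right (by linarith) (by positivity)) (by positivity)
              (by positivity)
        _ = _ := by ring
    calc 4 * (j : ℝ) * k * (1 / (128 * ((n : ℝ) + N + 1) ^ 7))
        = (j * k / 32) * (1 / ((n : ℝ) + N + 1) ^ 7) := by field_simp; ring
      _ ≤ (j * k / 32) * (1 / (N ^ 5 * (((n : ℝ) + N) * ((n : ℝ) + N + 1)))) := by gcongr
      _ = _ := by field_simp
  refine Real.tsum_le_of_sum_range_le (fun n => mixedTerm_nonneg _ _ _ _) fun M => ?_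
  calc ∑ n ∈ Finset.range M, mixedTerm i j k (n + N)
      ≤ ∑ n ∈ Finset.range M, j * k / (32 * (N : ℝ) ^ 5) *
        (1 / ((n : ℝ) + N) - 1 / (((n + 1 : ℕ) : ℝ) + N)) := Finset.sum_le_sum fun n _ => hterm n
    _ = j * k / (32 * (N : ℝ) ^ 5) * (1 / N - 1 / (M + N)) := by
        rw [← Finset.mul_sum, Finset.sum_range_sub' (fun n : ℕ => 1 / ((n : ℝ) + N))]
        simp
    _ ≤ j * k / (32 * (N : ℝ) ^ 5) * (1 / N) := by
        refine mul_le_mul_of_nonneg_left ?_ (by positivity)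
        have : (0 : ℝ) ≤ 1 / (M + N) := by positivity
        linarith
    _ = _ := by field_simp

variable {Ω : Type*} [MeasurableSpace Ω] {P : Measure Ω} {B : ℝ≥0 → Ω → ℝ}

/-- The normalised moment factor of `c ^ i (h - c) ^ j (-l) ^ k` on `c > 0`. -/
def momentFactor (i j k : ℕ) : ℝ :=
  if j = 0 ∨ k = 0 then (2 ^ (j + k))⁻¹ else mixedSum i j k

lemma momentFactor_nonneg (i j k : ℕ) : 0 ≤ momentFactor i j k := by
  unfold momentFactor; split_ifs
  · positivity
  · exact mixedSum_nonneg _ _ _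

/-- The series is needed only when both extremes occur. There the negative series stands on the
left-hand side and is cancelled, which uses that the half-line moment is finite. -/
theorem lintegral_moment (hB : IsBrownianReal B P) {i j k : ℕ} (hfin : halfMoment (i + j + k) ≠ ⊤) :
    ∫⁻ ω, (Ioi 0).indicator (nmono i) (B 1 ω) *
      nmono j ((highSpread fun t => B t ω) - B 1 ω) *
      nmono k (-(lowSpread fun t => B t ω)) ∂P =
      ENNReal.ofReal (momentFactor i j k) * halfMoment (i + j + k) := by
  rcases j with _ | j
  · rcases k with _ | k
    · have hg : Measurable (gaussianPDF 0 1) := measurable_gaussianPDF 0 1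
      have hm : Measurable ((Ioi (0 : ℝ)).indicator (nmono i)) :=
        (measurable_nmono i).indicator measurableSet_Ioi
      simp only [nmono_zero, mul_one, add_zero, momentFactor, true_or, if_true, pow_zero, inv_one,
        ENNReal.ofReal_one, one_mul]
      rw [← lintegral_map' hm.aemeasurable (hB.aemeasurable 1),
        map_eval_one hB.toIsPreBrownianReal, lintegral_withDensity_eq_lintegral_mul _ hg hm,
        halfMoment, ← lintegral_indicator measurableSet_Ioi]
      refine lintegral_congr fun x => ?_
      by_cases hx : x ∈ Ioi (0 : ℝ)
      · simp [Set.indicator_of_mem hx, mul_comm]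
      · simp [Set.indicator_of_notMem hx]
    · simp only [nmono_zero, mul_one, add_zero, zero_add, momentFactor, true_or, if_true]
      exact lintegral_close_low hB i k
  · rcases k with _ | k
    · simp only [nmono_zero, mul_one, add_zero, momentFactor, or_true, if_true]
      exact lintegral_close_high hB i j
    · have h := lintegral_close_high_low hB i j k
      have e : i + j + k + 2 = i + (j + 1) + (k + 1) := by ring
      rw [e] at h
      set S := halfMoment (i + (j + 1) + (k + 1)) with hS
      rw [← ENNReal.ofReal_tsum_of_nonneg (negCoeff_nonneg _ _ _) (summable_negCoeff i j k),
        ← ENNReal.ofReal_tsum_of_nonneg (posCoeff_nonneg _ _ _) (summable_posCoeff i j k)] at h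
      have hN : ENNReal.ofReal (∑' n, negCoeff i (j + 1) (k + 1) n) * S ≠ ⊤ :=
        ENNReal.mul_ne_top ENNReal.ofReal_ne_top hfin
      have hpos : ∑' n, posCoeff i (j + 1) (k + 1) n =
          mixedSum i (j + 1) (k + 1) + ∑' n, negCoeff i (j + 1) (k + 1) n := by
        have := hasSum_posCoeff_sub i j k; linarith
      rw [hpos, ENNReal.ofReal_add (mixedSum_nonneg _ _ _)
        (tsum_nonneg fun n => negCoeff_nonneg _ _ _ _), add_mul, ENNReal.add_left_inj hN] at h
      rw [h]
      simp [momentFactor]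

/-- `log 2` as the sum of a degree two mixed moment series. -/
lemma mixedSum_zero_one_one : mixedSum 0 1 1 = 2 * (2 * Real.log 2 - 5 / 4) := by
  -- Partial fractions of the terms give harmonic numbers at `2 (N + 1)` and `N + 1`, plus a
  -- rational remainder tending to `0`.
  have hpart : ∀ N : ℕ, ∑ n ∈ Finset.range N, mixedTerm 0 1 1 n =
      4 * (((harmonic (2 * (N + 1)) : ℚ) : ℝ) - ((harmonic (N + 1) : ℚ) : ℝ)) - 11 / 4 +
        (((N : ℝ) + 1)⁻¹ - ((N : ℝ) + 1)⁻¹ ^ 2 / 4) := by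
    intro N
    induction N with
    | zero => norm_num [harmonic, Finset.sum_range_succ]
    | succ N ih =>
      rw [Finset.sum_range_succ, ih, show 2 * (N + 1 + 1) = 2 * (N + 1) + 1 + 1 by ring,
        harmonic_succ (2 * (N + 1) + 1), harmonic_succ (2 * (N + 1)), harmonic_succ (N + 1)]
      simp only [mixedTerm]
      push_cast
      have h1 : (N : ℝ) + 1 ≠ 0 := by positivity
      have h2 : (N : ℝ) + 1 + 1 ≠ 0 := by positivity
      have h3 : 2 * (N : ℝ) + 3 ≠ 0 := by positivity
      rw [show 2 * ((N : ℝ) + 1) + 1 = 2 * N + 3 by ring,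
        show 2 * (N : ℝ) + 3 + 1 = 2 * (N + 1 + 1) by ring,
        show 2 * (N : ℝ) + 2 = 2 * (N + 1) by ring,
        show 2 * (N : ℝ) + 4 = 2 * (N + 1 + 1) by ring]
      field_simp
      ring
  -- Both harmonic numbers differ from a logarithm by terms tending to the Euler constant, which
  -- cancels and leaves `log 2`.
  have hlog : Tendsto (fun N : ℕ => ((harmonic (2 * (N + 1)) : ℚ) : ℝ) -
      ((harmonic (N + 1) : ℚ) : ℝ)) atTop (𝓝 (Real.log 2)) := by
    have hg := Real.tendsto_harmonic_sub_log
    have h1 : Tendsto (fun N : ℕ => N + 1) atTop atTop := tendsto_add_atTop_nat 1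
    have h2 : Tendsto (fun N : ℕ => 2 * (N + 1)) atTop atTop :=
      tendsto_atTop_mono (fun N => by omega) h1
    have h := ((hg.comp h2).sub (hg.comp h1)).add_const (Real.log 2)
    rw [sub_self, zero_add] at h
    refine h.congr fun N => ?_
    simp only [Function.comp]
    have : Real.log ((2 * (N + 1) : ℕ) : ℝ) = Real.log 2 + Real.log ((N + 1 : ℕ) : ℝ) := by
      push_cast
      rw [Real.log_mul (by norm_num) (by positivity)]
    rw [this]; ring
  have hinv : Tendsto (fun N : ℕ => ((N : ℝ) + 1)⁻¹) atTop (𝓝 0) := by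
    simpa [one_div] using tendsto_one_div_add_atTop_nhds_zero_nat (𝕜 := ℝ)
  have hlim := ((hlog.const_mul 4).sub_const (11 / 4)).add
    (hinv.sub ((hinv.pow 2).div_const 4))
  have hs := (summable_mixedTerm 0 1 1).hasSum.tendsto_sum_nat
  have := tendsto_nhds_unique hs (hlim.congr fun N => by rw [hpart N])
  rw [mixedSum, this]
  norm_num
  ring

end

/-! ### Brownian scaling and the sign flip -/

section

lemma highSpread_of_scaled {x y : ℝ≥0 → ℝ} (hy : Continuous y) {a : ℝ} (ha : 0 < a)
    (h : ∀ t, x t - x 0 = a * (y t - y 0)) : highSpread x = a * highSpread y := by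
  have hx : Continuous x := by
    have : x = fun t => a * (y t - y 0) + x 0 := funext fun t => by rw [← h]; ring
    rw [this]; fun_prop
  apply le_antisymm
  · obtain ⟨t, ht, e⟩ := exists_eq_highSpread hx
    rw [← e, h]
    exact mul_le_mul_of_nonneg_left (le_highSpread hy ht) ha.le
  · obtain ⟨t, ht, e⟩ := exists_eq_highSpread hy
    rw [← e, ← h]
    exact le_highSpread hx ht

lemma lowSpread_of_scaled {x y : ℝ≥0 → ℝ} (hy : Continuous y) {a : ℝ} (ha : 0 < a)
    (h : ∀ t, x t - x 0 = a * (y t - y 0)) : lowSpread x = a * lowSpread y := by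
  have := highSpread_of_scaled (x := -x) (y := -y) hy.neg ha fun t => by
    simp only [Pi.neg_apply]; linarith [h t]
  rw [highSpread_neg, highSpread_neg] at this
  linarith

/-- The monomial `C ^ i (H - C) ^ j (-L) ^ k`. -/
def flipMonomial (i j k : ℕ) (x : ℝ≥0 → ℝ) : ℝ :=
  flipClose x ^ i * (flipHigh x - flipClose x) ^ j * (-flipLow x) ^ k

/-- Replacing `x` by `-x` exchanges the two branches in the flipped statistics. At `c = 0` both
paths fall in the same branch, so this case must be excluded. -/
lemma flipMonomial_neg (i j k : ℕ) {x : ℝ≥0 → ℝ} (hx : closeSpread x ≠ 0) :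
    flipMonomial i j k (-x) = flipMonomial i j k x := by
  have e1 : flipClose (-x) = flipClose x := by simp [flipClose, closeSpread_neg]
  have e2 : flipHigh (-x) = flipHigh x := by
    simp only [flipHigh, closeSpread_neg, highSpread_neg, lowSpread_neg]
    rcases hx.lt_or_gt with h | h
    · rw [if_pos (by linarith), if_neg (by linarith)]
    · rw [if_neg (by linarith), if_pos (by linarith), neg_neg]
  have e3 : flipLow (-x) = flipLow x := by
    simp only [flipLow, closeSpread_neg, highSpread_neg, lowSpread_neg]
    rcases hx.lt_or_gt with h | h
    · rw [if_pos (by linarith), if_neg (by linarith)]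
    · rw [if_neg (by linarith), if_pos (by linarith), neg_neg]
  rw [flipMonomial, flipMonomial, e1, e2, e3]

/-- `E[c ^ i (h - c) ^ j (-l) ^ k; c > 0]` for standard Brownian motion, when `i + j + k` is
`2` or `4`. -/
def halfMean (i j k : ℕ) : ℝ :=
  i.factorial * j.factorial * k.factorial * momentFactor i j k *
    if i + j + k = 2 then 1 / 4 else 1 / 16

lemma halfMoment_eq_ofReal {d : ℕ} (hd : d = 2 ∨ d = 4) :
    halfMoment d = ENNReal.ofReal (if d = 2 then 1 / 4 else 1 / 16) := by
  rcases hd with rfl | rfl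
  · rw [halfMoment_two, if_pos rfl]
  · rw [halfMoment_four, if_neg (by norm_num)]

variable {Ω : Type*} [MeasurableSpace Ω] {P : Measure Ω} {B X : ℝ≥0 → Ω → ℝ} {σ : ℝ}

lemma ae_eval_one_ne_zero (hB : IsPreBrownianReal B P) : ∀ᵐ ω ∂P, B 1 ω ≠ 0 := by
  have h : ∀ᵐ y ∂(P.map (B 1)), y ≠ 0 := by
    rw [map_eval_one hB]
    exact (withDensity_absolutelyContinuous _ _).ae_le (Measure.ae_ne volume 0)
  exact ae_of_ae_map (hB.aemeasurable 1) h

theorem integral_halfMonomial (hB : IsBrownianReal B P) {i j k : ℕ}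
    (hd : i + j + k = 2 ∨ i + j + k = 4) :
    Integrable (fun ω => (Ioi 0).indicator (· ^ i) (B 1 ω) *
      ((highSpread fun t => B t ω) - B 1 ω) ^ j * (-(lowSpread fun t => B t ω)) ^ k) P ∧
    ∫ ω, (Ioi 0).indicator (· ^ i) (B 1 ω) *
      ((highSpread fun t => B t ω) - B 1 ω) ^ j * (-(lowSpread fun t => B t ω)) ^ k ∂P =
      halfMean i j k := by
  set F : Ω → ℝ := fun ω => (Ioi 0).indicator (· ^ i) (B 1 ω) *
      ((highSpread fun t => B t ω) - B 1 ω) ^ j * (-(lowSpread fun t => B t ω)) ^ k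
  have hm : AEMeasurable F P := by
    have h1 : Measurable ((Ioi (0 : ℝ)).indicator (· ^ i)) :=
      (measurable_id.pow_const i).indicator measurableSet_Ioi
    exact ((h1.comp_aemeasurable (hB.aemeasurable 1)).mul
      (((aemeasurable_highSpread hB).sub (hB.aemeasurable 1)).pow_const j)).mul
      ((aemeasurable_lowSpread hB).neg.pow_const k)
  have hae : ∀ᵐ ω ∂P, 0 ≤ (Ioi (0 : ℝ)).indicator (· ^ i) (B 1 ω) ∧
      0 ≤ (highSpread fun t => B t ω) - B 1 ω ∧ 0 ≤ -(lowSpread fun t => B t ω) := by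
    filter_upwards [hB.cont, hB.eval_zero_ae_eq_zero] with ω hω h0
    refine ⟨Set.indicator_nonneg (fun y (hy : 0 < y) => pow_nonneg hy.le _) _, ?_, ?_⟩
    · have := closeSpread_le_highSpread hω
      simp only [closeSpread, h0, sub_zero] at this
      linarith
    · linarith [lowSpread_nonpos hω]
  have hnn : 0 ≤ᵐ[P] F := by
    filter_upwards [hae] with ω ⟨h1, h2, h3⟩
    exact mul_nonneg (mul_nonneg h1 (pow_nonneg h2 _)) (pow_nonneg h3 _)
  -- The product of factorials undoes the normalisation of the monomials.
  have hlint : ∫⁻ ω, ENNReal.ofReal (F ω) ∂P = ENNReal.ofReal (halfMean i j k) := by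
    have hfin : halfMoment (i + j + k) ≠ ⊤ := by
      rw [halfMoment_eq_ofReal hd]; exact ENNReal.ofReal_ne_top
    set N : ℝ := i.factorial * j.factorial * k.factorial
    have hN : 0 ≤ N := by positivity
    have : ∀ᵐ ω ∂P, ENNReal.ofReal (F ω) = ENNReal.ofReal N *
        ((Ioi 0).indicator (nmono i) (B 1 ω) * nmono j ((highSpread fun t => B t ω) - B 1 ω) *
          nmono k (-(lowSpread fun t => B t ω))) := by
      filter_upwards [hae] with ω ⟨h1, h2, h3⟩
      simp only [F]
      by_cases h : B 1 ω ∈ Ioi (0 : ℝ)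
      · have h' : 0 < B 1 ω := h
        rw [indicator_of_mem h, indicator_of_mem h, nmono, nmono, nmono,
          ← ENNReal.ofReal_mul (by positivity), ← ENNReal.ofReal_mul (by positivity),
          ← ENNReal.ofReal_mul hN]
        congr 1
        simp only [N]
        field_simp
      · rw [indicator_of_notMem h, indicator_of_notMem h]
        simp
    rw [lintegral_congr_ae this, lintegral_const_mul' _ _ ENNReal.ofReal_ne_top,
      lintegral_moment hB hfin, halfMoment_eq_ofReal hd,
      ← ENNReal.ofReal_mul (momentFactor_nonneg _ _ _), ← ENNReal.ofReal_mul hN, halfMean]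
    congr 1
    simp only [N]; ring
  have h0 : 0 ≤ halfMean i j k := by
    have := momentFactor_nonneg i j k
    unfold halfMean; positivity
  constructor
  · rw [← lintegral_ofReal_ne_top_iff_integrable hm.aestronglyMeasurable hnn, hlint]
    exact ENNReal.ofReal_ne_top
  · rw [integral_eq_lintegral_of_nonneg_ae hnn hm.aestronglyMeasurable, hlint,
      ENNReal.toReal_ofReal h0]

lemma IsZeroDriftBM.neg (hX : IsZeroDriftBM X σ P) : IsZeroDriftBM (-X) σ P where
  sigma_pos := hX.sigma_pos
  isBrownian := by
    have := hX.isBrownian.neg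
    convert this using 3
    simp only [Pi.neg_apply]; ring

lemma IsZeroDriftBM.isProbabilityMeasure (hX : IsZeroDriftBM X σ P) : IsProbabilityMeasure P :=
  hX.isBrownian.isGaussianProcess.isProbabilityMeasure

lemma IsZeroDriftBM.ae_closeSpread_ne_zero (hX : IsZeroDriftBM X σ P) :
    ∀ᵐ ω ∂P, closeSpread (fun t => X t ω) ≠ 0 := by
  filter_upwards [ae_eval_one_ne_zero hX.isBrownian.toIsPreBrownianReal] with ω h h0
  exact h (by simp only [closeSpread] at h0; simp [h0])

theorem integral_flipMonomial_pos (hX : IsZeroDriftBM X σ P) {i j k : ℕ}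
    (hd : i + j + k = 2 ∨ i + j + k = 4) :
    Integrable (fun ω => if 0 < closeSpread (fun t => X t ω) then
      flipMonomial i j k (fun t => X t ω) else 0) P ∧
    ∫ ω, (if 0 < closeSpread (fun t => X t ω) then
      flipMonomial i j k (fun t => X t ω) else 0) ∂P = σ ^ (i + j + k) * halfMean i j k := by
  have hs := hX.sigma_pos
  have hB := hX.isBrownian
  set B : ℝ≥0 → Ω → ℝ := fun t ω => (X t ω - X 0 ω) / σ
  obtain ⟨h1, h2⟩ := integral_halfMonomial hB hd
  have hae : (fun ω => σ ^ (i + j + k) * ((Ioi 0).indicator (· ^ i) (B 1 ω) *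
      ((highSpread fun t => B t ω) - B 1 ω) ^ j * (-(lowSpread fun t => B t ω)) ^ k)) =ᵐ[P]
      fun ω => if 0 < closeSpread (fun t => X t ω) then
        flipMonomial i j k (fun t => X t ω) else 0 := by
    filter_upwards [hB.cont] with ω hω
    have hsc : ∀ t, X t ω - X 0 ω = σ * (B t ω - B 0 ω) := fun t => by
      simp only [B]; field_simp; ring
    have hc : closeSpread (fun t => X t ω) = σ * B 1 ω := by
      simp only [closeSpread, B]; field_simp
    have hh := highSpread_of_scaled (x := fun t => X t ω) hω hs hsc
    have hl := lowSpread_of_scaled (x := fun t => X t ω) hω hs hsc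
    by_cases h : 0 < B 1 ω
    · have hp : 0 < closeSpread (fun t => X t ω) := by rw [hc]; positivity
      rw [if_pos hp, indicator_of_mem (show B 1 ω ∈ Ioi (0 : ℝ) from h), flipMonomial, flipHigh,
        flipLow, flipClose, if_pos hp, if_pos hp, abs_of_pos hp, hc, hh, hl]
      rw [← mul_sub, ← mul_neg, mul_pow, mul_pow, mul_pow]
      ring
    · have hp : ¬ 0 < closeSpread (fun t => X t ω) := by
        rw [hc]; exact fun h' => h (pos_of_mul_pos_right h' hs.le)
      rw [if_neg hp, indicator_of_notMem (show B 1 ω ∉ Ioi (0 : ℝ) from h)]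
      ring
  refine ⟨(h1.const_mul _).congr hae, ?_⟩
  rw [← integral_congr_ae hae, integral_const_mul, h2]

/-- Apply the positive case to `-X`: flipped monomials do not change and the close is almost surely
nonzero, so the two halves have equal moments. -/
theorem integral_flipMonomial_neg (hX : IsZeroDriftBM X σ P) {i j k : ℕ}
    (hd : i + j + k = 2 ∨ i + j + k = 4) :
    Integrable (fun ω => if 0 < closeSpread (fun t => X t ω) then 0 else
      flipMonomial i j k (fun t => X t ω)) P ∧
    ∫ ω, (if 0 < closeSpread (fun t => X t ω) then 0 else
      flipMonomial i j k (fun t => X t ω)) ∂P = σ ^ (i + j + k) * halfMean i j k := by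
  obtain ⟨h1, h2⟩ := integral_flipMonomial_pos hX.neg hd
  have hae : (fun ω => if 0 < closeSpread (fun t => (-X) t ω) then
      flipMonomial i j k (fun t => (-X) t ω) else 0) =ᵐ[P]
      fun ω => if 0 < closeSpread (fun t => X t ω) then 0 else
        flipMonomial i j k (fun t => X t ω) := by
    filter_upwards [hX.ae_closeSpread_ne_zero] with ω hω
    have e : (fun t => (-X) t ω) = -fun t => X t ω := rfl
    rw [e, flipMonomial_neg i j k hω, closeSpread_neg]
    rcases hω.lt_or_gt with h | h
    · rw [if_pos (by linarith), if_neg (by linarith)]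
    · rw [if_neg (by linarith), if_pos (by linarith)]
  exact ⟨h1.congr hae, by rw [← integral_congr_ae hae, h2]⟩

end

/-! ### Means and covariances of quadratic statistics as bilinear forms -/

section

section Unbiased

variable {Ω : Type*} [MeasurableSpace Ω] {P : Measure Ω}

lemma IsUnbiased.const_mul {Y : Ω → ℝ} {θ : ℝ} (h : IsUnbiased Y θ P) (c : ℝ) :
    IsUnbiased (fun ω => c * Y ω) (c * θ) P :=
  ⟨h.1.const_mul c, by rw [integral_const_mul, h.2]⟩

lemma IsUnbiased.add {Y Z : Ω → ℝ} {θ η : ℝ} (h : IsUnbiased Y θ P) (h' : IsUnbiased Z η P) :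
    IsUnbiased (fun ω => Y ω + Z ω) (θ + η) P :=
  ⟨h.1.add h'.1, by rw [integral_add h.1 h'.1, h.2, h'.2]⟩

lemma IsUnbiased.sum {ι : Type*} [Fintype ι] {Y : ι → Ω → ℝ} {θ : ι → ℝ}
    (h : ∀ i, IsUnbiased (Y i) (θ i) P) : IsUnbiased (fun ω => ∑ i, Y i ω) (∑ i, θ i) P :=
  ⟨integrable_finsetSum _ fun i _ => (h i).1, by
    rw [integral_finsetSum _ fun i _ => (h i).1]
    exact Finset.sum_congr rfl fun i _ => (h i).2⟩

end Unbiased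

/-- Exponents of `C` in the monomials `C², Ca, Cb, a², ab, b²`, where `a = H - C`, `b = -L`. -/
def degClose : Fin 6 → ℕ := ![2, 1, 1, 0, 0, 0]

/-- Exponents of `H - C` in the six quadratic monomials. -/
def degHigh : Fin 6 → ℕ := ![0, 1, 0, 2, 1, 0]

/-- Exponents of `-L` in the six quadratic monomials. -/
def degLow : Fin 6 → ℕ := ![0, 0, 1, 0, 1, 2]

/-- A quadratic function of `(C, H, L)` with coefficients `p` on `c > 0` and `q` on `c ≤ 0`. -/
def piecewiseQuad (p q : Fin 6 → ℝ) (x : ℝ≥0 → ℝ) : ℝ :=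
  if 0 < closeSpread x then ∑ m, p m * flipMonomial (degClose m) (degHigh m) (degLow m) x
  else ∑ m, q m * flipMonomial (degClose m) (degHigh m) (degLow m) x

/-- Half means of the quadratic monomials. -/
def meanVec (m : Fin 6) : ℝ := halfMean (degClose m) (degHigh m) (degLow m)

/-- Half second moments of the quadratic monomials. -/
def gram (m n : Fin 6) : ℝ :=
  halfMean (degClose m + degClose n) (degHigh m + degHigh n) (degLow m + degLow n)

lemma deg_sum (m : Fin 6) : degClose m + degHigh m + degLow m = 2 := by
  fin_cases m <;> rfl

lemma flipMonomial_mul (i j k i' j' k' : ℕ) (x : ℝ≥0 → ℝ) :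
    flipMonomial i j k x * flipMonomial i' j' k' x =
      flipMonomial (i + i') (j + j') (k + k') x := by
  simp only [flipMonomial, pow_add]; ring

/-- The mean functional of `piecewiseQuad`, in units of `σ ^ 2`. -/
def meanForm (p q : Fin 6 → ℝ) : ℝ := ∑ m, (p m + q m) * meanVec m

/-- The second moment form of `piecewiseQuad`, in units of `σ ^ 4`. -/
def momentForm (p q p' q' : Fin 6 → ℝ) : ℝ := ∑ m, ∑ n, (p m * p' n + q m * q' n) * gram m n

variable {Ω : Type*} [MeasurableSpace Ω] {P : Measure Ω} {X : ℝ≥0 → Ω → ℝ} {σ : ℝ}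

lemma isUnbiased_piecewiseQuad (hX : IsZeroDriftBM X σ P) (p q : Fin 6 → ℝ) :
    IsUnbiased (onPaths (piecewiseQuad p q) X) (σ ^ 2 * meanForm p q) P := by
  have h := IsUnbiased.sum fun m : Fin 6 =>
    (IsUnbiased.const_mul (integral_flipMonomial_pos hX (Or.inl (deg_sum m))) (p m)).add
      (IsUnbiased.const_mul (integral_flipMonomial_neg hX (Or.inl (deg_sum m))) (q m))
  convert h using 1
  · funext ω
    simp only [onPaths, piecewiseQuad]
    split_ifs <;> simp
  · simp only [meanForm, Finset.mul_sum, deg_sum, meanVec]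
    exact Finset.sum_congr rfl fun m _ => by ring

/-- The branches `c > 0` and `c ≤ 0` are disjoint, so no products of a `p` with a `q'` appear; each
branch contributes the same degree-four half moments. -/
lemma isUnbiased_mul (hX : IsZeroDriftBM X σ P) (p q p' q' : Fin 6 → ℝ) :
    IsUnbiased (fun ω => onPaths (piecewiseQuad p q) X ω * onPaths (piecewiseQuad p' q') X ω)
      (σ ^ 4 * momentForm p q p' q') P := by
  have hd : ∀ m n : Fin 6, degClose m + degClose n + (degHigh m + degHigh n) +
      (degLow m + degLow n) = 4 := fun m n => by
    have := deg_sum m; have := deg_sum n; omega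
  have h := IsUnbiased.sum fun m : Fin 6 => IsUnbiased.sum fun n : Fin 6 =>
    (IsUnbiased.const_mul (integral_flipMonomial_pos hX (Or.inr (hd m n))) (p m * p' n)).add
      (IsUnbiased.const_mul (integral_flipMonomial_neg hX (Or.inr (hd m n))) (q m * q' n))
  convert h using 1
  · funext ω
    simp only [onPaths, piecewiseQuad, ← flipMonomial_mul]
    split_ifs
    · rw [Finset.sum_mul_sum]
      exact Finset.sum_congr rfl fun m _ => Finset.sum_congr rfl fun n _ => by ring
    · rw [Finset.sum_mul_sum]
      exact Finset.sum_congr rfl fun m _ => Finset.sum_congr rfl fun n _ => by ring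
  · simp only [momentForm, Finset.mul_sum, hd, gram]
    exact Finset.sum_congr rfl fun m _ => Finset.sum_congr rfl fun n _ => by ring

lemma memLp_piecewiseQuad (hX : IsZeroDriftBM X σ P) (p q : Fin 6 → ℝ) :
    MemLp (onPaths (piecewiseQuad p q) X) 2 P := by
  rw [memLp_two_iff_integrable_sq (isUnbiased_piecewiseQuad hX p q).1.aestronglyMeasurable]
  simpa only [sq] using (isUnbiased_mul hX p q p q).1

lemma covariance_piecewiseQuad (hX : IsZeroDriftBM X σ P) (p q p' q' : Fin 6 → ℝ) :
    cov[onPaths (piecewiseQuad p q) X, onPaths (piecewiseQuad p' q') X; P] =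
      σ ^ 4 * (momentForm p q p' q' - meanForm p q * meanForm p' q') := by
  have := hX.isProbabilityMeasure
  rw [covariance_eq_sub (memLp_piecewiseQuad hX p q) (memLp_piecewiseQuad hX p' q'),
    (isUnbiased_piecewiseQuad hX p q).2, (isUnbiased_piecewiseQuad hX p' q').2]
  rw [show ∫ ω, (onPaths (piecewiseQuad p q) X * onPaths (piecewiseQuad p' q') X) ω ∂P = _ from
    (isUnbiased_mul hX p q p' q').2]
  ring

lemma variance_piecewiseQuad (hX : IsZeroDriftBM X σ P) (p q : Fin 6 → ℝ) :
    Var[onPaths (piecewiseQuad p q) X; P] =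
      σ ^ 4 * (momentForm p q p q - meanForm p q ^ 2) := by
  rw [← covariance_self (memLp_piecewiseQuad hX p q).aestronglyMeasurable.aemeasurable,
    covariance_piecewiseQuad hX, sq]

lemma isUnbiased_piecewiseQuad_iff (hX : IsZeroDriftBM X σ P) {p q : Fin 6 → ℝ} :
    IsUnbiased (onPaths (piecewiseQuad p q) X) (σ ^ 2) P ↔ meanForm p q = 1 := by
  have h := isUnbiased_piecewiseQuad hX p q
  have hs : σ ^ 2 ≠ 0 := pow_ne_zero _ hX.sigma_pos.ne'
  constructor
  · intro h'
    have := h.2.symm.trans h'.2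
    exact mul_left_cancel₀ hs (by rw [this, mul_one])
  · intro h'
    rwa [h', mul_one] at h

/-- The orthogonality criterion for minimal variance. -/
theorem variance_le_of_momentForm_eq (hX : IsZeroDriftBM X σ P) {p q p' q' : Fin 6 → ℝ}
    (h1 : meanForm p q = 1) (h2 : meanForm p' q' = 1)
    (h : momentForm p q p' q' = momentForm p q p q) :
    Var[onPaths (piecewiseQuad p q) X; P] ≤ Var[onPaths (piecewiseQuad p' q') X; P] := by
  have := hX.isProbabilityMeasure
  have hp := memLp_piecewiseQuad hX p q
  have hp' := memLp_piecewiseQuad hX p' q'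
  -- Equal means and the assumed second-moment identity make the covariance equal to the smaller
  -- variance. Then nonnegativity of the variance of the difference is the claim.
  have hv := variance_nonneg (onPaths (piecewiseQuad p' q') X - onPaths (piecewiseQuad p q) X) P
  rw [variance_sub hp' hp, covariance_piecewiseQuad hX, variance_piecewiseQuad hX p q] at hv
  rw [variance_piecewiseQuad hX p q]
  have hc : momentForm p' q' p q = momentForm p q p' q' := by
    unfold momentForm
    rw [Finset.sum_comm]
    refine Finset.sum_congr rfl fun m _ => Finset.sum_congr rfl fun n _ => ?_
    have : gram n m = gram m n := by
      unfold gram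
      rw [add_comm (degClose n), add_comm (degHigh n), add_comm (degLow n)]
    rw [this]; ring
  rw [hc, h, h1, h2] at hv
  rw [h1]
  linarith

end

/-! ### Coefficients of the estimators and the explicit moment tables -/

section

/-- The mean of `(H - C)(-L)` for standard Brownian motion. -/
def meanHighLow : ℝ := 2 * Real.log 2 - 5 / 4

lemma meanHighLow_bounds : 0.1362943606 ≤ meanHighLow ∧ meanHighLow ≤ 0.1362943616 := by
  have h1 := Real.log_two_gt_d9
  have h2 := Real.log_two_lt_d9
  unfold meanHighLow
  constructor <;> linarith

lemma meanHighLow_pos : 0 < meanHighLow := lt_of_lt_of_le (by norm_num) meanHighLow_bounds.1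

lemma meanVec_eq : meanVec = ![1 / 2, 1 / 8, 1 / 8, 1 / 8, meanHighLow / 2, 1 / 8] := by
  have h := mixedSum_zero_one_one
  funext m
  fin_cases m <;>
    norm_num [meanVec, halfMean, degClose, degHigh, degLow, momentFactor, Nat.factorial, h,
      meanHighLow] <;> ring

/-- Symmetry of `mixedSum` in its last two indices leaves four irrational constants and makes the
table invariant under `a ↔ b`. -/
lemma gram_eq : gram = fun m n => !![
    3 / 2, 3 / 16, 3 / 16, 1 / 16, mixedSum 2 1 1 / 8, 1 / 16;
    3 / 16, 1 / 16, mixedSum 2 1 1 / 8, 3 / 64, mixedSum 1 2 1 / 8, mixedSum 1 2 1 / 8;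
    3 / 16, mixedSum 2 1 1 / 8, 1 / 16, mixedSum 1 2 1 / 8, mixedSum 1 2 1 / 8, 3 / 64;
    1 / 16, 3 / 64, mixedSum 1 2 1 / 8, 3 / 32, 3 * mixedSum 0 3 1 / 8, mixedSum 0 2 2 / 4;
    mixedSum 2 1 1 / 8, mixedSum 1 2 1 / 8, mixedSum 1 2 1 / 8, 3 * mixedSum 0 3 1 / 8,
      mixedSum 0 2 2 / 4, 3 * mixedSum 0 3 1 / 8;
    1 / 16, mixedSum 1 2 1 / 8, 3 / 64, mixedSum 0 2 2 / 4, 3 * mixedSum 0 3 1 / 8, 3 / 32] m n := by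
  have h1 := mixedSum_comm 1 1 2
  have h2 := mixedSum_comm 0 1 3
  funext m n
  fin_cases m <;> fin_cases n <;>
    norm_num [gram, halfMean, degClose, degHigh, degLow, momentFactor, Nat.factorial, h1, h2] <;>
    ring

/-- Coefficients of `weightedEst w` in `C², Ca, Cb, a², ab, b²`. -/
def weightCoeff (w : Fin 4 → ℝ) : Fin 6 → ℝ :=
  ![w 1, 2 * w 2, 2 * w 2, 2 * w 0, w 3 / meanHighLow, 2 * w 0]

lemma weightedEst_eq (w : Fin 4 → ℝ) :
    weightedEst w = piecewiseQuad (weightCoeff w) (weightCoeff w) := by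
  funext x
  simp [weightedEst, piecewiseQuad, Fin.sum_univ_succ, basicEst, weightCoeff, flipMonomial, degClose,
    degHigh, degLow, meanHighLow]
  ring

lemma basicEst_eq (i : Fin 4) : basicEst i = weightedEst (Pi.single i 1) := by
  funext x
  simp [weightedEst, Pi.single_apply]

/-- Coefficients of `garmanKlassEst g` in `C², Ca, Cb, a², ab, b²`. -/
def gkCoeff (g : Fin 3 → ℝ) : Fin 6 → ℝ :=
  ![g 0 - g 1 - g 2, 2 * g 0 - g 1, 2 * g 0 - g 1, g 0, 2 * (g 0 - g 1), g 0]

/-- The Garman–Klass expression is unchanged by `x ↦ -x`, hence one coefficient vector serves both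
signs of the close. -/
lemma garmanKlassEst_eq (g : Fin 3 → ℝ) :
    garmanKlassEst g = piecewiseQuad (gkCoeff g) (gkCoeff g) := by
  funext x
  by_cases h : 0 < closeSpread x
  · simp [garmanKlassEst, piecewiseQuad, Fin.sum_univ_succ, gkCoeff, flipMonomial, degClose,
      degHigh, degLow, flipClose, flipHigh, flipLow, h, abs_of_pos h]
    ring
  · simp [garmanKlassEst, piecewiseQuad, Fin.sum_univ_succ, gkCoeff, flipMonomial, degClose,
      degHigh, degLow, flipClose, flipHigh, flipLow, h, abs_of_nonpos (not_lt.1 h)]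
    ring

/-- Coefficients of a quadratic form in `(C, H, L)`. -/
def flipCoeff (A : Matrix (Fin 3) (Fin 3) ℝ) : Fin 6 → ℝ :=
  ![A 0 0 + A 0 1 + A 1 0 + A 1 1, A 0 1 + A 1 0 + 2 * A 1 1,
    -(A 0 2 + A 2 0) - (A 1 2 + A 2 1), A 1 1, -(A 1 2 + A 2 1), A 2 2]

/-- Coefficients of a quadratic form in `(c, h, l)` on `c ≤ 0`. -/
def swapCoeff (A : Matrix (Fin 3) (Fin 3) ℝ) : Fin 6 → ℝ :=
  ![A 0 0 + A 0 2 + A 2 0 + A 2 2, A 0 2 + A 2 0 + 2 * A 2 2,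
    -(A 0 1 + A 1 0) - (A 1 2 + A 2 1), A 2 2, -(A 1 2 + A 2 1), A 1 1]

lemma quadForm_flip_eq (A : Matrix (Fin 3) (Fin 3) ℝ) :
    (fun x => quadForm A (S₂ x)) = piecewiseQuad (flipCoeff A) (flipCoeff A) := by
  funext x
  simp [quadForm, S₂, Matrix.mulVec, dotProduct, piecewiseQuad, Fin.sum_univ_succ, flipCoeff,
    flipMonomial, degClose, degHigh, degLow]
  ring

/-- For `c ≤ 0` one has `(c, h, l) = (-C, b, -(C + a))`. The coefficients then differ between the
branches, which is why `piecewiseQuad` carries two vectors. -/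
lemma quadForm_raw_eq (A : Matrix (Fin 3) (Fin 3) ℝ) :
    (fun x => quadForm A (S₁ x)) = piecewiseQuad (flipCoeff A) (swapCoeff A) := by
  funext x
  by_cases h : 0 < closeSpread x
  · simp [quadForm, S₁, Matrix.mulVec, dotProduct, piecewiseQuad, Fin.sum_univ_succ, flipCoeff,
      flipMonomial, degClose, degHigh, degLow, flipClose, flipHigh, flipLow, h, abs_of_pos h]
    ring
  · simp [quadForm, S₁, Matrix.mulVec, dotProduct, piecewiseQuad, Fin.sum_univ_succ, swapCoeff,
      flipMonomial, degClose, degHigh, degLow, flipClose, flipHigh, flipLow, h,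
      abs_of_nonpos (not_lt.1 h)]
    ring

lemma closeSpread_sq_eq : (fun x => closeSpread x ^ 2) = weightedEst (Pi.single 1 1) := by
  funext x
  rw [← basicEst_eq]
  simp [basicEst, flipClose]

lemma meanForm_weightCoeff (w : Fin 4 → ℝ) :
    meanForm (weightCoeff w) (weightCoeff w) = w 0 + w 1 + w 2 + w 3 := by
  have := meanHighLow_pos.ne'
  rw [meanForm, meanVec_eq]
  simp [Fin.sum_univ_succ, weightCoeff]
  field_simp
  ring

/-- The covariance matrix of the basic estimators for `σ = 1`. -/
def unitCov : Matrix (Fin 4) (Fin 4) ℝ :=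
  !![1 / 2 + 4 * mixedSum 0 2 2, -1 / 2, 2 * mixedSum 1 2 1 - 1 / 4,
      3 * mixedSum 0 3 1 / meanHighLow - 1;
    -1 / 2, 2, 1 / 2, mixedSum 2 1 1 / (4 * meanHighLow) - 1;
    2 * mixedSum 1 2 1 - 1 / 4, 1 / 2, 2 * mixedSum 2 1 1, mixedSum 1 2 1 / meanHighLow - 1;
    3 * mixedSum 0 3 1 / meanHighLow - 1, mixedSum 2 1 1 / (4 * meanHighLow) - 1,
      mixedSum 1 2 1 / meanHighLow - 1, mixedSum 0 2 2 / (2 * meanHighLow ^ 2) - 1]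

/-- Every basic estimator has unit mean when `σ = 1`, so subtracting the product of the weight sums
turns second moments into covariances. -/
lemma momentForm_weightCoeff (w v : Fin 4 → ℝ) :
    momentForm (weightCoeff w) (weightCoeff w) (weightCoeff v) (weightCoeff v) -
      (w 0 + w 1 + w 2 + w 3) * (v 0 + v 1 + v 2 + v 3) = w ⬝ᵥ (unitCov *ᵥ v) := by
  have := meanHighLow_pos.ne'
  rw [momentForm, gram_eq]
  simp [Fin.sum_univ_succ, weightCoeff, unitCov, Matrix.mulVec, dotProduct]
  field_simp
  ring

end

/-! ### Constrained quadratic minimisation and numerical lower bounds -/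

section

section Optimum

variable {ι : Type*} [Fintype ι] {G : Matrix ι ι ℝ} {m : ι → ℝ}

/-- The minimizer of `x ⬝ G x` subject to `m ⬝ x = 1`. -/
def optimum [DecidableEq ι] (G : Matrix ι ι ℝ) (m : ι → ℝ) : ι → ℝ := (m ⬝ᵥ (G⁻¹ *ᵥ m))⁻¹ • (G⁻¹ *ᵥ m)

lemma mulVec_optimum [DecidableEq ι] (hG : G.PosDef) :
    G *ᵥ optimum G m = (m ⬝ᵥ (G⁻¹ *ᵥ m))⁻¹ • m := by
  rw [optimum, Matrix.mulVec_smul, Matrix.mulVec_mulVec,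
    Matrix.mul_nonsing_inv _ (G.isUnit_iff_isUnit_det.1 hG.isUnit), Matrix.one_mulVec]

lemma dotProduct_optimum [DecidableEq ι] (hG : G.PosDef) (hm : m ≠ 0) : m ⬝ᵥ optimum G m = 1 := by
  have h : 0 < m ⬝ᵥ (G⁻¹ *ᵥ m) := by simpa using hG.inv.dotProduct_mulVec_pos hm
  rw [optimum, dotProduct_smul, smul_eq_mul, inv_mul_cancel₀ h.ne']

lemma posDef_of_le {l : ℝ} (hl : 0 < l) (hsymm : G.IsHermitian)
    (hG : ∀ v, l * (v ⬝ᵥ v) ≤ v ⬝ᵥ (G *ᵥ v)) : G.PosDef := by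
  refine Matrix.PosDef.of_dotProduct_mulVec_pos hsymm fun v hv => ?_
  have h : 0 < v ⬝ᵥ v := by
    have := Matrix.dotProduct_star_self_pos_iff.2 hv
    simpa using this
  simpa using (mul_pos hl h).trans_le (hG v)

lemma dotProduct_mulVec_comm (hsymm : G.IsHermitian) (x y : ι → ℝ) :
    x ⬝ᵥ (G *ᵥ y) = y ⬝ᵥ (G *ᵥ x) := by
  have h : Gᵀ = G := by simpa [Matrix.IsHermitian, Matrix.conjTranspose_eq_transpose_of_trivial]
    using hsymm
  rw [Matrix.dotProduct_mulVec, ← Matrix.mulVec_transpose, h, dotProduct_comm]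

/-- Distance to the minimizer, and the minimum, in terms of the residual of an approximation. -/
lemma optimum_approx {l : ℝ} (hl : 0 < l) (hsymm : G.IsHermitian)
    (hG : ∀ v, l * (v ⬝ᵥ v) ≤ v ⬝ᵥ (G *ᵥ v)) {x r ρ : ι → ℝ} {k k' : ℝ} (hx : G *ᵥ x = k • m)
    (hmx : m ⬝ᵥ x = 1) (hmr : m ⬝ᵥ r = 1) (hρ : G *ᵥ r = k' • m + ρ) {ε : ℝ}
    (hε : ρ ⬝ᵥ ρ ≤ ε) :
    (∀ i, (x i - r i) ^ 2 ≤ ε / l ^ 2) ∧ r ⬝ᵥ (G *ᵥ r) - ε / l ≤ k ∧ k ≤ r ⬝ᵥ (G *ᵥ r) := by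
  obtain ⟨v, hv⟩ : ∃ v, v = x - r := ⟨_, rfl⟩
  have hmv : v ⬝ᵥ m = 0 := by rw [dotProduct_comm, hv, dotProduct_sub, hmx, hmr, sub_self]
  have h1 : v ⬝ᵥ (G *ᵥ v) = -(v ⬝ᵥ ρ) := by
    have e : G *ᵥ v = k • m - (k' • m + ρ) := by rw [hv, Matrix.mulVec_sub, hx, hρ]
    rw [e, dotProduct_sub, dotProduct_add, dotProduct_smul, dotProduct_smul, hmv]
    simp
  have h2 : r ⬝ᵥ (G *ᵥ r) = k + v ⬝ᵥ (G *ᵥ v) := by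
    have e : r = x - v := by rw [hv]; abel
    rw [e, Matrix.mulVec_sub, dotProduct_sub, sub_dotProduct, sub_dotProduct,
      dotProduct_mulVec_comm hsymm x v, hx, dotProduct_smul, dotProduct_smul, hmv,
      dotProduct_comm x m, hmx]
    simp
  -- Since `v` is orthogonal to `m`, only `ρ` survives in `v ⬝ G v`. This square together with `l
  -- |v|² ≤ -(v ⬝ ρ)` gives both `l² |v|² ≤ |ρ|²` and `v ⬝ G v ≤ |ρ|² / l`, replacing
  -- Cauchy–Schwarz.
  have h3 : 0 ≤ (l • v + ρ) ⬝ᵥ (l • v + ρ) :=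
    Finset.sum_nonneg fun i _ => mul_self_nonneg _
  have h4 : (l • v + ρ) ⬝ᵥ (l • v + ρ) = l ^ 2 * (v ⬝ᵥ v) + 2 * l * (v ⬝ᵥ ρ) + ρ ⬝ᵥ ρ := by
    simp only [add_dotProduct, dotProduct_add, smul_dotProduct, dotProduct_smul, smul_eq_mul,
      dotProduct_comm ρ v]
    ring
  have h5 := hG v
  have h6 : l * (l * (v ⬝ᵥ v)) ≤ l * -(v ⬝ᵥ ρ) := mul_le_mul_of_nonneg_left (h1 ▸ h5) hl.le
  have h7 : l ^ 2 * (v ⬝ᵥ v) ≤ ε := by nlinarith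
  have h8 : 0 ≤ v ⬝ᵥ v := Finset.sum_nonneg fun i _ => mul_self_nonneg (v i)
  refine ⟨fun i => ?_, ?_, ?_⟩
  · rw [le_div_iff₀ (by positivity), mul_comm]
    refine le_trans (mul_le_mul_of_nonneg_left ?_ (by positivity)) h7
    calc (x i - r i) ^ 2 = v i * v i := by rw [hv, Pi.sub_apply]; ring
      _ ≤ _ := Finset.single_le_sum (f := fun j => v j * v j)
        (fun j _ => mul_self_nonneg (v j)) (Finset.mem_univ i)
  · have : v ⬝ᵥ (G *ᵥ v) ≤ ε / l := by
      rw [le_div_iff₀ hl]; nlinarith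
    linarith
  · have : 0 ≤ v ⬝ᵥ (G *ᵥ v) := (mul_nonneg hl.le h8).trans h5
    linarith

end Optimum

/-- With thirty terms the tail bound `j k / (32 · 30 ^ 6)` is below `1.8 · 10⁻¹⁰`. -/
lemma mixedSum_enclosures :
    (0.2523766055 ≤ mixedSum 2 1 1 ∧ mixedSum 2 1 1 ≤ 0.2523766056) ∧
    (0.1303367812 ≤ mixedSum 1 2 1 ∧ mixedSum 1 2 1 ≤ 0.1303367814) ∧
    (0.0744857741 ≤ mixedSum 0 2 2 ∧ mixedSum 0 2 2 ≤ 0.0744857744) ∧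
    (0.0718173835 ≤ mixedSum 0 3 1 ∧ mixedSum 0 3 1 ≤ 0.0718173837) := by
  obtain ⟨a1, a2⟩ := mixedSum_bounds (i := 2) (j := 1) (k := 1) rfl (N := 30) (by norm_num)
  obtain ⟨b1, b2⟩ := mixedSum_bounds (i := 1) (j := 2) (k := 1) rfl (N := 30) (by norm_num)
  obtain ⟨c1, c2⟩ := mixedSum_bounds (i := 0) (j := 2) (k := 2) rfl (N := 30) (by norm_num)
  obtain ⟨d1, d2⟩ := mixedSum_bounds (i := 0) (j := 3) (k := 1) rfl (N := 30) (by norm_num)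
  norm_num [Finset.sum_range_succ, mixedTerm] at a1 a2 b1 b2 c1 c2 d1 d2
  refine ⟨⟨?_, ?_⟩, ⟨?_, ?_⟩, ⟨?_, ?_⟩, ?_, ?_⟩ <;> linarith

/-- Enclosures of the entries of `unitCov` other than the rational ones. -/
structure UnitCovEnclosure (t : Fin 7 → ℝ) : Prop where
  e00 : |t 0 - 0.7979430968| ≤ 0.00000002
  e02 : |t 1 - 0.0106735626| ≤ 0.00000002
  e03 : |t 2 - 0.5807855064| ≤ 0.00000002
  e13 : |t 3 + 0.5370743818| ≤ 0.00000002
  e22 : |t 4 - 0.5047532111| ≤ 0.00000002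
  e23 : |t 5 + 0.0437111247| ≤ 0.00000002
  e33 : |t 6 - 1.0048762173| ≤ 0.00000003

/-- The matrix `unitCov` with its irrational entries replaced by parameters. -/
def covPattern (t : Fin 7 → ℝ) : Matrix (Fin 4) (Fin 4) ℝ :=
  !![t 0, -1 / 2, t 1, t 2; -1 / 2, 2, 1 / 2, t 3; t 1, 1 / 2, t 4, t 5; t 2, t 3, t 5, t 6]

lemma exists_unitCov_eq : ∃ t, UnitCovEnclosure t ∧ unitCov = covPattern t := by
  obtain ⟨⟨a1, a2⟩, ⟨b1, b2⟩, ⟨c1, c2⟩, ⟨d1, d2⟩⟩ := mixedSum_enclosures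
  obtain ⟨k1, k2⟩ := meanHighLow_bounds
  have hk := meanHighLow_pos
  refine ⟨![1 / 2 + 4 * mixedSum 0 2 2, 2 * mixedSum 1 2 1 - 1 / 4,
    3 * mixedSum 0 3 1 / meanHighLow - 1, mixedSum 2 1 1 / (4 * meanHighLow) - 1,
    2 * mixedSum 2 1 1, mixedSum 1 2 1 / meanHighLow - 1,
    mixedSum 0 2 2 / (2 * meanHighLow ^ 2) - 1], ?_, ?_⟩
  · have hk2 : 0.1362943606 ^ 2 ≤ meanHighLow ^ 2 := by gcongr
    have hk3 : meanHighLow ^ 2 ≤ 0.1362943616 ^ 2 := by gcongr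
    have key : ∀ {x y c d : ℝ}, 0 < y → (c - d) * y ≤ x → x ≤ (c + d) * y →
        |x / y - c| ≤ d := by
      intro x y c d hy h1 h2
      rw [abs_le, neg_le_sub_iff_le_add, sub_le_iff_le_add, ← sub_le_iff_le_add, le_div_iff₀ hy,
        div_le_iff₀ hy]
      exact ⟨h1, by linarith⟩
    constructor
    · show |1 / 2 + 4 * mixedSum 0 2 2 - 0.7979430968| ≤ 0.00000002
      rw [abs_le]; constructor <;> linarith
    · show |2 * mixedSum 1 2 1 - 1 / 4 - 0.0106735626| ≤ 0.00000002
      rw [abs_le]; constructor <;> linarith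
    · show |3 * mixedSum 0 3 1 / meanHighLow - 1 - 0.5807855064| ≤ 0.00000002
      rw [sub_sub]
      exact key hk (by linarith) (by linarith)
    · show |mixedSum 2 1 1 / (4 * meanHighLow) - 1 + 0.5370743818| ≤ 0.00000002
      rw [sub_add]
      exact key (by positivity) (by linarith) (by linarith)
    · show |2 * mixedSum 2 1 1 - 0.5047532111| ≤ 0.00000002
      rw [abs_le]; constructor <;> linarith
    · show |mixedSum 1 2 1 / meanHighLow - 1 + 0.0437111247| ≤ 0.00000002
      rw [sub_add]
      exact key hk (by linarith) (by linarith)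
    · show |mixedSum 0 2 2 / (2 * meanHighLow ^ 2) - 1 - 1.0048762173| ≤ 0.00000003
      rw [sub_sub]
      exact key (by positivity) (by linarith) (by linarith)
  · ext i j
    fin_cases i <;> fin_cases j <;> rfl

/-- The effect of an entry error `e` on a quadratic form, from the squares of `a ± b` weighted by `d
± e`. Taking `a = b` covers diagonal entries. -/
lemma neg_mul_add_sq_le {e d : ℝ} (h : |e| ≤ d) (a b : ℝ) : -d * (a ^ 2 + b ^ 2) ≤ 2 * (e * (a * b)) := by
  obtain ⟨h1, h2⟩ := abs_le.1 h
  nlinarith [mul_nonneg (by linarith : 0 ≤ d + e) (sq_nonneg (a + b)),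
    mul_nonneg (by linarith : 0 ≤ d - e) (sq_nonneg (a - b))]

lemma unitCov_isHermitian : unitCov.IsHermitian := by
  ext i j
  fin_cases i <;> fin_cases j <;> simp [unitCov]

lemma unitCov_lower (v : Fin 4 → ℝ) : 0.25 * (v ⬝ᵥ v) ≤ v ⬝ᵥ (unitCov *ᵥ v) := by
  obtain ⟨t, ht, h⟩ := exists_unitCov_eq
  rw [h]
  simp only [covPattern, Matrix.mulVec, dotProduct, Fin.sum_univ_four, Matrix.of_apply,
    Matrix.cons_val]
  have h1 := neg_mul_add_sq_le ht.e00 (v 0) (v 0)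
  have h2 := neg_mul_add_sq_le ht.e02 (v 0) (v 2)
  have h3 := neg_mul_add_sq_le ht.e03 (v 0) (v 3)
  have h4 := neg_mul_add_sq_le ht.e13 (v 1) (v 3)
  have h5 := neg_mul_add_sq_le ht.e22 (v 2) (v 2)
  have h6 := neg_mul_add_sq_le ht.e23 (v 2) (v 3)
  have h7 := neg_mul_add_sq_le ht.e33 (v 3) (v 3)
  -- The first three squares are a rounded completion of squares for the midpoint matrix minus
  -- `0.25` times the identity; the others absorb rounding and the entry errors.
  linarith [sq_nonneg (v 0 - 0.9126 * v 1 + 0.0195 * v 2 + 1.06 * v 3),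
    sq_nonneg (v 1 + 0.394 * v 2 - 0.0055 * v 3), sq_nonneg (v 2 - 0.9726 * v 3),
    sq_nonneg (v 0), sq_nonneg (v 1), sq_nonneg (v 2), sq_nonneg (v 3), sq_nonneg (v 0 - v 1),
    sq_nonneg (v 0 + v 1), sq_nonneg (v 0 - v 2), sq_nonneg (v 0 + v 2), sq_nonneg (v 0 - v 3),
    sq_nonneg (v 0 + v 3), sq_nonneg (v 1 - v 2), sq_nonneg (v 1 + v 2), sq_nonneg (v 1 - v 3),
    sq_nonneg (v 1 + v 3), sq_nonneg (v 2 - v 3), sq_nonneg (v 2 + v 3)]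

lemma unitCov_posDef : unitCov.PosDef :=
  posDef_of_le (by norm_num) unitCov_isHermitian unitCov_lower

/-- Second moments, for `σ = 1`, of the three terms of `garmanKlassEst`. -/
def gkMoment : Matrix (Fin 3) (Fin 3) ℝ :=
  !![69 / 8 + 3 * mixedSum 2 1 1 + 6 * mixedSum 1 2 1 + 3 * mixedSum 0 2 2 + 6 * mixedSum 0 3 1,
      -99 / 16 - 2 * mixedSum 2 1 1 - 7 / 2 * mixedSum 1 2 1 - 2 * mixedSum 0 2 2
        - 3 * mixedSum 0 3 1, -19 / 4 - mixedSum 2 1 1 / 2;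
    -99 / 16 - 2 * mixedSum 2 1 1 - 7 / 2 * mixedSum 1 2 1 - 2 * mixedSum 0 2 2
        - 3 * mixedSum 0 3 1,
      19 / 4 + 3 / 2 * mixedSum 2 1 1 + 2 * mixedSum 1 2 1 + 2 * mixedSum 0 2 2,
      15 / 4 + mixedSum 2 1 1 / 2;
    -19 / 4 - mixedSum 2 1 1 / 2, 15 / 4 + mixedSum 2 1 1 / 2, 3]

/-- Means, for `σ = 1`, of the three terms of `garmanKlassEst`. -/
def gkMean : Fin 3 → ℝ := ![4 * Real.log 2, 1 - 4 * Real.log 2, -1]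

lemma momentForm_gkCoeff (g g' : Fin 3 → ℝ) :
    momentForm (gkCoeff g) (gkCoeff g) (gkCoeff g') (gkCoeff g') = g ⬝ᵥ (gkMoment *ᵥ g') := by
  rw [momentForm, gram_eq]
  simp [Fin.sum_univ_succ, gkCoeff, gkMoment, Matrix.mulVec, dotProduct]
  ring

lemma meanForm_gkCoeff (g : Fin 3 → ℝ) :
    meanForm (gkCoeff g) (gkCoeff g) = gkMean ⬝ᵥ g := by
  rw [meanForm, meanVec_eq]
  simp [Fin.sum_univ_succ, gkCoeff, gkMean, dotProduct, meanHighLow]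
  ring

lemma gkMoment_isHermitian : gkMoment.IsHermitian := by
  ext i j
  fin_cases i <;> fin_cases j <;> simp [gkMoment]

lemma gkMoment_enclosures :
    |gkMoment 0 0 - 10.8185121284| ≤ 0.00000001 ∧ |gkMoment 0 1 + 7.5128556447| ≤ 0.00000001 ∧
    |gkMoment 0 2 + 4.8761883028| ≤ 0.00000001 ∧ |gkMoment 1 1 - 5.5382100193| ≤ 0.00000001 ∧
    |gkMoment 1 2 - 3.8761883028| ≤ 0.00000001 := by
  obtain ⟨⟨a1, a2⟩, ⟨b1, b2⟩, ⟨c1, c2⟩, ⟨d1, d2⟩⟩ := mixedSum_enclosures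
  simp only [gkMoment, Matrix.of_apply, Matrix.cons_val, abs_le]
  refine ⟨⟨?_, ?_⟩, ⟨?_, ?_⟩, ⟨?_, ?_⟩, ⟨?_, ?_⟩, ?_, ?_⟩ <;> linarith

lemma gkMoment_mulVec (v : Fin 3 → ℝ) : gkMoment *ᵥ v =
    ![gkMoment 0 0 * v 0 + gkMoment 0 1 * v 1 + gkMoment 0 2 * v 2,
      gkMoment 0 1 * v 0 + gkMoment 1 1 * v 1 + gkMoment 1 2 * v 2,
      gkMoment 0 2 * v 0 + gkMoment 1 2 * v 1 + 3 * v 2] := by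
  ext i
  fin_cases i <;> simp [gkMoment, Matrix.mulVec, dotProduct, Fin.sum_univ_succ] <;> ring

lemma gkMoment_lower (v : Fin 3 → ℝ) : 0.012 * (v ⬝ᵥ v) ≤ v ⬝ᵥ (gkMoment *ᵥ v) := by
  obtain ⟨e1, e2, e3, e4, e5⟩ := gkMoment_enclosures
  rw [gkMoment_mulVec]
  simp only [dotProduct, Fin.sum_univ_three, Matrix.cons_val]
  have h1 := neg_mul_add_sq_le e1 (v 0) (v 0)
  have h2 := neg_mul_add_sq_le e2 (v 0) (v 1)
  have h3 := neg_mul_add_sq_le e3 (v 0) (v 2)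
  have h4 := neg_mul_add_sq_le e4 (v 1) (v 1)
  have h5 := neg_mul_add_sq_le e5 (v 1) (v 2)
  -- Gaussian elimination for the midpoint matrix, with `0.013` subtracted from the first two
  -- pivots. Using `0.013` rather than `0.012` leaves room for the entry errors.
  linarith [sq_nonneg ((10.8185121284 - 0.013) * v 0 - 7.5128556447 * v 1 - 4.8761883028 * v 2),
    sq_nonneg (((10.8185121284 - 0.013) * (5.5382100193 - 0.013) - 7.5128556447 ^ 2) * v 1 +
      ((10.8185121284 - 0.013) * 3.8761883028 - 7.5128556447 * 4.8761883028) * v 2),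
    sq_nonneg (v 0), sq_nonneg (v 1), sq_nonneg (v 2)]

lemma gkMoment_posDef : gkMoment.PosDef :=
  posDef_of_le (by norm_num) gkMoment_isHermitian gkMoment_lower

end

/-! ### Decimal values of the optimal coefficients and variances -/

section

/-- The optimal weights. -/
def optWeights : Fin 4 → ℝ := optimum unitCov 1

/-- The optimal Garman-Klass coefficients. -/
def optGK : Fin 3 → ℝ := optimum gkMoment gkMean

/-- The variance of the optimal weighted estimator for `σ = 1`. -/
def optVariance : ℝ := ((1 : Fin 4 → ℝ) ⬝ᵥ (unitCov⁻¹ *ᵥ 1))⁻¹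

/-- The second moment of the optimal Garman-Klass estimator for `σ = 1`. -/
def optGKMoment : ℝ := (gkMean ⬝ᵥ (gkMoment⁻¹ *ᵥ gkMean))⁻¹

lemma gkMean_ne_zero : gkMean ≠ 0 := fun h => by
  have h2 : (-1 : ℝ) = 0 := congrFun h 2
  norm_num at h2

lemma unitCov_mulVec_optWeights : unitCov *ᵥ optWeights = optVariance • 1 :=
  mulVec_optimum unitCov_posDef

lemma gkMoment_mulVec_optGK : gkMoment *ᵥ optGK = optGKMoment • gkMean :=
  mulVec_optimum gkMoment_posDef

lemma one_dotProduct_optWeights : 1 ⬝ᵥ optWeights = 1 :=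
  dotProduct_optimum unitCov_posDef one_ne_zero

lemma gkMean_dotProduct_optGK : gkMean ⬝ᵥ optGK = 1 :=
  dotProduct_optimum gkMoment_posDef gkMean_ne_zero

lemma sq_le_of_abs_le {a d : ℝ} (h : |a| ≤ d) : a * a ≤ d * d := by
  have := mul_self_le_mul_self (abs_nonneg a) h
  rwa [abs_mul_abs_self] at this

lemma optWeights_approx :
    (∀ i, |optWeights i - roundedWeights i| ≤ 0.0000005) ∧
      |optVariance - 0.2586582542| ≤ 0.00000005 := by
  obtain ⟨t, ht, h⟩ := exists_unitCov_eq
  obtain ⟨a1, a2⟩ := abs_le.1 ht.e00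
  obtain ⟨b1, b2⟩ := abs_le.1 ht.e02
  obtain ⟨c1, c2⟩ := abs_le.1 ht.e03
  obtain ⟨d1, d2⟩ := abs_le.1 ht.e13
  obtain ⟨e1, e2⟩ := abs_le.1 ht.e22
  obtain ⟨f1, f2⟩ := abs_le.1 ht.e23
  obtain ⟨g1, g2⟩ := abs_le.1 ht.e33
  -- A decimal solution of the stationarity equations whose coordinates sum to exactly `1`, as the
  -- constraint demands.
  let r : Fin 4 → ℝ := ![0.273520168276, 0.160358053233, 0.365211736712, 0.200910041779]
  obtain ⟨ρ, hρ⟩ : ∃ ρ, ρ = unitCov *ᵥ r - (0.2586582542 : ℝ) • 1 := ⟨_, rfl⟩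
  have hρi : ∀ i, |ρ i| ≤ 0.000000025 := by
    intro i
    rw [hρ, h]
    fin_cases i <;>
      simp [covPattern, r, abs_le] <;>
      constructor <;> linarith
  have hρ2 : ρ ⬝ᵥ ρ ≤ 0.0000000000000025 := by
    have h0 := sq_le_of_abs_le (hρi 0)
    have h1 := sq_le_of_abs_le (hρi 1)
    have h2 := sq_le_of_abs_le (hρi 2)
    have h3 := sq_le_of_abs_le (hρi 3)
    simp only [dotProduct, Fin.sum_univ_four]
    linarith
  have hr : (1 : Fin 4 → ℝ) ⬝ᵥ r = 1 := by
    simp [dotProduct, Fin.sum_univ_four, r]; norm_num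
  have hρ' : unitCov *ᵥ r = (0.2586582542 : ℝ) • 1 + ρ := by rw [hρ]; abel
  obtain ⟨h1, h2, h3⟩ := optimum_approx (by norm_num) unitCov_isHermitian unitCov_lower
    unitCov_mulVec_optWeights one_dotProduct_optWeights hr hρ' hρ2
  have hrr : r ⬝ᵥ (unitCov *ᵥ r) = 0.2586582542 + r ⬝ᵥ ρ := by
    rw [hρ', dotProduct_add, dotProduct_smul, dotProduct_comm r 1, hr, smul_eq_mul, mul_one]
  have hrρ : |r ⬝ᵥ ρ| ≤ 0.000000026 := by
    obtain ⟨p0, q0⟩ := abs_le.1 (hρi 0)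
    obtain ⟨p1, q1⟩ := abs_le.1 (hρi 1)
    obtain ⟨p2, q2⟩ := abs_le.1 (hρi 2)
    obtain ⟨p3, q3⟩ := abs_le.1 (hρi 3)
    simp [dotProduct, Fin.sum_univ_four, r, abs_le]
    constructor <;> linarith
  obtain ⟨u1, u2⟩ := abs_le.1 hrρ
  constructor
  · intro i
    -- The residual norm is at most `5 · 10⁻⁸`, and dividing by the spectral bound `0.25` gives `2 ·
    -- 10⁻⁷`. Rounding `r` to six decimals costs less than the remaining `3 · 10⁻⁷`.
    have hi : |optWeights i - r i| ≤ 0.0000002 := abs_le_of_sq_le_sq ((h1 i).trans (by norm_num))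
      (by norm_num)
    obtain ⟨v1, v2⟩ := abs_le.1 hi
    rw [abs_le]
    fin_cases i <;> simp [r, roundedWeights] at v1 v2 ⊢ <;> constructor <;> linarith
  · rw [abs_le]
    norm_num at h2
    constructor <;> linarith

lemma roundedWeights_variance :
    |roundedWeights ⬝ᵥ (unitCov *ᵥ roundedWeights) - 0.2586582542| ≤ 0.00000005 := by
  obtain ⟨t, ht, h⟩ := exists_unitCov_eq
  obtain ⟨a1, a2⟩ := abs_le.1 ht.e00
  obtain ⟨b1, b2⟩ := abs_le.1 ht.e02
  obtain ⟨c1, c2⟩ := abs_le.1 ht.e03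
  obtain ⟨d1, d2⟩ := abs_le.1 ht.e13
  obtain ⟨e1, e2⟩ := abs_le.1 ht.e22
  obtain ⟨f1, f2⟩ := abs_le.1 ht.e23
  obtain ⟨g1, g2⟩ := abs_le.1 ht.e33
  rw [h]
  simp [covPattern, Matrix.mulVec, dotProduct, Fin.sum_univ_four, roundedWeights, abs_le]
  constructor <;> linarith

lemma abs_mul_sub_mul_le {a b a₀ b₀ d : ℝ} (ha : |a - a₀| ≤ d) (hb : |b - b₀| ≤ d) (hb1 : |b| ≤ 1)
    (ha5 : |a₀| ≤ 5) : |a * b - a₀ * b₀| ≤ 6 * d := by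
  have hd : 0 ≤ d := (abs_nonneg _).trans ha
  calc |a * b - a₀ * b₀| = |(a - a₀) * b + a₀ * (b - b₀)| := by congr 1; ring
    _ ≤ |a - a₀| * |b| + |a₀| * |b - b₀| := by
        rw [← abs_mul, ← abs_mul]; exact abs_add_le _ _
    _ ≤ d * 1 + 5 * d := add_le_add (mul_le_mul ha hb1 (abs_nonneg _) hd)
        (mul_le_mul ha5 hb (abs_nonneg _) (by norm_num))
    _ = 6 * d := by ring

lemma optGK_approx :
    (∀ k, |optGK k - roundedGK k| ≤ 0.0005) ∧ |optGKMoment - 1.268581| ≤ 0.000001 := by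
  obtain ⟨e1, e2, e3, e4, e5⟩ := gkMoment_enclosures
  have l1 := Real.log_two_gt_d9
  have l2 := Real.log_two_lt_d9
  -- The third coordinate is solved from the constraint, so that the approximate coefficients are
  -- exactly unbiased. It therefore involves `log 2`, and its products with matrix entries need the
  -- bilinear error bound.
  obtain ⟨s, hs⟩ : ∃ s, s = 4 * Real.log 2 * 0.510995088 +
    (1 - 4 * Real.log 2) * 0.018875478 - 1 := ⟨_, rfl⟩
  have hs0 : |s - 0.383320759| ≤ 0.00000001 := by
    rw [hs, abs_le]; constructor <;> linarith
  have hs1 : |s| ≤ 1 := by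
    obtain ⟨p, q⟩ := abs_le.1 hs0
    rw [abs_le]; constructor <;> linarith
  have p1 := abs_mul_sub_mul_le (a₀ := -4.8761883028) (by rwa [sub_neg_eq_add]) hs0 hs1
    (by norm_num [abs_le])
  have p2 := abs_mul_sub_mul_le e5 hs0 hs1 (by norm_num [abs_le])
  rw [abs_le] at e1 e2 e3 e4 e5 p1 p2 hs0
  let r : Fin 3 → ℝ := ![0.510995088, 0.018875478, s]
  obtain ⟨ρ, hρ⟩ : ∃ ρ, ρ = gkMoment *ᵥ r - (1.2685810871 : ℝ) • gkMean := ⟨_, rfl⟩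
  have hρi : ∀ i, |ρ i| ≤ 0.0000002 := by
    intro i
    rw [hρ, gkMoment_mulVec]
    obtain ⟨_, _⟩ := e1
    obtain ⟨_, _⟩ := e2
    obtain ⟨_, _⟩ := e3
    obtain ⟨_, _⟩ := e4
    obtain ⟨_, _⟩ := e5
    obtain ⟨_, _⟩ := p1
    obtain ⟨_, _⟩ := p2
    obtain ⟨_, _⟩ := hs0
    fin_cases i <;> simp [r, gkMean, abs_le] <;> constructor <;> linarith
  have hρ2 : ρ ⬝ᵥ ρ ≤ 0.00000000000012 := by
    have h0 := sq_le_of_abs_le (hρi 0)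
    have h1 := sq_le_of_abs_le (hρi 1)
    have h2 := sq_le_of_abs_le (hρi 2)
    simp only [dotProduct, Fin.sum_univ_three]
    linarith
  have hr : gkMean ⬝ᵥ r = 1 := by
    simp [dotProduct, Fin.sum_univ_three, r, gkMean, hs]
  have hρ' : gkMoment *ᵥ r = (1.2685810871 : ℝ) • gkMean + ρ := by rw [hρ]; abel
  obtain ⟨h1, h2, h3⟩ := optimum_approx (by norm_num) gkMoment_isHermitian gkMoment_lower
    gkMoment_mulVec_optGK gkMean_dotProduct_optGK hr hρ' hρ2
  have hrr : r ⬝ᵥ (gkMoment *ᵥ r) = 1.2685810871 + r ⬝ᵥ ρ := by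
    rw [hρ', dotProduct_add, dotProduct_smul, dotProduct_comm r gkMean, hr, smul_eq_mul, mul_one]
  have hrρ : |r ⬝ᵥ ρ| ≤ 0.0000006 := by
    have hri : ∀ i, |r i| ≤ 1 := by
      intro i
      fin_cases i
      · simp [r]; norm_num [abs_le]
      · simp [r]; norm_num [abs_le]
      · simpa [r] using hs1
    calc |r ⬝ᵥ ρ| ≤ ∑ i, |r i * ρ i| := Finset.abs_sum_le_sum_abs _ _
      _ ≤ ∑ i : Fin 3, 0.0000002 := Finset.sum_le_sum fun i _ => by
          rw [abs_mul]
          calc |r i| * |ρ i| ≤ 1 * 0.0000002 :=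
                mul_le_mul (hri i) (hρi i) (abs_nonneg _) zero_le_one
            _ = _ := one_mul _
      _ = _ := by norm_num
  obtain ⟨u1, u2⟩ := abs_le.1 hrρ
  constructor
  · intro i
    -- Here the residual norm, about `3.5 · 10⁻⁷`, is divided by the weaker spectral bound `0.012`.
    have hi : |optGK i - r i| ≤ 0.00003 := abs_le_of_sq_le_sq ((h1 i).trans (by norm_num))
      (by norm_num)
    obtain ⟨v1, v2⟩ := abs_le.1 hi
    obtain ⟨_, _⟩ := hs0
    rw [abs_le]
    fin_cases i <;> simp [r, roundedGK] at v1 v2 ⊢ <;> constructor <;> linarith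
  · rw [abs_le]
    norm_num at h2
    constructor <;> linarith

lemma roundedGK_variance :
    |roundedGK ⬝ᵥ (gkMoment *ᵥ roundedGK) - (gkMean ⬝ᵥ roundedGK) ^ 2 - 0.268642| ≤ 0.00001 := by
  obtain ⟨⟨_, _⟩, ⟨_, _⟩, ⟨_, _⟩, ⟨_, _⟩, ⟨_, _⟩⟩ := by
    simpa only [abs_le] using gkMoment_enclosures
  have l1 := Real.log_two_gt_d9
  have l2 := Real.log_two_lt_d9
  -- The rounded coefficients have mean `s ≈ 1.00011`, not `1`, so the variance needs the actual
  -- square of `s`.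
  obtain ⟨s, hs⟩ : ∃ s, s = gkMean ⬝ᵥ roundedGK := ⟨_, rfl⟩
  have hs' : s = 1.968 * Real.log 2 - 0.364 := by
    rw [hs]; simp [dotProduct, Fin.sum_univ_three, gkMean, roundedGK]; ring
  have s1 : 1.000113650 ≤ s := by rw [hs']; linarith
  have s2 : s ≤ 1.000113652 := by rw [hs']; linarith
  have s3 : 1.000113650 ^ 2 ≤ s ^ 2 := by gcongr
  have s4 : s ^ 2 ≤ 1.000113652 ^ 2 := by gcongr
  rw [← hs, gkMoment_mulVec]
  simp [dotProduct, Fin.sum_univ_three, roundedGK, abs_le]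
  constructor <;> linarith

end

/-! ### Symmetry reductions, optimality and the passage to general `σ` -/

section

section Reduction

/-- The symmetric combination of the basic estimators having the same moments as a quadratic
function of `(C, H, L)` against symmetric ones. -/
def symmWeights (p : Fin 6 → ℝ) : Fin 4 → ℝ :=
  ![(p 3 + p 5) / 4, p 0, (p 1 + p 2) / 4, meanHighLow * p 4]

/-- Since `gram` is invariant under `a ↔ b`, an estimator symmetric in `a, b` sees only the
symmetrisation of `p`, and the four basic estimators span all symmetric quadratics. -/
lemma momentForm_symmWeights (w : Fin 4 → ℝ) (p : Fin 6 → ℝ) :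
    momentForm (weightCoeff w) (weightCoeff w) p p = momentForm (weightCoeff w) (weightCoeff w)
      (weightCoeff (symmWeights p)) (weightCoeff (symmWeights p)) := by
  have := meanHighLow_pos.ne'
  rw [momentForm, momentForm, gram_eq]
  simp [Fin.sum_univ_succ, weightCoeff, symmWeights]
  field_simp
  ring

lemma meanForm_symmWeights (p : Fin 6 → ℝ) :
    meanForm p p = meanForm (weightCoeff (symmWeights p)) (weightCoeff (symmWeights p)) := by
  have := meanHighLow_pos.ne'
  rw [meanForm, meanForm, meanVec_eq]
  simp [Fin.sum_univ_succ, weightCoeff, symmWeights]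
  field_simp
  ring

/-- The Garman-Klass coefficients having the same moments as a quadratic function of `(c, h, l)`
against estimators of Garman-Klass form. -/
def gkReduction (A : Matrix (Fin 3) (Fin 3) ℝ) : Fin 3 → ℝ :=
  ![(A 1 1 + A 2 2) / 2, (A 1 1 + A 2 2 + A 1 2 + A 2 1) / 2,
    -(A 1 2 + A 2 1) / 2 - (A 0 0 + (A 0 1 + A 1 0 + A 0 2 + A 2 0) / 2 + (A 1 1 + A 2 2) / 2)]

/-- Averaging over the sign of `c` and over `a ↔ b` leaves four coefficients. Averaging also forces
that of `C (a + b)` to equal that of `a² + b²` plus half that of `a b`, which is exactly the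
constraint defining the Garman–Klass form. -/
lemma momentForm_gkReduction (g : Fin 3 → ℝ) (A : Matrix (Fin 3) (Fin 3) ℝ) :
    momentForm (gkCoeff g) (gkCoeff g) (flipCoeff A) (swapCoeff A) =
      momentForm (gkCoeff g) (gkCoeff g) (gkCoeff (gkReduction A)) (gkCoeff (gkReduction A)) := by
  rw [momentForm, momentForm, gram_eq]
  simp [Fin.sum_univ_succ, gkCoeff, gkReduction, flipCoeff, swapCoeff]
  ring

lemma meanForm_gkReduction (A : Matrix (Fin 3) (Fin 3) ℝ) :
    meanForm (flipCoeff A) (swapCoeff A) =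
      meanForm (gkCoeff (gkReduction A)) (gkCoeff (gkReduction A)) := by
  rw [meanForm, meanForm, meanVec_eq]
  simp [Fin.sum_univ_succ, gkCoeff, gkReduction, flipCoeff, swapCoeff]
  ring

end Reduction

variable {Ω : Type*} [MeasurableSpace Ω] {P : Measure Ω} {X : ℝ≥0 → Ω → ℝ} {σ : ℝ}

lemma memLp_weightedEst (hX : IsZeroDriftBM X σ P) (w : Fin 4 → ℝ) :
    MemLp (onPaths (weightedEst w) X) 2 P := by
  rw [weightedEst_eq]; exact memLp_piecewiseQuad hX _ _

lemma isUnbiased_weightedEst_iff (hX : IsZeroDriftBM X σ P) {w : Fin 4 → ℝ} :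
    IsUnbiased (onPaths (weightedEst w) X) (σ ^ 2) P ↔ 1 ⬝ᵥ w = 1 := by
  rw [weightedEst_eq, isUnbiased_piecewiseQuad_iff hX, meanForm_weightCoeff, one_dotProduct,
    Fin.sum_univ_four]

lemma covariance_weightedEst (hX : IsZeroDriftBM X σ P) (w v : Fin 4 → ℝ) :
    cov[onPaths (weightedEst w) X, onPaths (weightedEst v) X; P] =
      σ ^ 4 * (w ⬝ᵥ (unitCov *ᵥ v)) := by
  rw [weightedEst_eq, weightedEst_eq, covariance_piecewiseQuad hX, meanForm_weightCoeff,
    meanForm_weightCoeff, momentForm_weightCoeff]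

lemma variance_weightedEst (hX : IsZeroDriftBM X σ P) (w : Fin 4 → ℝ) :
    Var[onPaths (weightedEst w) X; P] = σ ^ 4 * (w ⬝ᵥ (unitCov *ᵥ w)) := by
  rw [← covariance_self (memLp_weightedEst hX w).aestronglyMeasurable.aemeasurable,
    covariance_weightedEst hX]

lemma covMatrix_eq (hX : IsZeroDriftBM X σ P) : covMatrix X P = σ ^ 4 • unitCov := by
  ext i j
  rw [covMatrix, Matrix.of_apply, basicEst_eq, basicEst_eq, covariance_weightedEst hX]
  simp

lemma covMatrix_posDef (hX : IsZeroDriftBM X σ P) : (covMatrix X P).PosDef := by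
  rw [covMatrix_eq hX]
  exact unitCov_posDef.smul (pow_pos hX.sigma_pos 4)

lemma inv_covMatrix_mulVec (hX : IsZeroDriftBM X σ P) :
    (covMatrix X P)⁻¹ *ᵥ 1 = (σ ^ 4)⁻¹ • (unitCov⁻¹ *ᵥ 1) := by
  have hs := hX.sigma_pos
  have h : (covMatrix X P)⁻¹ = (σ ^ 4)⁻¹ • unitCov⁻¹ := by
    apply Matrix.inv_eq_right_inv
    rw [covMatrix_eq hX, Matrix.smul_mul, Matrix.mul_smul, smul_smul,
      mul_inv_cancel₀ (pow_pos hs 4).ne', one_smul,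
      Matrix.mul_nonsing_inv _ (unitCov.isUnit_iff_isUnit_det.1 unitCov_posDef.isUnit)]
  rw [h, Matrix.smul_mulVec]

lemma inv_sum_inv_covMatrix (hX : IsZeroDriftBM X σ P) :
    ((1 : Fin 4 → ℝ) ⬝ᵥ ((covMatrix X P)⁻¹ *ᵥ 1))⁻¹ = σ ^ 4 * optVariance := by
  rw [inv_covMatrix_mulVec hX, dotProduct_smul, smul_eq_mul, mul_inv, inv_inv, optVariance]

lemma optWeights_eq (hX : IsZeroDriftBM X σ P) :
    optWeights = ((1 : Fin 4 → ℝ) ⬝ᵥ ((covMatrix X P)⁻¹ *ᵥ 1))⁻¹ • ((covMatrix X P)⁻¹ *ᵥ 1) := by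
  rw [inv_sum_inv_covMatrix hX, inv_covMatrix_mulVec hX, smul_smul, mul_assoc, mul_comm,
    mul_assoc, inv_mul_cancel₀ (pow_pos hX.sigma_pos 4).ne', mul_one]
  rfl

lemma dotProduct_unitCov_optWeights (v : Fin 4 → ℝ) :
    v ⬝ᵥ (unitCov *ᵥ optWeights) = optVariance * (1 ⬝ᵥ v) := by
  rw [unitCov_mulVec_optWeights, dotProduct_smul, smul_eq_mul, dotProduct_comm v]

lemma variance_optWeights (hX : IsZeroDriftBM X σ P) :
    Var[onPaths (weightedEst optWeights) X; P] = σ ^ 4 * optVariance := by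
  rw [variance_weightedEst hX, dotProduct_unitCov_optWeights, one_dotProduct_optWeights, mul_one]

theorem variance_optWeights_lt (hX : IsZeroDriftBM X σ P) {w : Fin 4 → ℝ} (hw : 1 ⬝ᵥ w = 1)
    (hne : w ≠ optWeights) :
    Var[onPaths (weightedEst optWeights) X; P] < Var[onPaths (weightedEst w) X; P] := by
  rw [variance_optWeights hX, variance_weightedEst hX]
  refine mul_lt_mul_of_pos_left ?_ (pow_pos hX.sigma_pos 4)
  -- `unitCov` maps the optimum to a multiple of the all-ones vector. All cross terms then depend on
  -- weight sums alone, and strict positivity gives uniqueness.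
  have h : 0 < (w - optWeights) ⬝ᵥ (unitCov *ᵥ (w - optWeights)) := by
    simpa using unitCov_posDef.dotProduct_mulVec_pos (sub_ne_zero.2 hne)
  rw [Matrix.mulVec_sub, dotProduct_sub, dotProduct_unitCov_optWeights, dotProduct_sub, hw,
    one_dotProduct_optWeights, sub_dotProduct,
    dotProduct_mulVec_comm unitCov_isHermitian optWeights w, dotProduct_unitCov_optWeights, hw] at h
  linarith

/-- Against the optimum, the competitor may be replaced by its symmetrised weights. Every weight
vector of sum `1` has the same second moment `optVariance + 1` with it, so the orthogonality
criterion applies. -/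
theorem variance_optWeights_le_quadForm (hX : IsZeroDriftBM X σ P) {A : Matrix (Fin 3) (Fin 3) ℝ}
    (hA : IsUnbiased (onPaths (fun x => quadForm A (S₂ x)) X) (σ ^ 2) P) :
    Var[onPaths (weightedEst optWeights) X; P] ≤
      Var[onPaths (fun x => quadForm A (S₂ x)) X; P] := by
  rw [quadForm_flip_eq] at hA ⊢
  rw [isUnbiased_piecewiseQuad_iff hX] at hA
  have hv := hA
  rw [meanForm_symmWeights, meanForm_weightCoeff, ← Fin.sum_univ_four, ← one_dotProduct] at hv
  have h1 := one_dotProduct_optWeights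
  have key : ∀ v : Fin 4 → ℝ, 1 ⬝ᵥ v = 1 → momentForm (weightCoeff optWeights)
      (weightCoeff optWeights) (weightCoeff v) (weightCoeff v) = optVariance + 1 := by
    intro v hv
    have h := momentForm_weightCoeff optWeights v
    rw [← Fin.sum_univ_four, ← Fin.sum_univ_four, ← one_dotProduct, ← one_dotProduct, h1, hv,
      dotProduct_mulVec_comm unitCov_isHermitian, dotProduct_unitCov_optWeights, hv] at h
    linarith
  rw [weightedEst_eq]
  refine variance_le_of_momentForm_eq hX ?_ hA ?_
  · rw [meanForm_weightCoeff, ← Fin.sum_univ_four, ← one_dotProduct, h1]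
  · rw [momentForm_symmWeights, key _ hv, key _ h1]

lemma memLp_garmanKlassEst (hX : IsZeroDriftBM X σ P) (g : Fin 3 → ℝ) :
    MemLp (onPaths (garmanKlassEst g) X) 2 P := by
  rw [garmanKlassEst_eq]; exact memLp_piecewiseQuad hX _ _

lemma isUnbiased_optGK (hX : IsZeroDriftBM X σ P) :
    IsUnbiased (onPaths (garmanKlassEst optGK) X) (σ ^ 2) P := by
  rw [garmanKlassEst_eq, isUnbiased_piecewiseQuad_iff hX, meanForm_gkCoeff, gkMean_dotProduct_optGK]

lemma variance_garmanKlassEst (hX : IsZeroDriftBM X σ P) (g : Fin 3 → ℝ) :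
    Var[onPaths (garmanKlassEst g) X; P] =
      σ ^ 4 * (g ⬝ᵥ (gkMoment *ᵥ g) - (gkMean ⬝ᵥ g) ^ 2) := by
  rw [garmanKlassEst_eq, variance_piecewiseQuad hX, momentForm_gkCoeff, meanForm_gkCoeff]

lemma dotProduct_gkMoment_optGK (v : Fin 3 → ℝ) :
    v ⬝ᵥ (gkMoment *ᵥ optGK) = optGKMoment * (gkMean ⬝ᵥ v) := by
  rw [gkMoment_mulVec_optGK, dotProduct_smul, smul_eq_mul, dotProduct_comm v]

/-- The same orthogonality argument, with the competitor reduced to Garman–Klass form; minimising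
second moments at fixed mean is minimising variance. -/
theorem variance_optGK_le_quadForm (hX : IsZeroDriftBM X σ P) {A : Matrix (Fin 3) (Fin 3) ℝ}
    (hA : IsUnbiased (onPaths (fun x => quadForm A (S₁ x)) X) (σ ^ 2) P) :
    Var[onPaths (garmanKlassEst optGK) X; P] ≤
      Var[onPaths (fun x => quadForm A (S₁ x)) X; P] := by
  rw [quadForm_raw_eq] at hA ⊢
  rw [isUnbiased_piecewiseQuad_iff hX] at hA
  have hv := hA
  rw [meanForm_gkReduction, meanForm_gkCoeff] at hv
  rw [garmanKlassEst_eq]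
  refine variance_le_of_momentForm_eq hX ?_ hA ?_
  · rw [meanForm_gkCoeff, gkMean_dotProduct_optGK]
  · rw [momentForm_gkReduction, momentForm_gkCoeff, momentForm_gkCoeff,
      dotProduct_mulVec_comm gkMoment_isHermitian, dotProduct_gkMoment_optGK,
      dotProduct_gkMoment_optGK, hv, gkMean_dotProduct_optGK]

lemma variance_closeSpread_sq (hX : IsZeroDriftBM X σ P) :
    Var[onPaths (fun x => closeSpread x ^ 2) X; P] = σ ^ 4 * 2 := by
  rw [closeSpread_sq_eq, variance_weightedEst hX]
  simp [unitCov]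

lemma abs_variance_weights_le {w : Fin 4 → ℝ} (hw : w = optWeights ∨ w = roundedWeights) :
    |w ⬝ᵥ (unitCov *ᵥ w) - 0.2586582542| ≤ 0.00000005 := by
  rcases hw with rfl | rfl
  · rw [dotProduct_unitCov_optWeights, one_dotProduct_optWeights, mul_one]
    exact optWeights_approx.2
  · exact roundedWeights_variance

lemma one_dotProduct_weights {w : Fin 4 → ℝ} (hw : w = optWeights ∨ w = roundedWeights) :
    1 ⬝ᵥ w = 1 := by
  rcases hw with rfl | rfl
  · exact one_dotProduct_optWeights
  · simp [one_dotProduct, Fin.sum_univ_four, roundedWeights]; norm_num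

lemma abs_variance_gk_le {b : Fin 3 → ℝ} (hb : b = optGK ∨ b = roundedGK) :
    |b ⬝ᵥ (gkMoment *ᵥ b) - (gkMean ⬝ᵥ b) ^ 2 - 0.2686| ≤ 0.0001 := by
  rcases hb with rfl | rfl
  · rw [dotProduct_gkMoment_optGK, gkMean_dotProduct_optGK]
    have h := abs_le.1 optGK_approx.2
    rw [abs_le]; constructor <;> linarith [h.1, h.2]
  · have h := abs_le.1 roundedGK_variance
    rw [abs_le]; constructor <;> linarith [h.1, h.2]

lemma abs_mul_sub_mul_le_mul {s v a d : ℝ} (hs : 0 ≤ s) (h : |v - a| ≤ d) :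
    |s * v - a * s| ≤ d * s := by
  rw [mul_comm a, ← mul_sub, abs_mul, abs_of_nonneg hs, mul_comm]
  exact mul_le_mul_of_nonneg_right h hs

end

end GarmanKlass
end

/-! ### Assembly of the main theorem -/

theorem mainTheorem1 :
    ∃ (α : Fin 4 → ℝ) (g : Fin 3 → ℝ),
      (∀ i, |α i - GarmanKlass.roundedWeights i| ≤ 0.0000005) ∧
      (∀ k, |g k - GarmanKlass.roundedGK k| ≤ 0.0005) ∧
      ∀ (Ω : Type*) [MeasurableSpace Ω] (P : Measure Ω) (X : ℝ≥0 → Ω → ℝ) (σ : ℝ),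
        GarmanKlass.IsZeroDriftBM X σ P →
        -- the basic estimators are square integrable and unbiased
        (∀ i, MemLp (GarmanKlass.onPaths (GarmanKlass.basicEst i) X) 2 P ∧
          GarmanKlass.IsUnbiased (GarmanKlass.onPaths (GarmanKlass.basicEst i) X) (σ ^ 2) P) ∧
        -- `α = Σ⁻¹ 1 / (1ᵀ Σ⁻¹ 1)`, with variance `1 / (1ᵀ Σ⁻¹ 1)`
        (GarmanKlass.covMatrix X P).PosDef ∧
        α = ((1 : Fin 4 → ℝ) ⬝ᵥ ((GarmanKlass.covMatrix X P)⁻¹ *ᵥ 1))⁻¹ •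
          ((GarmanKlass.covMatrix X P)⁻¹ *ᵥ 1) ∧
        Var[GarmanKlass.onPaths (GarmanKlass.weightedEst α) X; P] =
          ((1 : Fin 4 → ℝ) ⬝ᵥ ((GarmanKlass.covMatrix X P)⁻¹ *ᵥ 1))⁻¹ ∧
        -- `α` is the unique minimizer among unbiased combinations of the basic estimators
        (∀ w : Fin 4 → ℝ,
          GarmanKlass.IsUnbiased (GarmanKlass.onPaths (GarmanKlass.weightedEst w) X) (σ ^ 2) P →
          w ≠ α →
          Var[GarmanKlass.onPaths (GarmanKlass.weightedEst α) X; P] <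
            Var[GarmanKlass.onPaths (GarmanKlass.weightedEst w) X; P]) ∧
        -- it is also best among all unbiased quadratic functions of `S₂`
        (∀ A : Matrix (Fin 3) (Fin 3) ℝ,
          GarmanKlass.IsUnbiased
            (GarmanKlass.onPaths (fun x => GarmanKlass.quadForm A (GarmanKlass.S₂ x)) X)
            (σ ^ 2) P →
          Var[GarmanKlass.onPaths (GarmanKlass.weightedEst α) X; P] ≤
            Var[GarmanKlass.onPaths (fun x => GarmanKlass.quadForm A (GarmanKlass.S₂ x)) X; P]) ∧
        -- `g` gives the best unbiased quadratic function of `S₁`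
        GarmanKlass.IsUnbiased (GarmanKlass.onPaths (GarmanKlass.garmanKlassEst g) X) (σ ^ 2) P ∧
        (∀ A : Matrix (Fin 3) (Fin 3) ℝ,
          GarmanKlass.IsUnbiased
            (GarmanKlass.onPaths (fun x => GarmanKlass.quadForm A (GarmanKlass.S₁ x)) X)
            (σ ^ 2) P →
          Var[GarmanKlass.onPaths (GarmanKlass.garmanKlassEst g) X; P] ≤
            Var[GarmanKlass.onPaths (fun x => GarmanKlass.quadForm A (GarmanKlass.S₁ x)) X; P]) ∧
        -- the proposed estimator, with exact or rounded weights, against Garman-Klass, with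
        -- exact or rounded coefficients
        (∀ w : Fin 4 → ℝ, (w = α ∨ w = GarmanKlass.roundedWeights) →
          MemLp (GarmanKlass.onPaths (GarmanKlass.weightedEst w) X) 2 P ∧
          GarmanKlass.IsUnbiased (GarmanKlass.onPaths (GarmanKlass.weightedEst w) X) (σ ^ 2) P ∧
          |Var[GarmanKlass.onPaths (GarmanKlass.weightedEst w) X; P] - 0.258658 * σ ^ 4| ≤
            0.0000005 * σ ^ 4 ∧
          |Var[GarmanKlass.onPaths (fun x => GarmanKlass.closeSpread x ^ 2) X; P] /
            Var[GarmanKlass.onPaths (GarmanKlass.weightedEst w) X; P] - 7.7322| ≤ 0.00005 ∧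
          ∀ b : Fin 3 → ℝ, (b = g ∨ b = GarmanKlass.roundedGK) →
            MemLp (GarmanKlass.onPaths (GarmanKlass.garmanKlassEst b) X) 2 P ∧
            |Var[GarmanKlass.onPaths (GarmanKlass.garmanKlassEst b) X; P] - 0.27 * σ ^ 4| ≤
              0.005 * σ ^ 4 ∧
            Var[GarmanKlass.onPaths (GarmanKlass.weightedEst w) X; P] <
              Var[GarmanKlass.onPaths (GarmanKlass.garmanKlassEst b) X; P]) := by
  refine ⟨GarmanKlass.optWeights, GarmanKlass.optGK, GarmanKlass.optWeights_approx.1,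
    GarmanKlass.optGK_approx.1, ?_⟩
  intro Ω _ P X σ hX
  have hs : 0 < σ ^ 4 := pow_pos hX.sigma_pos 4
  refine ⟨fun i => ?_, GarmanKlass.covMatrix_posDef hX, GarmanKlass.optWeights_eq hX, ?_,
    fun w hw hne => GarmanKlass.variance_optWeights_lt hX
      ((GarmanKlass.isUnbiased_weightedEst_iff hX).1 hw) hne,
    fun A hA => GarmanKlass.variance_optWeights_le_quadForm hX hA,
    GarmanKlass.isUnbiased_optGK hX,
    fun A hA => GarmanKlass.variance_optGK_le_quadForm hX hA, fun w hw => ?_⟩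
  · rw [GarmanKlass.basicEst_eq]
    refine ⟨GarmanKlass.memLp_weightedEst hX _, (GarmanKlass.isUnbiased_weightedEst_iff hX).2 ?_⟩
    simp
  · rw [GarmanKlass.variance_optWeights hX, GarmanKlass.inv_sum_inv_covMatrix hX]
  · have hv := GarmanKlass.abs_variance_weights_le hw
    have hvar := GarmanKlass.variance_weightedEst hX w
    set v := w ⬝ᵥ (GarmanKlass.unitCov *ᵥ w)
    obtain ⟨hv1, hv2⟩ := abs_le.1 hv
    refine ⟨GarmanKlass.memLp_weightedEst hX w, (GarmanKlass.isUnbiased_weightedEst_iff hX).2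
      (GarmanKlass.one_dotProduct_weights hw), ?_, ?_, fun b hb => ?_⟩
    · rw [hvar]
      refine GarmanKlass.abs_mul_sub_mul_le_mul hs.le ?_
      rw [abs_le]; constructor <;> linarith
    · have hv0 : 0 < v := by linarith
      -- The powers of `σ` cancel and the efficiency is `2 / v`; clearing the positive denominator
      -- leaves linear inequalities in `v`.
      rw [hvar, GarmanKlass.variance_closeSpread_sq hX, mul_div_mul_left _ _ hs.ne', abs_le,
        neg_le_sub_iff_le_add, sub_le_iff_le_add, ← sub_le_iff_le_add, le_div_iff₀ hv0,
        div_le_iff₀ hv0]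
      constructor <;> linarith
    -- The variance intervals around `0.25866` and `0.2686` are disjoint, so all four pairings of
    -- exact and rounded coefficients are settled together.
    · obtain ⟨hb1, hb2⟩ := abs_le.1 (GarmanKlass.abs_variance_gk_le hb)
      rw [hvar, GarmanKlass.variance_garmanKlassEst hX]
      refine ⟨GarmanKlass.memLp_garmanKlassEst hX b,
        GarmanKlass.abs_mul_sub_mul_le_mul hs.le ?_, mul_lt_mul_of_pos_left (by linarith) hs⟩
      rw [abs_le]; constructor <;> linarith
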